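/- **Setting.** Let $n\ge 2$ and $1\le d\le n$. Let $\mathbb G_{d,n}$ be the Grassmannian of $d$-dimensional subspaces of $\mathbb R^n$; a subspace $S$ is identified with the orthogonal projection onto $S$, and the distance is the operator norm $\|S-T\|$. A $d$-varifold is a nonnegative Radon measure $V$ on $\mathbb R^n\times\mathbb G_{d,n}$; its mass measure is $\|V\|(A)=V(A\times\mathbb G_{d,n})$. For a $C^1$ diffeomorphism $f$ of $\mathbb R^n$, the push-forward $f_\#V$ is the varifold $$f_\#V(\phi)=\int \phi\big(f(x),Df(x)(S)\big)\,J_Sf(x)\,dV(x,S),\qquad J_Sf(x)=\det(Y^tY)^{1/2},$$ where the columns of $Y$ are the images under $Df(x)$ of an orthonormal basis of $S$. For finite measures $\mu,\nu$ on a metric space $X$, the bounded Lipschitz distance $\Delta(\mu,\nu)$ is the supremum of $|\int\phi\,d\mu-\int\phi\,d\nu|$ over all $\phi:X\to[0,1]$ that are $1$-Lipschitz; on $\mathbb R^n\times\mathbb G_{d,n}$ the product metric $\max\{|x-y|,\|S-T\|\}$ is used. Weak-$*$ convergence of Radon measures, $\mu_j\overset{*}{\rightharpoonup}\mu$, means $\int\phi\,d\mu_j\to\int\phi\,d\mu$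 for every continuous compactly supported $\phi\ge 0$. Let $\psi\in C^\infty(\mathbb R^n)$ be radially symmetric with $0\le\psi\le1$, $\psi(x)=1$ for $|x|\le\frac12$, $\psi(x)=0$ for $|x|\ge1$, $|\nabla\psi|\le K_1$ and $\|\nabla^2\psi\|\le K_2$. For $\epsilon\in(0,1)$ put $$\hat\Phi_\epsilon(x)=(2\pi\epsilon^2)^{-n/2}e^{-|x|^2/(2\epsilon^2)},\qquad \Phi_\epsilon=\frac{\psi\,\hat\Phi_\epsilon}{\int_{\mathbb R^n}\psi\hat\Phi_\epsilon\,dx}.$$ For a varifold $V$ of finite mass let $$(\Phi_\epsilon*\|V\|)(x)=\int\Phi_\epsilon(y-x)\,d\|V\|(y),\qquad (\Phi_\epsilon*\delta V)(x)=\int S\big(\nabla\Phi_\epsilon(y-x)\big)\,dV(y,S),$$ $$h_\epsilon(\cdot,V)=\Phi_\epsilon*\tilde h_\epsilon(\cdot,V),\qquad \tilde h_\epsilon(\cdot,V)=-\frac{\Phi_\epsilon*\delta V}{\Phi_\epsilon*\|V\|+\epsilon}.$$ A subdivision of $[0,1]$ is a finite sequence $\mathcal T$: $0=t_0<t_1<\dots<t_m=1$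 with $m\ge1$; its mesh is $\delta(\mathcal T)=\max_{1\le i\le m}(t_i-t_{i-1})$. The time-discrete approximate mean curvature flow from $V_0$ with respect to $\mathcal T$ is defined by $V_{\epsilon,\mathcal T}(0)=V_0$ and, for $t\in[t_i,t_{i+1}]$ and $i=0,\dots,m-1$ successively, $$V_{\epsilon,\mathcal T}(t)=\big[\mathrm{id}+(t-t_i)\,h_\epsilon(\cdot,V_{\epsilon,\mathcal T}(t_i))\big]_\#V_{\epsilon,\mathcal T}(t_i).$$ **Theorem.** There is a constant $c_3>0$ depending only on $n,K_1,K_2$ such that the following holds for every $d$ with $1\le d\le n$, every $\psi$ as above, every $\epsilon\in(0,1)$, every $M\ge1$ and every $d$-varifold $V_0$ with compact support and $\|V_0\|(\mathbb R^n)\le M$. If $\mathcal T$ is a subdivision of $[0,1]$ with $c_3\,\delta(\mathcal T)\le(M+1)^{-3}\epsilon^8$, then the flow $V_{\epsilon,\mathcal T}$ is well defined: each map $\mathrm{id}+\tau\,h_\epsilon(\cdot,V_{\epsilon,\mathcal T}(t_i))$ with $0\le i<m$ and $0\le\tau\le t_{i+1}-t_i$ is a $C^1$ diffeomorphism of $\mathbb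 R^n$, and for every $t\in[0,1]$, $V_{\epsilon,\mathcal T}(t)$ is a varifold with $\|V_{\epsilon,\mathcal T}(t)\|(\mathbb R^n)\le M+1$. Moreover, there is a family $(V_\epsilon(t))_{t\in[0,1]}$ of $d$-varifolds such that: 1. With $\mathcal T^D_j=\{k2^{-j}\}_{k=0}^{2^j}$ the dyadic subdivisions, for every $t\in[0,1]$: $\|V_\epsilon(t)\|(\mathbb R^n)\le M+1$, and as $j\to\infty$, $V_{\epsilon,\mathcal T^D_j}(t)\overset{*}{\rightharpoonup}V_\epsilon(t)$ and $\Delta(V_{\epsilon,\mathcal T^D_j}(t),V_\epsilon(t))\to0$. 2. For every sequence $(\mathcal T_j)_j$ of subdivisions of $[0,1]$ with $\delta(\mathcal T_j)\to0$ and every $t\in[0,1]$: $V_{\epsilon,\mathcal T_j}(t)\overset{*}{\rightharpoonup}V_\epsilon(t)$ and $\Delta(V_{\epsilon,\mathcal T_j}(t),V_\epsilon(t))\to0$ as $j\to\infty$, with the same family $V_\epsilon$. 3. The limit flow is unique: if a family $(W(t))_{t\in[0,1]}$ of $d$-varifolds satisfies $V_{\epsilon,\mathcal T_j}(t)\overset{*}{\rightharpoonup}W(t)$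 for all $t\in[0,1]$, for some sequence of subdivisions of $[0,1]$ with $\delta(\mathcal T_j)\to0$, then $W(t)=V_\epsilon(t)$ for all $t\in[0,1]$. (In 1 and 2 the flows are well defined for all large $j$.) -/

import Mathlib

open MeasureTheory Filter Topology Set
open scoped ENNReal ContDiff

noncomputable section

namespace VarifoldFlow

/-- The ambient Euclidean space. -/
abbrev E (n : ℕ) : Type := EuclideanSpace ℝ (Fin n)

/-! ### The Grassmannian -/

/-- The Grassmannian of `d`-dimensional vector subspaces of `ℝⁿ`. -/
def Gr (d n : ℕ) : Type := {S : Submodule ℝ (E n) // Module.finrank ℝ S = d}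

/-- The orthogonal projection onto a `d`-plane, as an endomorphism of `ℝⁿ`. -/
def Gr.proj {d n : ℕ} (S : Gr d n) : E n →L[ℝ] E n := S.1.starProjection

theorem Gr.proj_injective (d n : ℕ) : Function.Injective (Gr.proj : Gr d n → (E n →L[ℝ] E n)) :=
  fun _ _ h => Subtype.ext (Submodule.starProjection_inj.1 h)

/-- The distance of `S` and `T` is the operator norm of the difference of the projections. -/
instance (d n : ℕ) : MetricSpace (Gr d n) :=
  MetricSpace.induced Gr.proj (Gr.proj_injective d n) inferInstance

instance (d n : ℕ) : MeasurableSpace (Gr d n) := borel (Gr d n)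

instance (d n : ℕ) : BorelSpace (Gr d n) := ⟨rfl⟩

open Classical in
/-- The image `L(S)` of a `d`-plane. It is a `d`-plane whenever `L` is injective; the second
branch is only a default value. -/
def Gr.image {d n : ℕ} (L : E n →L[ℝ] E n) (S : Gr d n) : Gr d n :=
  if h : Module.finrank ℝ (S.1.map (L : E n →ₗ[ℝ] E n)) = d then
    ⟨S.1.map (L : E n →ₗ[ℝ] E n), h⟩
  else S

/-- The tangential Jacobian `det (Yᵗ Y) ^ (1/2)`, where the columns of `Y` are the images under `L`
of an orthonormal basis of `S`; `Yᵗ Y` is the Gram matrix of these images. -/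
def tangentialJacobian {d n : ℕ} (L : E n →L[ℝ] E n) (S : Gr d n) : ℝ :=
  Real.sqrt (Matrix.gram ℝ fun i => L (stdOrthonormalBasis ℝ S.1 i : E n)).det

/-! ### Varifolds -/

/-- A `d`-varifold in `ℝⁿ` is a nonnegative Radon measure on `ℝⁿ × Gr d n`. -/
def IsVarifold {d n : ℕ} (V : Measure (E n × Gr d n)) : Prop := V.Regular

/-- The mass measure `‖V‖` on `ℝⁿ`, `‖V‖(A) = V(A × Gr d n)`. -/
def massMeasure {d n : ℕ} (V : Measure (E n × Gr d n)) : Measure (E n) := V.map Prod.fst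

/-- The push-forward `f_# V`, that is, the measure
`φ ↦ ∫ φ(f(x), Df(x)(S)) J_S f(x) dV(x, S)`. -/
def pushforward {d n : ℕ} (f : E n → E n) (V : Measure (E n × Gr d n)) :
    Measure (E n × Gr d n) :=
  (V.withDensity fun p => ENNReal.ofReal (tangentialJacobian (fderiv ℝ f p.1) p.2)).map
    fun p => (f p.1, Gr.image (fderiv ℝ f p.1) p.2)

/-- `f` is a `C¹` diffeomorphism of `ℝⁿ`. -/
def IsC1Diffeo {n : ℕ} (f : E n → E n) : Prop :=
  ContDiff ℝ 1 f ∧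
    ∃ g : E n → E n, ContDiff ℝ 1 g ∧ Function.LeftInverse g f ∧ Function.RightInverse g f

/-! ### Convergence of measures -/

/-- The bounded Lipschitz distance of two finite measures on a metric space, as a supremum over
nonnegative functions bounded by `1` with Lipschitz constant at most `1`. -/
def boundedLipschitzDist {X : Type*} [MetricSpace X] [MeasurableSpace X] (μ ν : Measure X) :
    ℝ≥0∞ :=
  ⨆ φ ∈ {φ : X → ℝ | LipschitzWith 1 φ ∧ ∀ x, 0 ≤ φ x ∧ φ x ≤ 1},
    ENNReal.ofReal |∫ x, φ x ∂μ - ∫ x, φ x ∂ν|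

/-- Weak-* convergence: convergence against nonnegative continuous compactly supported
functions. -/
def WeakStarTendsto {X : Type*} [TopologicalSpace X] [MeasurableSpace X] (μ : ℕ → Measure X)
    (ν : Measure X) : Prop :=
  ∀ φ : X → ℝ, Continuous φ → HasCompactSupport φ → (∀ x, 0 ≤ φ x) →
    Tendsto (fun j => ∫ x, φ x ∂(μ j)) atTop (𝓝 (∫ x, φ x ∂ν))

/-! ### The regularization kernel and the approximate mean curvature -/

/-- A smooth radially symmetric cut-off function, equal to `1` on the ball of radius `1/2` and to
`0` outside the unit ball, with gradient bounded by `K₁` and Hessian bounded by `K₂`. -/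
structure IsCutoff {n : ℕ} (K₁ K₂ : ℝ) (ψ : E n → ℝ) : Prop where
  contDiff : ContDiff ℝ ∞ ψ
  radial : ∀ x y, ‖x‖ = ‖y‖ → ψ x = ψ y
  eq_one : ∀ x, ‖x‖ ≤ 1 / 2 → ψ x = 1
  eq_zero : ∀ x, 1 ≤ ‖x‖ → ψ x = 0
  nonneg : ∀ x, 0 ≤ ψ x
  le_one : ∀ x, ψ x ≤ 1
  gradient_le : ∀ x, ‖gradient ψ x‖ ≤ K₁
  hessian_le : ∀ x, ‖fderiv ℝ (gradient ψ) x‖ ≤ K₂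

/-- The Gaussian of width `ε`. -/
def gaussianKernel (n : ℕ) (ε : ℝ) (x : E n) : ℝ :=
  1 / (2 * Real.pi * ε ^ 2) ^ ((n : ℝ) / 2) * Real.exp (-(‖x‖ ^ 2 / (2 * ε ^ 2)))

/-- The truncated Gaussian `Φ_ε = c(ε) ψ Φ̂_ε`, normalized to have integral `1`. -/
def kernel {n : ℕ} (ψ : E n → ℝ) (ε : ℝ) (x : E n) : ℝ :=
  (1 / ∫ y, ψ y * gaussianKernel n ε y) * ψ x * gaussianKernel n ε x

/-- `(Φ_ε * ‖V‖)(x) = ∫ Φ_ε(y - x) d‖V‖(y)`. -/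
def smoothedMass {d n : ℕ} (ψ : E n → ℝ) (ε : ℝ) (V : Measure (E n × Gr d n)) (x : E n) : ℝ :=
  ∫ y, kernel ψ ε (y - x) ∂(massMeasure V)

/-- `(Φ_ε * δV)(x) = ∫ S(∇Φ_ε(y - x)) dV(y, S)`. -/
def smoothedFirstVariation {d n : ℕ} (ψ : E n → ℝ) (ε : ℝ) (V : Measure (E n × Gr d n))
    (x : E n) : E n :=
  ∫ p, p.2.proj (gradient (kernel ψ ε) (p.1 - x)) ∂V

/-- `h̃_ε(y, V) = - (Φ_ε * δV)(y) / ((Φ_ε * ‖V‖)(y) + ε)`. -/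
def preMeanCurvature {d n : ℕ} (ψ : E n → ℝ) (ε : ℝ) (V : Measure (E n × Gr d n)) (y : E n) :
    E n :=
  -((smoothedMass ψ ε V y + ε)⁻¹ • smoothedFirstVariation ψ ε V y)

/-- The approximate mean curvature `h_ε(x, V) = (Φ_ε * h̃_ε(·, V))(x)`. -/
def approxMeanCurvature {d n : ℕ} (ψ : E n → ℝ) (ε : ℝ) (V : Measure (E n × Gr d n))
    (x : E n) : E n :=
  ∫ y, kernel ψ ε (x - y) • preMeanCurvature ψ ε V y

/-! ### Time-discrete approximate mean curvature flows -/

/-- A subdivision `a = t₀ < t₁ < ⋯ < t_m = b` of `[a, b]` with `m ≥ 1`. The values `pt i` with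
`i > m` are not used. -/
structure Subdivision (a b : ℝ) where
  m : ℕ
  m_pos : 0 < m
  pt : ℕ → ℝ
  first : pt 0 = a
  last : pt m = b
  lt_succ : ∀ i < m, pt i < pt (i + 1)

/-- The mesh `δ(𝒯)`, the largest step of the subdivision. -/
def Subdivision.mesh {a b : ℝ} (T : Subdivision a b) : ℝ :=
  (Finset.range T.m).sup' (Finset.nonempty_range_iff.2 T.m_pos.ne') fun i => T.pt (i + 1) - T.pt i

/-- The dyadic subdivision of `[0, 1]` of mesh `2⁻ʲ`. -/
def dyadic (j : ℕ) : Subdivision 0 1 where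
  m := 2 ^ j
  m_pos := by positivity
  pt k := (k : ℝ) / 2 ^ j
  first := by simp
  last := by simp
  lt_succ k _ := by
    have : (0 : ℝ) < 2 ^ j := by positivity
    push_cast
    gcongr
    linarith

/-- The map `id + τ h_ε(·, V)`. -/
def eulerMap {d n : ℕ} (ψ : E n → ℝ) (ε τ : ℝ) (V : Measure (E n × Gr d n)) (x : E n) : E n :=
  x + τ • approxMeanCurvature ψ ε V x

/-- The values `V_{ε,𝒯}(t_i)` of the time-discrete flow at the points of the subdivision. -/
def nodeFlow {d n : ℕ} (ψ : E n → ℝ) (ε : ℝ) {a b : ℝ} (T : Subdivision a b)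
    (V₀ : Measure (E n × Gr d n)) : ℕ → Measure (E n × Gr d n)
  | 0 => V₀
  | i + 1 => pushforward (eulerMap ψ ε (T.pt (i + 1) - T.pt i) (nodeFlow ψ ε T V₀ i))
      (nodeFlow ψ ε T V₀ i)

open Classical in
/-- The largest index `i ≤ m - 1` with `t_i ≤ t`. -/
def Subdivision.index {a b : ℝ} (T : Subdivision a b) (t : ℝ) : ℕ :=
  Nat.findGreatest (fun i => T.pt i ≤ t) (T.m - 1)

/-- The time-discrete approximate mean curvature flow
`V_{ε,𝒯}(t) = (id + (t - t_i) h_ε(·, V_{ε,𝒯}(t_i)))_# V_{ε,𝒯}(t_i)` for `t ∈ [t_i, t_{i+1}]`. -/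
def discreteFlow {d n : ℕ} (ψ : E n → ℝ) (ε : ℝ) {a b : ℝ} (T : Subdivision a b)
    (V₀ : Measure (E n × Gr d n)) (t : ℝ) : Measure (E n × Gr d n) :=
  pushforward (eulerMap ψ ε (t - T.pt (T.index t)) (nodeFlow ψ ε T V₀ (T.index t)))
    (nodeFlow ψ ε T V₀ (T.index t))

theorem image_id {d n : ℕ} (S : Gr d n) :
    Gr.image (ContinuousLinearMap.id ℝ (E n)) S = S := by
  have h : S.1.map ((ContinuousLinearMap.id ℝ (E n)) : E n →ₗ[ℝ] E n) = S.1 := by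
    simp
  have h' : Module.finrank ℝ (S.1.map ((ContinuousLinearMap.id ℝ (E n)) : E n →ₗ[ℝ] E n)) = d := by
    rw [h]; exact S.2
  exact (dif_pos h').trans (Subtype.ext h)

theorem tangentialJacobian_id {d n : ℕ} (S : Gr d n) :
    tangentialJacobian (ContinuousLinearMap.id ℝ (E n)) S = 1 := by
  unfold tangentialJacobian
  have : Matrix.gram ℝ (fun i => (ContinuousLinearMap.id ℝ (E n))
      (stdOrthonormalBasis ℝ S.1 i : E n)) = 1 := by
    ext i j
    have h := orthonormal_iff_ite.1 (stdOrthonormalBasis ℝ S.1).orthonormal i j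
    rw [Matrix.gram_apply, Matrix.one_apply]
    simpa using h
  rw [this]; simp

theorem pushforward_id {d n : ℕ} (V : Measure (E n × Gr d n)) :
    pushforward (fun x => x) V = V := by
  unfold pushforward
  have h : ∀ x : E n, fderiv ℝ (fun x : E n => x) x = ContinuousLinearMap.id ℝ (E n) :=
    fun x => fderiv_fun_id
  simp only [h, tangentialJacobian_id, image_id]
  simp

theorem eulerMap_zero {d n : ℕ} (ψ : E n → ℝ) (ε : ℝ) (V : Measure (E n × Gr d n)) :
    eulerMap ψ ε 0 V = fun x => x := by
  funext x; simp [eulerMap]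

theorem Subdivision.pt_lt {a b : ℝ} (T : Subdivision a b) {i j : ℕ} (hij : i < j) (hj : j ≤ T.m) :
    T.pt i < T.pt j := by
  induction j, hij using Nat.le_induction with
  | base => exact T.lt_succ i (by omega)
  | succ k hk ih => exact (ih (by omega)).trans (T.lt_succ k (by omega))

/-- The flow is given by its interpolation formula on every closed interval `[t_i, t_{i+1}]`; at the
common endpoints the two formulas agree. -/
theorem discreteFlow_eq {d n : ℕ} (ψ : E n → ℝ) (ε : ℝ) {a b : ℝ} (T : Subdivision a b)
    (V₀ : Measure (E n × Gr d n)) {i : ℕ} (hi : i < T.m) {t : ℝ}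
    (ht : t ∈ Icc (T.pt i) (T.pt (i + 1))) :
    discreteFlow ψ ε T V₀ t =
      pushforward (eulerMap ψ ε (t - T.pt i) (nodeFlow ψ ε T V₀ i)) (nodeFlow ψ ε T V₀ i) := by
  classical
  have h1 : i ≤ T.index t := Nat.le_findGreatest (by omega) ht.1
  have h2 : T.index t ≤ T.m - 1 := Nat.findGreatest_le _
  have h3 : T.pt (T.index t) ≤ t :=
    Nat.findGreatest_spec (P := fun i => T.pt i ≤ t) (m := i) (by omega) ht.1
  rcases h1.eq_or_lt with h | h
  · rw [discreteFlow, ← h]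
  · have h4 : T.index t = i + 1 := by
      by_contra hne
      have := T.pt_lt (i := i + 1) (j := T.index t) (by omega) (by omega)
      linarith [ht.2]
    have h5 : t = T.pt (i + 1) := le_antisymm ht.2 (h4 ▸ h3)
    rw [discreteFlow, h4, h5, sub_self, eulerMap_zero, pushforward_id]
    rfl

end VarifoldFlow

end

open VarifoldFlow

/-! The proof replaces measures by Lagrangian states. A state is a pair `(u, A)` of bounded
continuous fields on ℝⁿ, a displacement and a linear deformation, and `stateMeasure V₀ (u, A)` is
`V₀` transported by `x ↦ x + u x` with `A x` acting on the planes. The tangential Jacobian and the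
action on planes are multiplicative under composition, so transports compose
(`Admissible.transport_transport`). Hence a push-forward by `id + τ h_ε` is exactly an explicit
Euler step `y + τ • velocity y` (`pushforward_eulerMap_stateMeasure`), and the time-discrete flow is
the image of an Euler polygon for an autonomous ODE in a Banach space.

The velocity is bounded and Lipschitz on states whose field satisfies `‖A x‖ ≤ R` and `‖v‖ ≤ R ‖A x
v‖` (`exists_velocity_bound`, `exists_velocity_lipschitz`): the curvature sees the varifold only
through integrals of bounded Lipschitz functions, with a denominator at least `ε`, and mollification
controls its derivatives. Two polygons that stay in this set are then close by Gronwall's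
inequality, with an error governed by the two meshes (`dist_eulerPolygon_le`). So they converge to a
limit that does not depend on the subdivisions (`exists_tendsto_eulerPolygon`).

It remains to keep the polygons in the set up to time 1 (`APriori.step`). A bound `B` for `‖D h_ε‖`,
valid for masses up to `M + 1`, gives exponential control of `A`. The mass needs a finer argument:
to first order in `τ` it changes by the integral of the trace of `D h_ε` over the planes, which by
Fubini is minus the integral of `|Φ_ε * δV|² / (Φ_ε * ‖V‖ + ε)` (`integral_planeTrace_nonpos`). Only
an error of order `τ² B² (M + 1)` is left (`mass_pushforward_eulerMap_le`), and the mesh condition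
makes it at most `τ`. Since `B` is of order `(M + 1) ε⁻⁴` (`norm_fderiv_approxMeanCurvature_le`),
this is the condition `δ(𝒯) ≲ (M + 1)⁻³ ε⁸`.

Convergence of states gives weak-* and bounded Lipschitz convergence of the transported measures
(`weakStarTendsto_stateMeasure`, `tendsto_boundedLipschitzDist_stateMeasure`). Uniqueness of the
limit flow is uniqueness of weak-* limits among regular measures (`WeakStarTendsto.unique`). -/

namespace VarifoldFlow

/-! ### The Grassmannian as a metric space -/

theorem Gr.dist_eq {d n : ℕ} (S T : Gr d n) : dist S T = ‖S.proj - T.proj‖ := by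
  rw [← dist_eq_norm]; rfl

theorem Gr.isometry_proj (d n : ℕ) : Isometry (Gr.proj : Gr d n → (E n →L[ℝ] E n)) :=
  Isometry.of_dist_eq fun _ _ => rfl

theorem Gr.norm_proj_le {d n : ℕ} (S : Gr d n) : ‖S.proj‖ ≤ 1 :=
  Submodule.starProjection_norm_le _

theorem Gr.norm_proj_apply_le {d n : ℕ} (S : Gr d n) (v : E n) : ‖S.proj v‖ ≤ ‖v‖ := by
  simpa using S.proj.le_of_opNorm_le S.norm_proj_le v

theorem Gr.proj_mem {d n : ℕ} (S : Gr d n) (v : E n) : S.proj v ∈ S.1 :=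
  Submodule.starProjection_apply_mem _ _

theorem Gr.proj_eq_self {d n : ℕ} (S : Gr d n) {v : E n} (hv : v ∈ S.1) : S.proj v = v :=
  Submodule.starProjection_eq_self_iff.2 hv

instance (d n : ℕ) : SecondCountableTopology (Gr d n) :=
  (Gr.isometry_proj d n).isEmbedding.secondCountableTopology

/-- The trace of a projection is the dimension of its range, so the rank condition becomes a closed
one. All three conditions are closed, which gives compactness of the Grassmannian. -/
theorem Gr.range_proj (d n : ℕ) : range (Gr.proj : Gr d n → (E n →L[ℝ] E n)) =
    {P | P ∘L P = P ∧ ContinuousLinearMap.adjoint P = P ∧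
      LinearMap.trace ℝ (E n) (P : E n →ₗ[ℝ] E n) = d} := by
  ext P
  constructor
  · rintro ⟨S, rfl⟩
    have h := isStarProjection_starProjection (U := S.1)
    refine ⟨h.isIdempotentElem, h.isSelfAdjoint, ?_⟩
    have hp : LinearMap.IsProj S.1 (S.proj : E n →ₗ[ℝ] E n) :=
      ⟨fun x => S.proj_mem x, fun x hx => S.proj_eq_self hx⟩
    rw [hp.trace, S.2]
  · rintro ⟨h1, h2, h3⟩
    have h : IsStarProjection P := ⟨h1, h2⟩
    obtain ⟨h4, h5⟩ := isStarProjection_iff_eq_starProjection_range.1 h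
    have hp : LinearMap.IsProj P.range (P : E n →ₗ[ℝ] E n) := by
      refine ⟨fun x => ⟨x, rfl⟩, ?_⟩
      rintro _ ⟨x, rfl⟩
      exact DFunLike.congr_fun h1 x
    refine ⟨⟨P.range, ?_⟩, h5.symm⟩
    rw [hp.trace] at h3
    exact_mod_cast h3

/-- Compactness makes `E n × Gr d n` locally compact and σ-compact; finite measures on it are then
automatically regular. -/
instance (d n : ℕ) : CompactSpace (Gr d n) := by
  have hc : IsClosed (range (Gr.proj : Gr d n → (E n →L[ℝ] E n))) := by
    rw [Gr.range_proj]
    refine IsClosed.inter (isClosed_eq (by fun_prop) continuous_id) (IsClosed.inter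
      (isClosed_eq (LinearIsometryEquiv.continuous _) continuous_id)
      (isClosed_eq ?_ continuous_const))
    exact LinearMap.continuous_of_finiteDimensional
      ((LinearMap.trace ℝ (E n)).comp (ContinuousLinearMap.coeLM ℝ))
  have hb : Bornology.IsBounded (range (Gr.proj : Gr d n → (E n →L[ℝ] E n))) := by
    refine (Metric.isBounded_closedBall (x := 0) (r := 1)).subset ?_
    rintro _ ⟨S, rfl⟩
    simpa using S.norm_proj_le
  have hk := Metric.isCompact_of_isClosed_isBounded hc hb
  exact ⟨by
    rw [(Gr.isometry_proj d n).isEmbedding.isInducing.isCompact_iff, image_univ]; exact hk⟩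

theorem isVarifold_of_isFiniteMeasure {d n : ℕ} (V : Measure (E n × Gr d n)) [IsFiniteMeasure V] :
    IsVarifold V :=
  Measure.Regular.of_sigmaCompactSpace_of_isLocallyFiniteMeasure V

/-! ### Images of planes -/

/-- `A` is bounded below by `R⁻¹`. -/
def LowerBound {n : ℕ} (R : ℝ) (A : E n →L[ℝ] E n) : Prop := ∀ v, ‖v‖ ≤ R * ‖A v‖

theorem LowerBound.injective {n : ℕ} {R : ℝ} {A : E n →L[ℝ] E n} (h : LowerBound R A) :
    Function.Injective A := by
  rw [injective_iff_map_eq_zero]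
  intro v hv
  have := h v
  rw [hv, norm_zero, mul_zero] at this
  exact norm_le_zero_iff.1 this

theorem Gr.coe_image {d n : ℕ} {A : E n →L[ℝ] E n} (hA : Function.Injective A) (S : Gr d n) :
    (Gr.image A S).1 = S.1.map (A : E n →ₗ[ℝ] E n) := by
  have h : Module.finrank ℝ (S.1.map (A : E n →ₗ[ℝ] E n)) = d := by
    exact (LinearEquiv.finrank_eq (S.1.equivMapOfInjective (A : E n →ₗ[ℝ] E n) hA)).symm.trans S.2
  simp [Gr.image, h]

theorem Gr.apply_mem_image {d n : ℕ} {A : E n →L[ℝ] E n} (hA : Function.Injective A) {S : Gr d n}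
    {v : E n} (hv : v ∈ S.1) : A v ∈ (Gr.image A S).1 := by
  rw [Gr.coe_image hA]; exact ⟨v, hv, rfl⟩

theorem Gr.image_comp {d n : ℕ} {A B : E n →L[ℝ] E n} (hA : Function.Injective A)
    (hB : Function.Injective B) (S : Gr d n) :
    Gr.image (B ∘L A) S = Gr.image B (Gr.image A S) := by
  apply Subtype.ext
  have hBA : Function.Injective (B ∘L A) := fun x y h => hA (hB h)
  rw [Gr.coe_image hBA, Gr.coe_image hB, Gr.coe_image hA, ← Submodule.map_comp]
  rfl

/-- `T.proj` picks the nearest point of `T`, so any competitor `w` in `T` bounds the distance from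
`v` to its projection. -/
theorem Gr.norm_sub_proj_proj_le {d n : ℕ} {S T : Gr d n} {c : ℝ}
    (h : ∀ v ∈ S.1, ∃ w ∈ T.1, ‖v - w‖ ≤ c * ‖v‖) (hc : 0 ≤ c) :
    ‖(1 - T.proj) ∘L S.proj‖ ≤ c := by
  refine ContinuousLinearMap.opNorm_le_bound _ hc fun x => ?_
  obtain ⟨w, hw, hvw⟩ := h (S.proj x) (S.proj_mem x)
  have h1 : ‖S.proj x - T.proj (S.proj x)‖ ≤ ‖S.proj x - w‖ := by
    have := Submodule.starProjection_minimal (U := T.1) (S.proj x)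
    rw [show T.proj (S.proj x) = T.1.starProjection (S.proj x) from rfl, this]
    exact ciInf_le ⟨0, by rintro _ ⟨y, rfl⟩; exact norm_nonneg _⟩ (⟨w, hw⟩ : T.1)
  calc _ = ‖S.proj x - T.proj (S.proj x)‖ := rfl
    _ ≤ c * ‖S.proj x‖ := h1.trans hvw
    _ ≤ c * ‖x‖ := by gcongr; exact S.norm_proj_apply_le x

/-- With `P`, `Q` the projections onto `S`, `T`, one has `P - Q = P (1 - Q) - (1 - P) Q`. The first
term is the adjoint of `(1 - Q) P`, so each term is a one-sided gap between the planes. -/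
theorem Gr.dist_le_of_forall_mem {d n : ℕ} {S T : Gr d n} {c : ℝ} (hc : 0 ≤ c)
    (hST : ∀ v ∈ S.1, ∃ w ∈ T.1, ‖v - w‖ ≤ c * ‖v‖)
    (hTS : ∀ v ∈ T.1, ∃ w ∈ S.1, ‖v - w‖ ≤ c * ‖v‖) : dist S T ≤ 2 * c := by
  have hS : ContinuousLinearMap.adjoint S.proj = S.proj :=
    (isStarProjection_starProjection (U := S.1)).isSelfAdjoint
  have hT : ContinuousLinearMap.adjoint T.proj = T.proj :=
    (isStarProjection_starProjection (U := T.1)).isSelfAdjoint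
  have h1 := Gr.norm_sub_proj_proj_le hST hc
  have h2 := Gr.norm_sub_proj_proj_le hTS hc
  have h3 : ‖S.proj ∘L (1 - T.proj)‖ ≤ c := by
    rw [← LinearIsometryEquiv.norm_map ContinuousLinearMap.adjoint,
      ContinuousLinearMap.adjoint_comp, hS, map_sub, hT]
    rwa [← ContinuousLinearMap.star_eq_adjoint, star_one]
  rw [Gr.dist_eq]
  have h4 : S.proj - T.proj = S.proj ∘L (1 - T.proj) - (1 - S.proj) ∘L T.proj := by
    ext x; simp
  rw [h4]
  linarith [norm_sub_le (S.proj ∘L (1 - T.proj)) ((1 - S.proj) ∘L T.proj)]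

/-- The competitor for `A u` is `B u`; the lower bound on `A` turns the error `‖A - B‖ ‖u‖` into a
multiple of `‖A u‖`. -/
theorem Gr.dist_image_image_le {d n : ℕ} {R : ℝ} {A B : E n →L[ℝ] E n} (hR : 0 ≤ R)
    (hA : LowerBound R A) (hB : LowerBound R B) (S : Gr d n) :
    dist (Gr.image A S) (Gr.image B S) ≤ 2 * (R * ‖A - B‖) := by
  have key : ∀ {A B : E n →L[ℝ] E n}, LowerBound R A → LowerBound R B →
      ∀ v ∈ (Gr.image A S).1, ∃ w ∈ (Gr.image B S).1, ‖v - w‖ ≤ R * ‖A - B‖ * ‖v‖ := by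
    intro A B hA hB v hv
    rw [Gr.coe_image hA.injective] at hv
    obtain ⟨u, hu, rfl⟩ := hv
    refine ⟨B u, Gr.apply_mem_image hB.injective hu, ?_⟩
    calc ‖A u - B u‖ = ‖(A - B) u‖ := rfl
      _ ≤ ‖A - B‖ * ‖u‖ := (A - B).le_opNorm u
      _ ≤ ‖A - B‖ * (R * ‖A u‖) := by gcongr; exact hA u
      _ = _ := by simp; ring
  refine Gr.dist_le_of_forall_mem (by positivity) (key hA hB) ?_
  have := key hB hA
  rwa [norm_sub_rev] at this

/-! ### The tangential Jacobian -/

theorem tangentialJacobian_nonneg {d n : ℕ} (A : E n →L[ℝ] E n) (S : Gr d n) :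
    0 ≤ tangentialJacobian A S := Real.sqrt_nonneg _

/-- `stdOrthonormalBasis` is indexed by `Fin (finrank S)`, a type depending on the plane. Reindexing
by `Fin d` gives `S` and its image a common index type, so that the change of basis between them is
a square matrix. -/
theorem exists_tangentialJacobian_eq {d n : ℕ} (S : Gr d n) :
    ∃ b : OrthonormalBasis (Fin d) ℝ S.1, ∀ A : E n →L[ℝ] E n,
      tangentialJacobian A S = Real.sqrt (Matrix.gram ℝ fun i => A (b i : E n)).det := by
  refine ⟨(stdOrthonormalBasis ℝ S.1).reindex (finCongr S.2), fun A => ?_⟩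
  unfold tangentialJacobian
  rw [← Matrix.det_submatrix_equiv_self (finCongr S.2).symm]
  congr 2
  ext i j
  simp [Matrix.gram_apply]

theorem gram_sum_smul {ι κ F : Type*} [Fintype ι] [NormedAddCommGroup F]
    [InnerProductSpace ℝ F] (m : Matrix ι κ ℝ) (g : ι → F) :
    Matrix.gram ℝ (fun j => ∑ i, m i j • g i) = m.transpose * Matrix.gram ℝ g * m := by
  ext j k
  simp only [Matrix.gram_apply, Matrix.mul_apply, Matrix.transpose_apply, sum_inner, inner_sum,
    real_inner_smul_left, real_inner_smul_right]
  refine Finset.sum_congr rfl fun i _ => ?_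
  rw [Finset.sum_mul]
  refine Finset.sum_congr rfl fun l _ => ?_
  ring

/-- Let `m` express the `A`-images of a basis of `S` in an orthonormal basis `c` of the image plane.
The Gram matrices are `mᵗ m` for `A` and `mᵗ G m` for `B ∘ A`, where `G` is the Gram matrix of the
`B (c i)`; taking determinants gives the product formula. -/
theorem tangentialJacobian_comp {d n : ℕ} {A : E n →L[ℝ] E n} (hA : Function.Injective A)
    (B : E n →L[ℝ] E n) (S : Gr d n) :
    tangentialJacobian (B ∘L A) S =
      tangentialJacobian B (Gr.image A S) * tangentialJacobian A S := by
  obtain ⟨b, hb⟩ := exists_tangentialJacobian_eq S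
  obtain ⟨c, hc⟩ := exists_tangentialJacobian_eq (Gr.image A S)
  let v : Fin d → (Gr.image A S).1 := fun j => ⟨A (b j), Gr.apply_mem_image hA (b j).2⟩
  let m : Matrix (Fin d) (Fin d) ℝ := fun i j => inner ℝ (c i) (v j)
  have hv : ∀ j, A (b j : E n) = ∑ i, m i j • (c i : E n) := by
    intro j
    have := congrArg (fun z : (Gr.image A S).1 => (z : E n)) (c.sum_repr (v j)).symm
    simpa [c.repr_apply_apply, m, v] using this
  rw [hb, hb, hc]
  have h1 : (fun i => (B ∘L A) (b i : E n)) = fun j => ∑ i, m i j • B (c i : E n) := by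
    funext j
    rw [ContinuousLinearMap.comp_apply, hv, map_sum]
    simp
  have h2 : (fun i => A (b i : E n)) = fun j => ∑ i, m i j • (c i : E n) := funext hv
  have h3 : Matrix.gram ℝ (fun i => (c i : E n)) = 1 := by
    ext i j
    have h := orthonormal_iff_ite.1 c.orthonormal i j
    rw [Matrix.gram_apply, Matrix.one_apply]
    simpa using h
  rw [h1, h2, gram_sum_smul, gram_sum_smul, h3]
  simp only [Matrix.det_mul, Matrix.det_transpose, mul_one]
  rw [Real.sqrt_mul_self_eq_abs,
    show m.det * (Matrix.gram ℝ fun i => B (c i : E n)).det * m.det =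
      (Matrix.gram ℝ fun i => B (c i : E n)).det * (m.det * m.det) by ring,
    Real.sqrt_mul' _ (mul_self_nonneg _), Real.sqrt_mul_self_eq_abs]

/-- The trace of `L` over the plane `S`. -/
noncomputable def planeTrace {d n : ℕ} (L : E n →L[ℝ] E n) (S : Gr d n) : ℝ :=
  ∑ i, inner ℝ (stdOrthonormalBasis ℝ S.1 i : E n) (L (stdOrthonormalBasis ℝ S.1 i : E n))

/-- Each eigenvalue satisfies `0 ≤ λ ≤ exp (λ - 1)`; multiply over the spectrum. -/
theorem det_le_exp_trace_sub_one {m : Type*} [Fintype m] [DecidableEq m] {G : Matrix m m ℝ}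
    (hG : G.PosSemidef) : G.det ≤ Real.exp (∑ i, (G i i - 1)) := by
  have h1 := hG.isHermitian.trace_eq_sum_eigenvalues
  have h2 : ∑ i, (G i i - 1) = ∑ i, (hG.isHermitian.eigenvalues i - 1) := by
    rw [Finset.sum_sub_distrib, Finset.sum_sub_distrib]
    congr 1
  rw [hG.isHermitian.det_eq_prod_eigenvalues, h2, Real.exp_sum]
  refine Finset.prod_le_prod (fun i _ => hG.eigenvalues_nonneg i) fun i _ => ?_
  simpa using Real.add_one_le_exp (hG.isHermitian.eigenvalues i - 1)

/-- Through `det_le_exp_trace_sub_one` only the diagonal `‖e + L e‖² - 1 ≤ 2 ⟨e, L e⟩ + ‖L‖²` of the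
Gram matrix matters, so the determinant is never expanded. The square root halves the exponent. -/
theorem tangentialJacobian_one_add_le_exp_trace {d n : ℕ} (L : E n →L[ℝ] E n) (S : Gr d n) :
    tangentialJacobian (1 + L) S ≤ Real.exp (planeTrace L S + d * ‖L‖ ^ 2 / 2) := by
  unfold tangentialJacobian planeTrace
  refine Real.sqrt_le_iff.2 ⟨(Real.exp_pos _).le, ?_⟩
  refine (det_le_exp_trace_sub_one (Matrix.posSemidef_gram ℝ _)).trans ?_
  rw [← Real.exp_nat_mul]
  refine Real.exp_le_exp.2 ?_
  set e : Fin (Module.finrank ℝ S.1) → E n := fun i => (stdOrthonormalBasis ℝ S.1 i : E n)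
  have he : ∀ i, ‖e i‖ = 1 := fun i => (stdOrthonormalBasis ℝ S.1).orthonormal.1 i
  have h : ∀ i, Matrix.gram ℝ (fun i => (1 + L) (e i)) i i - 1 ≤
      2 * inner ℝ (e i) (L (e i)) + ‖L‖ ^ 2 := by
    intro i
    rw [Matrix.gram_apply, real_inner_self_eq_norm_sq, add_apply,
      one_apply_eq_self, norm_add_sq_real, he]
    have : ‖L (e i)‖ ≤ ‖L‖ := by simpa [he] using L.le_opNorm (e i)
    nlinarith [norm_nonneg (L (e i))]
  refine (Finset.sum_le_sum fun i _ => h i).trans ?_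
  rw [Finset.sum_add_distrib, ← Finset.mul_sum]
  simp only [Finset.sum_const, Finset.card_univ, Fintype.card_fin, nsmul_eq_mul]
  have hd : ((Module.finrank ℝ S.1 : ℕ) : ℝ) = d := by exact_mod_cast S.2
  rw [hd]
  push_cast
  linarith

theorem abs_planeTrace_le {d n : ℕ} (L : E n →L[ℝ] E n) (S : Gr d n) :
    |planeTrace L S| ≤ d * ‖L‖ := by
  unfold planeTrace
  refine (Finset.abs_sum_le_sum_abs _ _).trans ?_
  have h : ∀ i ∈ Finset.univ, |inner ℝ (stdOrthonormalBasis ℝ S.1 i : E n)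
      (L (stdOrthonormalBasis ℝ S.1 i : E n))| ≤ ‖L‖ := by
    intro i _
    have he : ‖(stdOrthonormalBasis ℝ S.1 i : E n)‖ = 1 :=
      (stdOrthonormalBasis ℝ S.1).orthonormal.1 i
    refine (abs_real_inner_le_norm _ _).trans ?_
    rw [he, one_mul]
    simpa [he] using L.le_opNorm (stdOrthonormalBasis ℝ S.1 i : E n)
  refine (Finset.sum_le_sum h).trans ?_
  simp [S.2]

theorem tangentialJacobian_one_add_le_exp {d n : ℕ} (L : E n →L[ℝ] E n) (S : Gr d n) :
    tangentialJacobian (1 + L) S ≤ Real.exp (d * ‖L‖ * (1 + ‖L‖ / 2)) := by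
  refine (tangentialJacobian_one_add_le_exp_trace L S).trans (Real.exp_le_exp.2 ?_)
  have := (abs_le.1 (abs_planeTrace_le L S)).2
  nlinarith

/-- First order expansion of the tangential Jacobian, with a one-sided quadratic remainder. -/
theorem tangentialJacobian_one_add_le {d n : ℕ} (hdn : d ≤ n) (L : E n →L[ℝ] E n)
    (hL : 2 * n * ‖L‖ ≤ 1) (S : Gr d n) :
    tangentialJacobian (1 + L) S ≤ 1 + planeTrace L S + 3 * n ^ 2 * ‖L‖ ^ 2 := by
  refine (tangentialJacobian_one_add_le_exp_trace L S).trans ?_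
  rcases Nat.eq_zero_or_pos n with rfl | hn
  · obtain rfl : d = 0 := by omega
    have h := abs_planeTrace_le L S
    simp only [Nat.cast_zero, zero_mul, abs_nonpos_iff] at h
    simp [h]
  have hn' : (1 : ℝ) ≤ n := by exact_mod_cast hn
  have hd : (d : ℝ) ≤ n := by exact_mod_cast hdn
  have hd0 : (0 : ℝ) ≤ d := by positivity
  have hL0 := norm_nonneg L
  set s := ‖L‖
  have htr := abs_planeTrace_le L S
  have h1 : d * s ≤ n * s := by gcongr
  have h2 : (n : ℝ) * s ≤ 1 / 2 := by linarith
  have h3 : s ≤ 1 / 2 := by nlinarith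
  have h4 : d * s ^ 2 / 2 ≤ n * s / 4 := by nlinarith
  have hab := abs_le.1 htr
  set x := planeTrace L S + d * s ^ 2 / 2
  have hx0 : -(5 / 4 * (n * s)) ≤ x := by
    have : 0 ≤ d * s ^ 2 / 2 := by positivity
    have h5 : x = planeTrace L S + d * s ^ 2 / 2 := rfl
    nlinarith
  have hx1 : x ≤ 5 / 4 * (n * s) := by
    have h5 : x = planeTrace L S + d * s ^ 2 / 2 := rfl
    nlinarith
  have hx : |x| ≤ 1 := abs_le.2 ⟨by linarith, by linarith⟩
  -- This is `exp x ≤ 1 + x + x²`. Here `x² ≤ (25/16) n² s²`, and `x` exceeds the trace by at most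
  -- `n² s² / 2`, so the remainder is at most `(33/16) n² s²`, below the stated constant 3.
  have h6 := (abs_le.1 (Real.abs_exp_sub_one_sub_id_le hx)).2
  have h7 : x ^ 2 ≤ (5 / 4 * (n * s)) ^ 2 := sq_le_sq' hx0 hx1
  have h8 : d * s ^ 2 / 2 ≤ n ^ 2 * s ^ 2 / 2 := by
    have : (d : ℝ) ≤ n ^ 2 := by nlinarith
    have := mul_le_mul_of_nonneg_right this (sq_nonneg s)
    linarith
  have h9 : 0 ≤ (n : ℝ) ^ 2 * s ^ 2 := by positivity
  have h5 : x = planeTrace L S + d * s ^ 2 / 2 := rfl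
  nlinarith

theorem exists_inverse_of_lowerBound {n : ℕ} {R : ℝ} (hR : 0 ≤ R) {A : E n →L[ℝ] E n}
    (hA : LowerBound R A) :
    ∃ B : E n →L[ℝ] E n, B ∘L A = 1 ∧ A ∘L B = 1 ∧ ‖B‖ ≤ R := by
  let e := LinearEquiv.ofInjectiveEndo (A : E n →ₗ[ℝ] E n) hA.injective
  let B : E n →L[ℝ] E n := LinearMap.toContinuousLinearMap (e.symm : E n →ₗ[ℝ] E n)
  have hAB : ∀ v, A (B v) = v := fun v => e.apply_symm_apply v
  refine ⟨B, ?_, ?_, ?_⟩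
  · ext1 v; exact e.symm_apply_apply v
  · ext1 v; exact hAB v
  · refine ContinuousLinearMap.opNorm_le_bound _ hR fun v => ?_
    simpa [hAB] using hA (B v)

/-- A bound for the tangential Jacobian on operators of norm at most `R`. -/
noncomputable def jacobianBound (n : ℕ) (R : ℝ) : ℝ :=
  Real.exp (n * (R + 1) * (1 + (R + 1) / 2))

theorem tangentialJacobian_le {d n : ℕ} (hdn : d ≤ n) {R : ℝ} {A : E n →L[ℝ] E n}
    (hA : ‖A‖ ≤ R) (S : Gr d n) : tangentialJacobian A S ≤ jacobianBound n R := by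
  have h := tangentialJacobian_one_add_le_exp (A - 1) S
  rw [add_sub_cancel] at h
  have h1 : ‖A - 1‖ ≤ R + 1 :=
    (norm_sub_le _ _).trans (add_le_add hA ContinuousLinearMap.norm_id_le)
  have hd : (d : ℝ) ≤ n := by exact_mod_cast hdn
  have hR : 0 ≤ R + 1 := (norm_nonneg _).trans h1
  refine h.trans (Real.exp_le_exp.2 ?_)
  gcongr

/-- A Lipschitz constant for the tangential Jacobian. -/
noncomputable def jacobianLip (n : ℕ) (R : ℝ) : ℝ :=
  jacobianBound n R * (n * R * (1 + R * (2 * R) / 2) *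
    Real.exp (n * (R * (2 * R)) * (1 + R * (2 * R) / 2)))

theorem jacobianBound_nonneg (n : ℕ) (R : ℝ) : 0 ≤ jacobianBound n R := (Real.exp_pos _).le

theorem jacobianLip_nonneg (n : ℕ) {R : ℝ} (hR : 0 ≤ R) : 0 ≤ jacobianLip n R :=
  mul_nonneg (jacobianBound_nonneg n R) (by positivity)

theorem exp_sub_one_le (x : ℝ) : Real.exp x - 1 ≤ x * Real.exp x := by
  have h := Real.add_one_le_exp (-x)
  have h1 : Real.exp (-x) * Real.exp x = 1 := by rw [← Real.exp_add]; simp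
  nlinarith [Real.exp_pos x]

/-- Write `A = (1 + (A - B) B⁻¹) B`. The product formula reduces the difference to the Jacobian of a
perturbation of the identity, for which an upper bound suffices: exchanging `A` and `B` gives the
other sign. -/
theorem abs_tangentialJacobian_sub_le {d n : ℕ} (hdn : d ≤ n) {R : ℝ} (hR : 0 ≤ R)
    {A B : E n →L[ℝ] E n} (hA : LowerBound R A) (hB : LowerBound R B) (hA' : ‖A‖ ≤ R)
    (hB' : ‖B‖ ≤ R) (S : Gr d n) :
    |tangentialJacobian A S - tangentialJacobian B S| ≤ jacobianLip n R * ‖A - B‖ := by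
  have key : ∀ {A B : E n →L[ℝ] E n}, LowerBound R B → ‖A‖ ≤ R → ‖B‖ ≤ R →
      tangentialJacobian A S - tangentialJacobian B S ≤ jacobianLip n R * ‖A - B‖ := by
    intro A B hB hA' hB'
    obtain ⟨C, hC1, hC2, hC⟩ := exists_inverse_of_lowerBound hR hB
    have hs : ‖A - B‖ ≤ 2 * R := by linarith [norm_sub_le A B]
    have hL : ‖(A - B) ∘L C‖ ≤ R * ‖A - B‖ :=
      ((A - B).opNorm_comp_le C).trans (by rw [mul_comm]; gcongr)
    set s := ‖A - B‖
    have hAB : A = (1 + (A - B) ∘L C) ∘L B := by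
      have h : ∀ v, C (B v) = v := fun v => DFunLike.congr_fun hC1 v
      ext1 v
      simp [h]
    have h1 := tangentialJacobian_comp hB.injective (1 + (A - B) ∘L C) S
    rw [← hAB] at h1
    have h2 := tangentialJacobian_one_add_le_exp ((A - B) ∘L C) (Gr.image B S)
    have h3 := tangentialJacobian_le hdn hB' S
    have h0 := tangentialJacobian_nonneg B S
    have hd : (d : ℝ) ≤ n := by exact_mod_cast hdn
    have hs0 : 0 ≤ s := norm_nonneg _
    -- The crude bound `‖A - B‖ ≤ 2 R` enters only the last factor, so the exponent stays linear in
    -- `‖A - B‖`.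
    have h4 : d * ‖(A - B) ∘L C‖ * (1 + ‖(A - B) ∘L C‖ / 2) ≤
        n * (R * s) * (1 + R * (2 * R) / 2) := by
      have : ‖(A - B) ∘L C‖ ≤ R * (2 * R) := hL.trans (by gcongr)
      gcongr
    set x := n * (R * s) * (1 + R * (2 * R) / 2)
    have h5 : x ≤ n * (R * (2 * R)) * (1 + R * (2 * R) / 2) := by
      show n * (R * s) * (1 + R * (2 * R) / 2) ≤ _
      gcongr
    have hx0 : 0 ≤ x := by positivity
    rw [h1]
    calc _ = (tangentialJacobian (1 + (A - B) ∘L C) (Gr.image B S) - 1) *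
          tangentialJacobian B S := by ring
      _ ≤ (Real.exp x - 1) * tangentialJacobian B S := by
          gcongr
          exact h2.trans (Real.exp_le_exp.2 h4)
      _ ≤ (Real.exp x - 1) * jacobianBound n R := by
          have : 0 ≤ Real.exp x - 1 := by linarith [Real.add_one_le_exp x]
          gcongr
      _ ≤ (x * Real.exp (n * (R * (2 * R)) * (1 + R * (2 * R) / 2))) * jacobianBound n R := by
          have := jacobianBound_nonneg n R
          gcongr
          refine (exp_sub_one_le x).trans ?_
          gcongr
      _ = _ := by
          show (n * (R * s) * (1 + R * (2 * R) / 2) * _) * _ = _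
          unfold jacobianLip
          ring
  rw [abs_sub_le_iff]
  refine ⟨key hB hA' hB', ?_⟩
  rw [norm_sub_rev]
  exact key hA hB' hA'

/-! ### Joint continuity of the action on planes -/

/-- The operators bounded by `R` and bounded below by `R⁻¹`. -/
def controlled (n : ℕ) (R : ℝ) : Set (E n →L[ℝ] E n) := {A | ‖A‖ ≤ R ∧ LowerBound R A}

theorem LowerBound.mono {n : ℕ} {R R' : ℝ} (h : R ≤ R') {A : E n →L[ℝ] E n}
    (hA : LowerBound R A) : LowerBound R' A := fun v =>
  (hA v).trans (by gcongr)

theorem LowerBound.comp {n : ℕ} {R R' : ℝ} (hR : 0 ≤ R) {A B : E n →L[ℝ] E n}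
    (hA : LowerBound R A) (hB : LowerBound R' B) : LowerBound (R * R') (B ∘L A) := fun v =>
  (hA v).trans (by
    rw [mul_assoc]
    exact mul_le_mul_of_nonneg_left (hB (A v)) hR)

theorem lowerBound_one_add {n : ℕ} {L : E n →L[ℝ] E n} (hL : ‖L‖ ≤ 1 / 2) :
    LowerBound 2 (1 + L) := by
  intro v
  have h1 : ‖L v‖ ≤ 1 / 2 * ‖v‖ := L.le_of_opNorm_le hL v
  have h2 : ‖v‖ - ‖L v‖ ≤ ‖v + L v‖ := by
    have := norm_sub_le (v + L v) (L v)
    rw [add_sub_cancel_right] at this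
    linarith
  have h3 : (1 + L) v = v + L v := rfl
  rw [h3]
  linarith

theorem norm_one_add_le {n : ℕ} (L : E n →L[ℝ] E n) : ‖1 + L‖ ≤ 1 + ‖L‖ :=
  (norm_add_le _ _).trans (add_le_add ContinuousLinearMap.norm_id_le le_rfl)

theorem one_add_mem_controlled {n : ℕ} {L : E n →L[ℝ] E n} (hL : ‖L‖ ≤ 1 / 2) :
    1 + L ∈ controlled n 2 :=
  ⟨(norm_one_add_le L).trans (by linarith), lowerBound_one_add hL⟩

theorem controlled_mono {n : ℕ} {R R' : ℝ} (h : R ≤ R') : controlled n R ⊆ controlled n R' :=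
  fun _ hA => ⟨hA.1.trans h, hA.2.mono h⟩

theorem controlled_comp {n : ℕ} {R R' : ℝ} {A B : E n →L[ℝ] E n}
    (hA : A ∈ controlled n R) (hB : B ∈ controlled n R') : B ∘L A ∈ controlled n (R * R') := by
  have hR : 0 ≤ R := (norm_nonneg _).trans hA.1
  have hR' : 0 ≤ R' := (norm_nonneg _).trans hB.1
  refine ⟨(B.opNorm_comp_le A).trans ?_, hA.2.comp hR hB.2⟩
  rw [mul_comm R R']
  exact mul_le_mul hB.1 hA.1 (norm_nonneg _) hR'

theorem isClosed_controlled (n : ℕ) (R : ℝ) : IsClosed (controlled n R) := by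
  refine (isClosed_le continuous_norm continuous_const).inter ?_
  have h : {A : E n →L[ℝ] E n | LowerBound R A} = ⋂ v, {A | ‖v‖ ≤ R * ‖A v‖} := by
    ext A; simp [LowerBound]
  change IsClosed {A : E n →L[ℝ] E n | LowerBound R A}
  rw [h]
  exact isClosed_iInter fun v => isClosed_le (by fun_prop) (by fun_prop)

/-- The operator `1 + (P_T - P_S)`, which maps `S` onto `T` if these planes are close. -/
noncomputable def Gr.rotation {d n : ℕ} (S T : Gr d n) : E n →L[ℝ] E n := 1 + (T.proj - S.proj)

/-- On `S` the rotation acts as `T.proj`, so it maps `S` into `T`. Closeness of the planes makes it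
injective, and equal dimensions give equality. -/
theorem Gr.image_rotation {d n : ℕ} {S T : Gr d n} (h : dist T S ≤ 1 / 2) :
    Gr.image (S.rotation T) S = T := by
  rw [Gr.dist_eq] at h
  have hinj : Function.Injective (S.rotation T) := (lowerBound_one_add h).injective
  apply Subtype.ext
  refine Submodule.eq_of_le_of_finrank_eq ?_ ((Gr.image _ S).2.trans T.2.symm)
  rw [Gr.coe_image hinj]
  rintro _ ⟨v, hv, rfl⟩
  have : S.rotation T v = T.proj v := by
    have := S.proj_eq_self hv
    simp [Gr.rotation, this]
  change S.rotation T v ∈ T.1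
  rw [this]
  exact T.proj_mem v

theorem continuousOn_image_left {d n : ℕ} {R : ℝ} (S : Gr d n) :
    ContinuousOn (fun A => Gr.image A S) (controlled n R) := by
  rcases le_or_gt 0 R with hR | hR
  · refine LipschitzOnWith.continuousOn (K := (2 * R).toNNReal) (LipschitzOnWith.of_dist_le_mul ?_)
    intro A hA B hB
    have := Gr.dist_image_image_le hR hA.2 hB.2 S
    rw [Real.coe_toNNReal _ (by positivity), dist_eq_norm]
    linarith
  · intro A hA
    exact absurd ((norm_nonneg A).trans hA.1) (not_le.2 hR)

theorem continuousOn_tangentialJacobian_left {d n : ℕ} (hdn : d ≤ n) {R : ℝ} (S : Gr d n) :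
    ContinuousOn (fun A => tangentialJacobian A S) (controlled n R) := by
  rcases le_or_gt 0 R with hR | hR
  · refine LipschitzOnWith.continuousOn (K := (jacobianLip n R).toNNReal)
      (LipschitzOnWith.of_dist_le_mul ?_)
    intro A hA B hB
    have := abs_tangentialJacobian_sub_le hdn hR hA.2 hB.2 hA.1 hB.1 S
    rwa [Real.coe_toNNReal _ (jacobianLip_nonneg n hR), dist_eq_norm A B]
  · intro A hA
    exact absurd ((norm_nonneg A).trans hA.1) (not_le.2 hR)

theorem continuous_rotation {d n : ℕ} (S : Gr d n) : Continuous S.rotation := by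
  unfold Gr.rotation
  exact continuous_const.add ((Gr.isometry_proj d n).continuous.sub continuous_const)

theorem rotation_self {d n : ℕ} (S : Gr d n) : S.rotation S = 1 := by
  unfold Gr.rotation; simp

/-- A plane `T` near `S` is the image of `S` under the rotation, so acting with `A'` on `T` is
acting with `A' ∘L S.rotation T` on `S`. Joint continuity in operator and plane thus reduces to
continuity in the operator at the fixed plane `S`. -/
theorem tendsto_comp_rotation {d n : ℕ} (R : ℝ) (A : E n →L[ℝ] E n) (S : Gr d n) :
    Tendsto (fun q : (E n →L[ℝ] E n) × Gr d n => q.1 ∘L S.rotation q.2)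
      (𝓝[controlled n R ×ˢ univ] (A, S)) (𝓝[controlled n (2 * R)] A) ∧
    Tendsto (fun q : (E n →L[ℝ] E n) × Gr d n => S.rotation q.2)
      (𝓝[controlled n R ×ˢ univ] (A, S)) (𝓝[controlled n 2] 1) ∧
    ∀ᶠ q in 𝓝[controlled n R ×ˢ univ] (A, S), q.1 ∈ controlled n R ∧ dist q.2 S ≤ 1 / 2 := by
  have h3 : ∀ᶠ q in 𝓝[controlled n R ×ˢ univ] (A, S),
      q.1 ∈ controlled n R ∧ dist q.2 S ≤ 1 / 2 := by
    have h1 : ∀ᶠ q : (E n →L[ℝ] E n) × Gr d n in 𝓝 (A, S), dist q.2 S < 1 / 2 :=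
      (isOpen_lt (by fun_prop) continuous_const).mem_nhds (by simp)
    filter_upwards [self_mem_nhdsWithin, mem_nhdsWithin_of_mem_nhds h1] with q hq hq'
    exact ⟨hq.1, hq'.le⟩
  have h4 : ∀ T : Gr d n, dist T S ≤ 1 / 2 → S.rotation T ∈ controlled n 2 := by
    intro T hT
    rw [Gr.dist_eq] at hT
    exact one_add_mem_controlled hT
  have hc : Continuous fun q : (E n →L[ℝ] E n) × Gr d n => S.rotation q.2 :=
    (continuous_rotation S).comp continuous_snd
  refine ⟨tendsto_nhdsWithin_iff.2 ⟨?_, ?_⟩, tendsto_nhdsWithin_iff.2 ⟨?_, ?_⟩, h3⟩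
  · have : Continuous fun q : (E n →L[ℝ] E n) × Gr d n => q.1 ∘L S.rotation q.2 :=
      continuous_fst.clm_comp hc
    have h := (this.tendsto (A, S)).mono_left (nhdsWithin_le_nhds (s := controlled n R ×ˢ univ))
    rw [rotation_self] at h
    exact h
  · filter_upwards [h3] with q hq
    exact controlled_comp (h4 _ hq.2) hq.1
  · have h := (hc.tendsto (A, S)).mono_left (nhdsWithin_le_nhds (s := controlled n R ×ˢ univ))
    rw [rotation_self] at h
    exact h
  · filter_upwards [h3] with q hq
    exact h4 _ hq.2

theorem one_mem_controlled (n : ℕ) : (1 : E n →L[ℝ] E n) ∈ controlled n 2 := by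
  simpa using one_add_mem_controlled (n := n) (L := 0) (by simp)

theorem continuousOn_image {d n : ℕ} {R : ℝ} :
    ContinuousOn (fun q : (E n →L[ℝ] E n) × Gr d n => Gr.image q.1 q.2)
      (controlled n R ×ˢ univ) := by
  rintro ⟨A, S⟩ ⟨hA, -⟩
  obtain ⟨h1, -, h3⟩ := tendsto_comp_rotation R A S
  have hA' : A ∈ controlled n (2 * R) :=
    controlled_mono (by linarith [(norm_nonneg A).trans hA.1]) hA
  refine Tendsto.congr' ?_ ((continuousOn_image_left S A hA').tendsto.comp h1)
  filter_upwards [h3] with q hq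
  have hr : Function.Injective (S.rotation q.2) :=
    (lowerBound_one_add (by simpa [Gr.dist_eq] using hq.2)).injective
  simp only [Function.comp]
  rw [Gr.image_comp hr hq.1.2.injective, Gr.image_rotation hq.2]

/-- Near `(A, S)` the Jacobian at `(A', T)` is the quotient of the Jacobians on `S` of `A' ∘L
S.rotation T` and of `S.rotation T`; the denominator tends to the Jacobian of the identity, which is
1. -/
theorem continuousOn_tangentialJacobian {d n : ℕ} (hdn : d ≤ n) {R : ℝ} :
    ContinuousOn (fun q : (E n →L[ℝ] E n) × Gr d n => tangentialJacobian q.1 q.2)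
      (controlled n R ×ˢ univ) := by
  rintro ⟨A, S⟩ ⟨hA, -⟩
  obtain ⟨h1, h2, h3⟩ := tendsto_comp_rotation R A S
  have hA' : A ∈ controlled n (2 * R) :=
    controlled_mono (by linarith [(norm_nonneg A).trans hA.1]) hA
  have h4 := (continuousOn_tangentialJacobian_left hdn S A hA').tendsto.comp h1
  have h5 := (continuousOn_tangentialJacobian_left hdn S 1 (one_mem_controlled n)).tendsto.comp h2
  have h6 : tangentialJacobian 1 S = 1 := tangentialJacobian_id S
  rw [h6] at h5
  have h7 := h4.div h5 one_ne_zero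
  rw [div_one] at h7
  refine Tendsto.congr' ?_ h7
  have h8 : ∀ᶠ q : (E n →L[ℝ] E n) × Gr d n in 𝓝[controlled n R ×ˢ univ] (A, S),
      tangentialJacobian (S.rotation q.2) S ≠ 0 := h5.eventually_ne one_ne_zero
  filter_upwards [h3, h8] with q hq hq'
  have hr : Function.Injective (S.rotation q.2) :=
    (lowerBound_one_add (by simpa [Gr.dist_eq] using hq.2)).injective
  simp only [Function.comp, Pi.div_apply]
  rw [tangentialJacobian_comp hr, Gr.image_rotation hq.2, mul_div_assoc, div_self hq', mul_one]

/-! ### Transport of varifolds by a map and a deformation field -/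

/-- The push-forward of `V` by a map `f` with the field `A` in place of the differential. -/
noncomputable def transport {d n : ℕ} (V : Measure (E n × Gr d n)) (f : E n → E n)
    (A : E n → E n →L[ℝ] E n) : Measure (E n × Gr d n) :=
  (V.withDensity fun p => ENNReal.ofReal (tangentialJacobian (A p.1) p.2)).map
    fun p => (f p.1, Gr.image (A p.1) p.2)

/-- Continuous maps and fields with a uniform control. -/
structure Admissible {n : ℕ} (R : ℝ) (f : E n → E n) (A : E n → E n →L[ℝ] E n) : Prop where
  continuous_map : Continuous f
  continuous_field : Continuous A
  mem : ∀ x, A x ∈ controlled n R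

theorem map_withDensity_map_withDensity {α β γ : Type*} [MeasurableSpace α] [MeasurableSpace β]
    [MeasurableSpace γ] (μ : Measure α) {G : α → β} {H : β → γ} {a : α → ℝ≥0∞} {b : β → ℝ≥0∞}
    (hG : Measurable G) (hH : Measurable H) (ha : Measurable a) (hb : Measurable b) :
    ((((μ.withDensity a).map G).withDensity b).map H) =
      (μ.withDensity fun x => a x * b (G x)).map fun x => H (G x) := by
  ext s hs
  have hHG : Measurable fun x => H (G x) := hH.comp hG
  rw [Measure.map_apply hH hs, Measure.map_apply hHG hs, withDensity_apply _ (hH hs),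
    withDensity_apply _ (hHG hs), setLIntegral_map (hH hs) hb hG,
    setLIntegral_withDensity_eq_setLIntegral_mul μ ha (g := fun x => b (G x)) (hb.comp hG)
      (hG (hH hs))]
  rfl

namespace Admissible

variable {d n : ℕ} {R R' : ℝ} {f g : E n → E n} {A B : E n → E n →L[ℝ] E n}

theorem nonneg (h : Admissible R f A) : 0 ≤ R := (norm_nonneg _).trans (h.mem 0).1

theorem continuous_jacobian (h : Admissible R f A) (hdn : d ≤ n) :
    Continuous fun p : E n × Gr d n => tangentialJacobian (A p.1) p.2 :=
  (continuousOn_tangentialJacobian hdn).comp_continuous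
    (f := fun p : E n × Gr d n => (A p.1, p.2))
    ((h.continuous_field.comp continuous_fst).prodMk continuous_snd)
    fun p => ⟨h.mem p.1, mem_univ _⟩

theorem continuous_transportMap (h : Admissible R f A) :
    Continuous fun p : E n × Gr d n => (f p.1, Gr.image (A p.1) p.2) :=
  (h.continuous_map.comp continuous_fst).prodMk
    (continuousOn_image.comp_continuous (f := fun p : E n × Gr d n => (A p.1, p.2))
      ((h.continuous_field.comp continuous_fst).prodMk continuous_snd)
      fun p => ⟨h.mem p.1, mem_univ _⟩)

theorem measurable_density (h : Admissible R f A) (hdn : d ≤ n) :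
    Measurable fun p : E n × Gr d n => ENNReal.ofReal (tangentialJacobian (A p.1) p.2) :=
  (h.continuous_jacobian hdn).measurable.ennreal_ofReal

/-- Multiplicativity of the Jacobian and functoriality of the image make transport functorial. The
fields need not be the differentials of the maps, so the two components of a Lagrangian state can be
treated as independent unknowns. -/
theorem transport_transport (hA : Admissible R f A) (hB : Admissible R' g B) (hdn : d ≤ n)
    (V : Measure (E n × Gr d n)) :
    transport (transport V f A) g B = transport V (g ∘ f) fun x => B (f x) ∘L A x := by
  have h := map_withDensity_map_withDensity V hA.continuous_transportMap.measurable
    hB.continuous_transportMap.measurable (hA.measurable_density hdn) (hB.measurable_density hdn)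
  refine h.trans ?_
  have h1 : (fun p : E n × Gr d n => ENNReal.ofReal (tangentialJacobian (A p.1) p.2) *
      ENNReal.ofReal (tangentialJacobian (B (f p.1)) (Gr.image (A p.1) p.2))) =
      fun p => ENNReal.ofReal (tangentialJacobian (B (f p.1) ∘L A p.1) p.2) := by
    funext p
    rw [tangentialJacobian_comp (hA.mem _).2.injective,
      ENNReal.ofReal_mul (tangentialJacobian_nonneg _ _), mul_comm]
  have h2 : (fun p : E n × Gr d n => (g (f p.1), Gr.image (B (f p.1)) (Gr.image (A p.1) p.2))) =
      fun p => ((g ∘ f) p.1, Gr.image (B (f p.1) ∘L A p.1) p.2) := by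
    funext p
    rw [Gr.image_comp (hA.mem _).2.injective (hB.mem _).2.injective]
    rfl
  rw [transport, ← h1, ← h2]

theorem transport_univ (hA : Admissible R f A) (V : Measure (E n × Gr d n)) :
    transport V f A univ = ∫⁻ p, ENNReal.ofReal (tangentialJacobian (A p.1) p.2) ∂V := by
  rw [transport, Measure.map_apply hA.continuous_transportMap.measurable .univ, preimage_univ,
    withDensity_apply _ .univ, Measure.restrict_univ]

theorem integral_transport {F : Type*} [NormedAddCommGroup F] [NormedSpace ℝ F]
    [SecondCountableTopology F] (hA : Admissible R f A) (hdn : d ≤ n)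
    (V : Measure (E n × Gr d n)) {φ : E n × Gr d n → F} (hφ : Continuous φ) :
    ∫ p, φ p ∂(transport V f A) =
      ∫ p, tangentialJacobian (A p.1) p.2 • φ (f p.1, Gr.image (A p.1) p.2) ∂V := by
  rw [transport, integral_map hA.continuous_transportMap.measurable.aemeasurable
    hφ.aestronglyMeasurable,
    integral_withDensity_eq_integral_toReal_smul (hA.measurable_density hdn)
      (ae_of_all _ fun _ => ENNReal.ofReal_lt_top)]
  simp only [ENNReal.toReal_ofReal (tangentialJacobian_nonneg _ _)]

theorem isFiniteMeasure_transport (hA : Admissible R f A) (hdn : d ≤ n)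
    (V : Measure (E n × Gr d n)) [IsFiniteMeasure V] : IsFiniteMeasure (transport V f A) := by
  refine ⟨?_⟩
  rw [hA.transport_univ]
  calc _ ≤ ∫⁻ p, ENNReal.ofReal (jacobianBound n R) ∂V :=
        lintegral_mono fun p => ENNReal.ofReal_le_ofReal (tangentialJacobian_le hdn (hA.mem _).1 _)
    _ < ⊤ := by
        rw [lintegral_const]
        exact ENNReal.mul_lt_top ENNReal.ofReal_lt_top (measure_lt_top _ _)

/-- Transport is Lipschitz against bounded Lipschitz functions. -/
theorem norm_integral_sub_integral_le {F : Type*} [NormedAddCommGroup F] [NormedSpace ℝ F]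
    [SecondCountableTopology F] (hA : Admissible R f A) (hB : Admissible R g B)
    (hdn : d ≤ n) (V : Measure (E n × Gr d n)) [IsFiniteMeasure V] {φ : E n × Gr d n → F}
    {b l δ : ℝ} (hb : ∀ p, ‖φ p‖ ≤ b) (hl : ∀ p q, ‖φ p - φ q‖ ≤ l * dist p q)
    (hl0 : 0 ≤ l) (hfg : ∀ x, ‖f x - g x‖ ≤ δ) (hAB : ∀ x, ‖A x - B x‖ ≤ δ) :
    ‖∫ p, φ p ∂(transport V f A) - ∫ p, φ p ∂(transport V g B)‖ ≤
      (jacobianLip n R * b + jacobianBound n R * (1 + 2 * R) * l) * V.real univ * δ := by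
  have hφ : Continuous φ := by
    refine LipschitzWith.continuous (K := l.toNNReal) (LipschitzWith.of_dist_le_mul fun p q => ?_)
    rw [Real.coe_toNNReal _ hl0, dist_eq_norm]
    exact hl p q
  have hR := hA.nonneg
  have hδ : 0 ≤ δ := (norm_nonneg _).trans (hfg 0)
  have hint : ∀ {f : E n → E n} {A : E n → E n →L[ℝ] E n}, Admissible R f A →
      Integrable (fun p : E n × Gr d n =>
        tangentialJacobian (A p.1) p.2 • φ (f p.1, Gr.image (A p.1) p.2)) V := by
    intro f A hA
    refine Integrable.of_bound (C := jacobianBound n R * b)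
      ((hA.continuous_jacobian hdn).smul
        (hφ.comp hA.continuous_transportMap)).aestronglyMeasurable (ae_of_all _ fun p => ?_)
    rw [norm_smul, Real.norm_of_nonneg (tangentialJacobian_nonneg _ _)]
    exact mul_le_mul (tangentialJacobian_le hdn (hA.mem _).1 _) (hb _) (norm_nonneg _)
      (jacobianBound_nonneg _ _)
  rw [hA.integral_transport hdn V hφ, hB.integral_transport hdn V hφ,
    ← integral_sub (hint hA) (hint hB)]
  refine (norm_integral_le_of_norm_le_const (μ := V)
    (C := (jacobianLip n R * b + jacobianBound n R * (1 + 2 * R) * l) * δ)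
    (ae_of_all _ fun p => ?_)).trans (le_of_eq (by ring))
  set J := tangentialJacobian (A p.1) p.2
  set J' := tangentialJacobian (B p.1) p.2
  have h1 : |J - J'| ≤ jacobianLip n R * δ :=
    (abs_tangentialJacobian_sub_le hdn hR (hA.mem _).2 (hB.mem _).2 (hA.mem _).1
      (hB.mem _).1 _).trans (mul_le_mul_of_nonneg_left (hAB _) (jacobianLip_nonneg n hR))
  have h2 : dist (f p.1, Gr.image (A p.1) p.2) (g p.1, Gr.image (B p.1) p.2) ≤
      (1 + 2 * R) * δ := by
    refine max_le ?_ ?_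
    · rw [dist_eq_norm]
      nlinarith [hfg p.1, mul_nonneg hR hδ]
    · refine (Gr.dist_image_image_le hR (hA.mem _).2 (hB.mem _).2 _).trans ?_
      nlinarith [mul_le_mul_of_nonneg_left (hAB p.1) hR]
  -- The change of the Jacobian is paid for by the bound on `φ`, the change of the transported point
  -- by its Lipschitz constant.
  have h3 : J • φ (f p.1, Gr.image (A p.1) p.2) - J' • φ (g p.1, Gr.image (B p.1) p.2) =
      (J - J') • φ (f p.1, Gr.image (A p.1) p.2) +
        J' • (φ (f p.1, Gr.image (A p.1) p.2) - φ (g p.1, Gr.image (B p.1) p.2)) := by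
    module
  rw [h3]
  refine (norm_add_le _ _).trans ?_
  rw [norm_smul, norm_smul, Real.norm_eq_abs, Real.norm_of_nonneg (tangentialJacobian_nonneg _ _)]
  have h4 := mul_le_mul h1 (hb (f p.1, Gr.image (A p.1) p.2)) (norm_nonneg _)
    (mul_nonneg (jacobianLip_nonneg n hR) hδ)
  have h5 := mul_le_mul (tangentialJacobian_le hdn (hB.mem p.1).1 p.2)
    ((hl _ _).trans (mul_le_mul_of_nonneg_left h2 hl0)) (norm_nonneg _) (jacobianBound_nonneg n R)
  linarith

end Admissible

theorem pushforward_eq_transport {d n : ℕ} (f : E n → E n) (V : Measure (E n × Gr d n)) :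
    pushforward f V = transport V f (fderiv ℝ f) := rfl

theorem massMeasure_univ {d n : ℕ} (V : Measure (E n × Gr d n)) : massMeasure V univ = V univ := by
  rw [massMeasure, Measure.map_apply measurable_fst .univ, preimage_univ]

/-! ### Mollifiers -/

/-- A smooth nonnegative function of integral `1` that vanishes outside the unit ball. -/
structure IsMollifier {n : ℕ} (Φ : E n → ℝ) : Prop where
  contDiff : ContDiff ℝ ∞ Φ
  eq_zero : ∀ x, 1 ≤ ‖x‖ → Φ x = 0
  nonneg : ∀ x, 0 ≤ Φ x
  integral_eq_one : ∫ x, Φ x = 1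

theorem norm_gradient {n : ℕ} (f : E n → ℝ) (x : E n) : ‖gradient f x‖ = ‖fderiv ℝ f x‖ :=
  LinearIsometryEquiv.norm_map _ _

theorem inner_gradient_left {n : ℕ} (f : E n → ℝ) (x v : E n) :
    inner ℝ (gradient f x) v = fderiv ℝ f x v :=
  InnerProductSpace.toDual_symm_apply

theorem norm_gradient_sub {n : ℕ} (f : E n → ℝ) (x y : E n) :
    ‖gradient f x - gradient f y‖ = ‖fderiv ℝ f x - fderiv ℝ f y‖ := by
  rw [gradient, gradient, ← map_sub]
  exact LinearIsometryEquiv.norm_map _ _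

namespace IsMollifier

variable {n : ℕ} {Φ : E n → ℝ}

theorem hasCompactSupport (h : IsMollifier Φ) : HasCompactSupport Φ :=
  HasCompactSupport.intro (isCompact_closedBall (0 : E n) 1) fun x hx =>
    h.eq_zero x (by simpa using (not_le.1 (by simpa using hx)).le)

theorem continuous (h : IsMollifier Φ) : Continuous Φ := h.contDiff.continuous

theorem continuous_fderiv (h : IsMollifier Φ) : Continuous (fderiv ℝ Φ) :=
  h.contDiff.continuous_fderiv (by simp)

theorem continuous_gradient (h : IsMollifier Φ) : Continuous (gradient Φ) :=
  (LinearIsometryEquiv.continuous _).comp h.continuous_fderiv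

theorem integrable (h : IsMollifier Φ) : Integrable Φ :=
  h.continuous.integrable_of_hasCompactSupport h.hasCompactSupport

theorem integrable_fderiv (h : IsMollifier Φ) : Integrable (fderiv ℝ Φ) :=
  h.continuous_fderiv.integrable_of_hasCompactSupport (h.hasCompactSupport.fderiv ℝ)

theorem fderiv_eq_zero (h : IsMollifier Φ) {x : E n} (hx : 1 < ‖x‖) : fderiv ℝ Φ x = 0 := by
  have h1 : Φ =ᶠ[𝓝 x] fun _ => 0 := by
    filter_upwards [(isOpen_lt continuous_const continuous_norm).mem_nhds hx] with y hy
    exact h.eq_zero y (le_of_lt hy)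
  rw [h1.fderiv_eq]
  simp

/-- A qualitative constant with no control in `ε`. It suffices for integrability, continuity and the
Lipschitz property of the velocity; the mesh condition rests on the explicit bounds derived from
`IsCutoff`. -/
theorem exists_bound (h : IsMollifier Φ) : ∃ C : ℝ, 0 ≤ C ∧ (∀ x, Φ x ≤ C) ∧
    (∀ x, ‖fderiv ℝ Φ x‖ ≤ C) ∧ (∀ x y, |Φ x - Φ y| ≤ C * ‖x - y‖) ∧
    ∀ x y, ‖fderiv ℝ Φ x - fderiv ℝ Φ y‖ ≤ C * ‖x - y‖ := by
  obtain ⟨C1, hC1⟩ := h.hasCompactSupport.exists_bound_of_continuous h.continuous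
  obtain ⟨C2, hC2⟩ := (h.hasCompactSupport.fderiv ℝ).exists_bound_of_continuous h.continuous_fderiv
  obtain ⟨C3, hC3⟩ := ContDiff.lipschitzWith_of_hasCompactSupport (𝕂 := ℝ) h.hasCompactSupport
    h.contDiff (by simp)
  obtain ⟨C4, hC4⟩ := ContDiff.lipschitzWith_of_hasCompactSupport (𝕂 := ℝ)
    (h.hasCompactSupport.fderiv ℝ) (h.contDiff.fderiv_right (m := ∞) (by simp)) (by simp)
  have hC10 : 0 ≤ C1 := (norm_nonneg _).trans (hC1 0)
  have hC20 : 0 ≤ C2 := (norm_nonneg _).trans (hC2 0)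
  refine ⟨C1 + C2 + C3 + C4, by positivity, fun x => ?_, fun x => ?_, fun x y => ?_,
    fun x y => ?_⟩
  · have := (le_abs_self _).trans (hC1 x)
    linarith [C3.2, C4.2, show (0 : ℝ) ≤ C3 from C3.2, show (0 : ℝ) ≤ C4 from C4.2]
  · linarith [hC2 x, show (0 : ℝ) ≤ C3 from C3.2, show (0 : ℝ) ≤ C4 from C4.2]
  · have h1 := hC3.dist_le_mul x y
    rw [Real.dist_eq, dist_eq_norm] at h1
    refine h1.trans (mul_le_mul_of_nonneg_right ?_ (norm_nonneg _))
    linarith [show (0 : ℝ) ≤ C3 from C3.2, show (0 : ℝ) ≤ C4 from C4.2]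
  · have h1 := hC4.dist_le_mul x y
    rw [dist_eq_norm, dist_eq_norm x y] at h1
    refine h1.trans (mul_le_mul_of_nonneg_right ?_ (norm_nonneg _))
    linarith [show (0 : ℝ) ≤ C3 from C3.2, show (0 : ℝ) ≤ C4 from C4.2]

/-- A pointwise bound for the gradient by the mollifier itself gives an integral bound. -/
theorem integral_norm_fderiv_le (h : IsMollifier Φ) {a D : ℝ} (ha : 1 ≤ a) (hD0 : 0 ≤ D)
    (hD : ∀ x, ‖fderiv ℝ Φ x‖ ≤ a * Φ x + D) :
    ∫ x, ‖fderiv ℝ Φ x‖ ≤ (1 + D * volume.real (Metric.closedBall (0 : E n) 1)) * a := by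
  have hind : Integrable ((Metric.closedBall (0 : E n) 1).indicator fun _ => D) := by
    rw [integrable_indicator_iff Metric.isClosed_closedBall.measurableSet]
    exact integrableOn_const (hs := measure_closedBall_lt_top.ne)
  calc ∫ x, ‖fderiv ℝ Φ x‖
      ≤ ∫ x, (a * Φ x + (Metric.closedBall (0 : E n) 1).indicator (fun _ => D) x) := by
        refine integral_mono h.integrable_fderiv.norm ((h.integrable.const_mul a).add hind)
          fun x => ?_
        by_cases hx : x ∈ Metric.closedBall (0 : E n) 1
        · simp only [indicator_of_mem hx]; exact hD x
        · have hx' : 1 < ‖x‖ := by simpa using hx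
          simp only [indicator_of_notMem hx, h.fderiv_eq_zero hx', norm_zero, add_zero]
          exact mul_nonneg (by linarith) (h.nonneg x)
    _ = a + D * volume.real (Metric.closedBall (0 : E n) 1) := by
        rw [integral_add (h.integrable.const_mul a) hind, integral_const_mul, h.integral_eq_one,
          integral_indicator_const _ Metric.isClosed_closedBall.measurableSet]
        simp [mul_comm]
    _ ≤ _ := by
        have : 0 ≤ D * volume.real (Metric.closedBall (0 : E n) 1) :=
          mul_nonneg hD0 measureReal_nonneg
        nlinarith

end IsMollifier

/-! ### The truncated Gaussian -/

theorem gaussianKernel_eq {n : ℕ} {ε : ℝ} (hε : 0 < ε) (x : E n) :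
    gaussianKernel n ε x = ((2 * Real.pi) ^ ((n : ℝ) / 2))⁻¹ * (ε ^ n)⁻¹ *
      Real.exp (-(‖x‖ ^ 2 / (2 * ε ^ 2))) := by
  have h : (ε ^ 2 : ℝ) ^ ((n : ℝ) / 2) = ε ^ n := by
    rw [← Real.rpow_natCast ε 2, ← Real.rpow_mul hε.le, ← Real.rpow_natCast]
    congr 1
    push_cast
    ring
  rw [gaussianKernel, Real.mul_rpow (by positivity) (by positivity), h, one_div, mul_inv]

theorem gaussianKernel_pos {n : ℕ} {ε : ℝ} (hε : 0 < ε) (x : E n) : 0 < gaussianKernel n ε x := by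
  rw [gaussianKernel_eq hε]; positivity

theorem contDiff_gaussianKernel (n : ℕ) (ε : ℝ) : ContDiff ℝ ∞ (gaussianKernel n ε) := by
  unfold gaussianKernel
  exact contDiff_const.mul (((contDiff_norm_sq ℝ).div_const _).neg.exp)

theorem norm_fderiv_gaussianKernel_le {n : ℕ} {ε : ℝ} (hε : 0 < ε) (x : E n) :
    ‖fderiv ℝ (gaussianKernel n ε) x‖ ≤ ‖x‖ * (ε ^ 2)⁻¹ * gaussianKernel n ε x := by
  have h1 : HasFDerivAt (fun x : E n => -(‖x‖ ^ 2 / (2 * ε ^ 2)))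
      ((-(ε ^ 2)⁻¹) • innerSL ℝ x) x := by
    have h := ((hasStrictFDerivAt_norm_sq (F := E n) x).hasFDerivAt.const_mul
      ((2 * ε ^ 2)⁻¹)).neg
    refine (h.congr_fderiv ?_).congr_of_eventuallyEq (Eventually.of_forall fun y => ?_)
    · ext v
      simp
      field_simp
    · simp [div_eq_inv_mul]
  have h2 := h1.exp.const_mul (1 / (2 * Real.pi * ε ^ 2) ^ ((n : ℝ) / 2))
  rw [show gaussianKernel n ε = fun x => 1 / (2 * Real.pi * ε ^ 2) ^ ((n : ℝ) / 2) *
    Real.exp (-(‖x‖ ^ 2 / (2 * ε ^ 2))) from rfl, h2.fderiv]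
  rw [norm_smul, norm_smul, norm_smul, innerSL_apply_norm]
  rw [Real.norm_of_nonneg (by positivity), Real.norm_of_nonneg (by positivity), norm_neg,
    Real.norm_of_nonneg (by positivity)]
  exact le_of_eq (by ring)

/-- A lower bound for the integral of the truncated Gaussian. -/
noncomputable def gaussianMass (n : ℕ) : ℝ :=
  ((2 * Real.pi) ^ ((n : ℝ) / 2))⁻¹ * ((1 / 2) ^ n * volume.real (Metric.ball (0 : E n) 1)) *
    Real.exp (-(1 / 8))

theorem gaussianMass_pos (n : ℕ) : 0 < gaussianMass n := by
  have : 0 < volume.real (Metric.ball (0 : E n) 1) :=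
    ENNReal.toReal_pos (Metric.measure_ball_pos _ _ one_pos).ne' measure_ball_lt_top.ne
  unfold gaussianMass
  positivity

/-- A bound for the part of the gradient of the truncated Gaussian caused by the cut-off. -/
noncomputable def cutoffBound (n : ℕ) (K₁ : ℝ) : ℝ :=
  (gaussianMass n)⁻¹ * (K₁ * (((2 * Real.pi) ^ ((n : ℝ) / 2))⁻¹ * (8 ^ n * n.factorial)))

/-- Away from the origin the exponential beats the factor `ε⁻ⁿ`: with `u = 1 / (8 ε²)` one has `ε⁻ⁿ
≤ (8 u)ⁿ ≤ 8ⁿ n! exp u`, while the Gaussian exponential is at most `exp (-u)`. The result is uniform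
in `ε`. -/
theorem gaussianKernel_le_of_half_le {n : ℕ} {ε : ℝ} (hε : 0 < ε) (hε1 : ε < 1) {x : E n}
    (hx : 1 / 2 ≤ ‖x‖) :
    gaussianKernel n ε x ≤ ((2 * Real.pi) ^ ((n : ℝ) / 2))⁻¹ * (8 ^ n * n.factorial) := by
  rw [gaussianKernel_eq hε, mul_assoc]
  refine mul_le_mul_of_nonneg_left ?_ (by positivity)
  set u : ℝ := 1 / (8 * ε ^ 2)
  have hu : 0 ≤ u := by positivity
  have h1 : Real.exp (-(‖x‖ ^ 2 / (2 * ε ^ 2))) ≤ Real.exp (-u) := by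
    refine Real.exp_le_exp.2 (neg_le_neg ?_)
    have : (1 / 2 : ℝ) ^ 2 ≤ ‖x‖ ^ 2 := by gcongr
    rw [div_le_div_iff₀ (by positivity) (by positivity)]
    nlinarith [sq_nonneg ε, pow_pos hε 2]
  have h2 : (ε ^ n)⁻¹ ≤ 8 ^ n * u ^ n := by
    rw [← mul_pow, ← inv_pow]
    refine pow_le_pow_left₀ (by positivity) ?_ n
    have : (8 : ℝ) * u = (ε ^ 2)⁻¹ := by
      show 8 * (1 / (8 * ε ^ 2)) = _
      field_simp
    rw [this]
    exact inv_anti₀ (by positivity) (by nlinarith)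
  have h3 := Real.pow_div_factorial_le_exp u hu n
  have h4 : u ^ n ≤ n.factorial * Real.exp u := by
    rw [div_le_iff₀ (by positivity)] at h3
    linarith
  have h5 : Real.exp u * Real.exp (-u) = 1 := by rw [← Real.exp_add]; simp
  calc (ε ^ n)⁻¹ * Real.exp (-(‖x‖ ^ 2 / (2 * ε ^ 2)))
      ≤ (8 ^ n * (n.factorial * Real.exp u)) * Real.exp (-u) :=
        mul_le_mul (h2.trans (by gcongr)) h1 (Real.exp_pos _).le (by positivity)
    _ = 8 ^ n * n.factorial * (Real.exp u * Real.exp (-u)) := by ring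
    _ = _ := by rw [h5, mul_one]

namespace IsCutoff

variable {n : ℕ} {K₁ K₂ ε : ℝ} {ψ : E n → ℝ}

theorem integrable_mul (h : IsCutoff K₁ K₂ ψ) (ε : ℝ) :
    Integrable fun y => ψ y * gaussianKernel n ε y := by
  refine (h.contDiff.continuous.mul
    (contDiff_gaussianKernel n ε).continuous).integrable_of_hasCompactSupport ?_
  refine HasCompactSupport.intro (isCompact_closedBall (0 : E n) 1) fun x hx => ?_
  have : 1 < ‖x‖ := by simpa using hx
  simp [h.eq_zero x this.le]

/-- Only the ball of radius `ε / 2` is kept. There the cut-off is 1 and the exponential is at least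
`exp (-1/8)`, and the volume of order `εⁿ` cancels the factor `ε⁻ⁿ`. -/
theorem gaussianMass_le (h : IsCutoff K₁ K₂ ψ) (hε : 0 < ε) (hε1 : ε < 1) :
    gaussianMass n ≤ ∫ y, ψ y * gaussianKernel n ε y := by
  have hnn : ∀ y, 0 ≤ ψ y * gaussianKernel n ε y := fun y =>
    mul_nonneg (h.nonneg y) (gaussianKernel_pos hε y).le
  set s := Metric.ball (0 : E n) (ε * (1 / 2))
  have hs : volume.real s = (ε * (1 / 2)) ^ n * volume.real (Metric.ball (0 : E n) 1) := by
    rw [measureReal_def, Measure.addHaar_ball_of_pos _ _ (by positivity)]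
    simp [measureReal_def]
    left
    positivity
  calc gaussianMass n = ∫ y in s, ((2 * Real.pi) ^ ((n : ℝ) / 2))⁻¹ * (ε ^ n)⁻¹ *
        Real.exp (-(1 / 8)) := by
        rw [setIntegral_const, hs, gaussianMass, mul_pow, smul_eq_mul]
        field_simp
    _ ≤ ∫ y in s, ψ y * gaussianKernel n ε y := by
        refine setIntegral_mono_on (integrableOn_const (hs := measure_ball_lt_top.ne))
          (h.integrable_mul ε).integrableOn Metric.isOpen_ball.measurableSet fun y hy => ?_
        have hy' : ‖y‖ < ε * (1 / 2) := by simpa [s] using hy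
        rw [h.eq_one y (by nlinarith), one_mul, gaussianKernel_eq hε]
        refine mul_le_mul_of_nonneg_left (Real.exp_le_exp.2 (neg_le_neg ?_)) (by positivity)
        rw [div_le_div_iff₀ (by positivity) (by positivity)]
        have : ‖y‖ ^ 2 ≤ (ε * (1 / 2)) ^ 2 := by gcongr
        nlinarith
    _ ≤ _ := setIntegral_le_integral (h.integrable_mul ε) (ae_of_all _ hnn)

theorem normalization_pos (h : IsCutoff K₁ K₂ ψ) (hε : 0 < ε) (hε1 : ε < 1) :
    0 < ∫ y, ψ y * gaussianKernel n ε y :=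
  (gaussianMass_pos n).trans_le (h.gaussianMass_le hε hε1)

theorem isMollifier (h : IsCutoff K₁ K₂ ψ) (hε : 0 < ε) (hε1 : ε < 1) :
    IsMollifier (kernel ψ ε) where
  contDiff := (contDiff_const.mul h.contDiff).mul (contDiff_gaussianKernel n ε)
  eq_zero x hx := by simp [kernel, h.eq_zero x hx]
  nonneg x := mul_nonneg (mul_nonneg (one_div_pos.2 (h.normalization_pos hε hε1)).le (h.nonneg x))
    (gaussianKernel_pos hε x).le
  integral_eq_one := by
    simp only [kernel, mul_assoc]
    rw [integral_const_mul, one_div, inv_mul_cancel₀ (h.normalization_pos hε hε1).ne']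

theorem nonneg_gradientBound (h : IsCutoff K₁ K₂ ψ) : 0 ≤ K₁ :=
  (norm_nonneg _).trans (h.gradient_le 0)

theorem cutoffBound_nonneg (h : IsCutoff K₁ K₂ ψ) : 0 ≤ cutoffBound n K₁ := by
  have := h.nonneg_gradientBound
  have := gaussianMass_pos n
  unfold cutoffBound
  positivity

/-- The derivative of the Gaussian contributes `‖x‖ ε⁻²` times the kernel, with `‖x‖ ≤ 1` where the
cut-off is nonzero. The derivative of the cut-off lives where `‖x‖ ≥ 1/2`, and there the Gaussian is
bounded uniformly in `ε`. A bound by the kernel itself plus a constant is what the quotient defining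
`preMeanCurvature` can absorb. -/
theorem norm_fderiv_kernel_le (h : IsCutoff K₁ K₂ ψ) (hε : 0 < ε) (hε1 : ε < 1) (x : E n) :
    ‖fderiv ℝ (kernel ψ ε) x‖ ≤ (ε ^ 2)⁻¹ * kernel ψ ε x + cutoffBound n K₁ := by
  set c := 1 / ∫ y, ψ y * gaussianKernel n ε y
  have hc0 : 0 < c := one_div_pos.2 (h.normalization_pos hε hε1)
  have hc1 : c ≤ (gaussianMass n)⁻¹ := by
    show 1 / _ ≤ _
    rw [one_div]
    exact inv_anti₀ (gaussianMass_pos n) (h.gaussianMass_le hε hε1)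
  have hK := h.nonneg_gradientBound
  have hg := gaussianKernel_pos (n := n) hε x
  have hψ : HasFDerivAt ψ (fderiv ℝ ψ x) x :=
    (h.contDiff.differentiable (by simp) x).hasFDerivAt
  have hG : HasFDerivAt (gaussianKernel n ε) (fderiv ℝ (gaussianKernel n ε) x) x :=
    ((contDiff_gaussianKernel n ε).differentiable (by simp) x).hasFDerivAt
  have hk := (hψ.const_mul c).mul hG
  rw [show kernel ψ ε = (fun y => c * ψ y) * gaussianKernel n ε from rfl, hk.fderiv]
  refine (norm_add_le _ _).trans ?_
  rw [norm_smul, norm_smul, norm_smul, Real.norm_of_nonneg (mul_nonneg hc0.le (h.nonneg x)),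
    Real.norm_of_nonneg hg.le, Real.norm_of_nonneg hc0.le]
  refine add_le_add ?_ ?_
  · have h1 : ψ x * ‖x‖ ≤ ψ x := by
      rcases le_or_gt 1 ‖x‖ with hx | hx
      · simp [h.eq_zero x hx]
      · nlinarith [h.nonneg x]
    calc c * ψ x * ‖fderiv ℝ (gaussianKernel n ε) x‖
        ≤ c * ψ x * (‖x‖ * (ε ^ 2)⁻¹ * gaussianKernel n ε x) :=
          mul_le_mul_of_nonneg_left (norm_fderiv_gaussianKernel_le hε x)
            (mul_nonneg hc0.le (h.nonneg x))
      _ = c * (ψ x * ‖x‖) * (ε ^ 2)⁻¹ * gaussianKernel n ε x := by ring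
      _ ≤ c * ψ x * (ε ^ 2)⁻¹ * gaussianKernel n ε x := by gcongr
      _ = _ := by rw [Pi.mul_apply]; ring
  · rcases lt_or_ge ‖x‖ (1 / 2) with hx | hx
    · have h1 : ψ =ᶠ[𝓝 x] fun _ => 1 := by
        filter_upwards [(isOpen_lt continuous_norm continuous_const).mem_nhds hx] with y hy
        exact h.eq_one y (le_of_lt hy)
      rw [h1.fderiv_eq]
      simpa using h.cutoffBound_nonneg
    · have h1 : ‖fderiv ℝ ψ x‖ ≤ K₁ := by rw [← norm_gradient]; exact h.gradient_le x
      have h2 := gaussianKernel_le_of_half_le hε hε1 hx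
      calc gaussianKernel n ε x * (c * ‖fderiv ℝ ψ x‖)
          = c * (‖fderiv ℝ ψ x‖ * gaussianKernel n ε x) := by ring
        _ ≤ (gaussianMass n)⁻¹ * (K₁ * (((2 * Real.pi) ^ ((n : ℝ) / 2))⁻¹ *
              (8 ^ n * n.factorial))) := by
            have := gaussianMass_pos n
            gcongr
        _ = _ := rfl

end IsCutoff

/-! ### Mollification of vector fields -/

/-- The derivative at `x` of the mollification of the vector field `w`. -/
noncomputable def mollifyDeriv {n : ℕ} (Φ : E n → ℝ) (w : E n → E n) (x : E n) :
    E n →L[ℝ] E n :=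
  ∫ y, (fderiv ℝ Φ (x - y)).smulRight (w y)

namespace IsMollifier

variable {n : ℕ} {Φ : E n → ℝ} {w w' : E n → E n} {H : ℝ}

theorem norm_mollify_integrand_le (h : IsMollifier Φ) (hb : ∀ y, ‖w y‖ ≤ H) (x y : E n) :
    ‖Φ (x - y) • w y‖ ≤ H * Φ (x - y) := by
  rw [norm_smul, Real.norm_of_nonneg (h.nonneg _), mul_comm]
  exact mul_le_mul_of_nonneg_right (hb y) (h.nonneg _)

theorem norm_mollifyDeriv_integrand_le (Φ : E n → ℝ) (hb : ∀ y, ‖w y‖ ≤ H) (x y : E n) :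
    ‖(fderiv ℝ Φ (x - y)).smulRight (w y)‖ ≤ H * ‖fderiv ℝ Φ (x - y)‖ := by
  rw [ContinuousLinearMap.norm_smulRight_apply, mul_comm]
  exact mul_le_mul_of_nonneg_right (hb y) (norm_nonneg _)

theorem integrable_mollify (h : IsMollifier Φ) (hw : Continuous w) (hb : ∀ y, ‖w y‖ ≤ H)
    (x : E n) : Integrable fun y => Φ (x - y) • w y :=
  Integrable.mono' ((h.integrable.comp_sub_left x).const_mul H)
    ((h.continuous.comp (continuous_const.sub continuous_id)).smul hw).aestronglyMeasurable
    (ae_of_all _ (h.norm_mollify_integrand_le hb x))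

theorem integrable_mollifyDeriv (h : IsMollifier Φ) (hw : Continuous w) (hb : ∀ y, ‖w y‖ ≤ H)
    (x : E n) : Integrable fun y => (fderiv ℝ Φ (x - y)).smulRight (w y) := by
  refine Integrable.mono' ((h.integrable_fderiv.norm.comp_sub_left x).const_mul H) ?_
    (ae_of_all _ (norm_mollifyDeriv_integrand_le Φ hb x))
  have hc : Continuous fun y => (ContinuousLinearMap.smulRightL ℝ (E n) (E n)
      (fderiv ℝ Φ (x - y))) (w y) :=
    ((ContinuousLinearMap.continuous _).comp
      (h.continuous_fderiv.comp (continuous_const.sub continuous_id))).clm_apply hw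
  exact hc.aestronglyMeasurable

theorem norm_mollify_le (h : IsMollifier Φ) (hb : ∀ y, ‖w y‖ ≤ H)
    (x : E n) : ‖∫ y, Φ (x - y) • w y‖ ≤ H := by
  refine (norm_integral_le_of_norm_le ((h.integrable.comp_sub_left x).const_mul H)
    (ae_of_all _ (h.norm_mollify_integrand_le hb x))).trans ?_
  rw [integral_const_mul, integral_sub_left_eq_self, h.integral_eq_one, mul_one]

theorem norm_mollifyDeriv_le (h : IsMollifier Φ) (hb : ∀ y, ‖w y‖ ≤ H)
    (x : E n) : ‖mollifyDeriv Φ w x‖ ≤ H * ∫ y, ‖fderiv ℝ Φ y‖ := by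
  refine (norm_integral_le_of_norm_le ((h.integrable_fderiv.norm.comp_sub_left x).const_mul H)
    (ae_of_all _ (norm_mollifyDeriv_integrand_le Φ hb x))).trans ?_
  rw [integral_const_mul, integral_sub_left_eq_self fun y => ‖fderiv ℝ Φ y‖]

theorem mollify_sub (h : IsMollifier Φ) (hw : Continuous w) (hw' : Continuous w') {H' : ℝ}
    (hb : ∀ y, ‖w y‖ ≤ H) (hb' : ∀ y, ‖w' y‖ ≤ H') (x : E n) :
    (∫ y, Φ (x - y) • w y) - ∫ y, Φ (x - y) • w' y = ∫ y, Φ (x - y) • (w y - w' y) := by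
  rw [← integral_sub (h.integrable_mollify hw hb x) (h.integrable_mollify hw' hb' x)]
  simp only [smul_sub]

theorem mollifyDeriv_sub (h : IsMollifier Φ) (hw : Continuous w) (hw' : Continuous w') {H' : ℝ}
    (hb : ∀ y, ‖w y‖ ≤ H) (hb' : ∀ y, ‖w' y‖ ≤ H') (x : E n) :
    mollifyDeriv Φ w x - mollifyDeriv Φ w' x = mollifyDeriv Φ (fun y => w y - w' y) x := by
  rw [mollifyDeriv, mollifyDeriv, ← integral_sub (h.integrable_mollifyDeriv hw hb x)
    (h.integrable_mollifyDeriv hw' hb' x), mollifyDeriv]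
  congr 1
  funext y
  ext v
  simp [smul_sub]

theorem mollify_eq_convolution (Φ : E n → ℝ) (w : E n → E n) :
    (fun x => ∫ y, Φ (x - y) • w y) =
      convolution Φ w (ContinuousLinearMap.lsmul ℝ ℝ) volume := by
  funext x
  rw [convolution_eq_swap]
  rfl

theorem contDiff_mollify (h : IsMollifier Φ) (hw : Continuous w) :
    ContDiff ℝ ∞ fun x => ∫ y, Φ (x - y) • w y := by
  rw [mollify_eq_convolution]
  exact h.hasCompactSupport.contDiff_convolution_left _ (n := ⊤) h.contDiff
    hw.locallyIntegrable

theorem hasFDerivAt_mollify (h : IsMollifier Φ) (hw : Continuous w) (x : E n) :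
    HasFDerivAt (fun x => ∫ y, Φ (x - y) • w y) (mollifyDeriv Φ w x) x := by
  rw [mollify_eq_convolution]
  refine (h.hasCompactSupport.hasFDerivAt_convolution_left _ (h.contDiff.of_le (by simp))
    hw.locallyIntegrable x).congr_fderiv ?_
  rw [convolution_eq_swap]
  rfl

/-- The difference of the integrands vanishes outside the two unit balls around `x` and `x'`, hence
the factor 2 and the volume. -/
theorem norm_mollifyDeriv_sub_le (h : IsMollifier Φ) (hw : Continuous w)
    (hb : ∀ y, ‖w y‖ ≤ H) {C : ℝ}
    (hC : ∀ x y, ‖fderiv ℝ Φ x - fderiv ℝ Φ y‖ ≤ C * ‖x - y‖) (x x' : E n) :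
    ‖mollifyDeriv Φ w x - mollifyDeriv Φ w x'‖ ≤
      2 * (H * C * volume.real (Metric.closedBall (0 : E n) 1)) * ‖x - x'‖ := by
  have hH : 0 ≤ H := (norm_nonneg _).trans (hb 0)
  have hvol : ∀ z : E n, volume.real (Metric.closedBall z 1) =
      volume.real (Metric.closedBall (0 : E n) 1) := fun z => by
    rw [measureReal_def, measureReal_def, Measure.addHaar_closedBall_center]
  have hind : ∀ z : E n, Integrable ((Metric.closedBall z 1).indicator
      fun _ => H * (C * ‖x - x'‖)) := fun z => by
    rw [integrable_indicator_iff Metric.isClosed_closedBall.measurableSet]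
    exact integrableOn_const (hs := measure_closedBall_lt_top.ne)
  have hint : ∀ z : E n, ∫ y, (Metric.closedBall z 1).indicator
      (fun _ => H * (C * ‖x - x'‖)) y =
      H * C * volume.real (Metric.closedBall (0 : E n) 1) * ‖x - x'‖ := fun z => by
    rw [integral_indicator_const _ Metric.isClosed_closedBall.measurableSet, hvol, smul_eq_mul]
    ring
  rw [mollifyDeriv, mollifyDeriv, ← integral_sub (h.integrable_mollifyDeriv hw hb x)
    (h.integrable_mollifyDeriv hw hb x')]
  refine (norm_integral_le_of_norm_le ((hind x).add (hind x')) (ae_of_all _ fun y => ?_)).trans ?_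
  · have h1 : (fderiv ℝ Φ (x - y)).smulRight (w y) - (fderiv ℝ Φ (x' - y)).smulRight (w y) =
        (fderiv ℝ Φ (x - y) - fderiv ℝ Φ (x' - y)).smulRight (w y) := by
      ext v; simp [sub_smul]
    have h2 : ‖(fderiv ℝ Φ (x - y) - fderiv ℝ Φ (x' - y)).smulRight (w y)‖ ≤
        H * ‖fderiv ℝ Φ (x - y) - fderiv ℝ Φ (x' - y)‖ := by
      rw [ContinuousLinearMap.norm_smulRight_apply, mul_comm]
      exact mul_le_mul_of_nonneg_right (hb y) (norm_nonneg _)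
    have h3 := hC (x - y) (x' - y)
    rw [sub_sub_sub_cancel_right] at h3
    have h4 : 0 ≤ H * (C * ‖x - x'‖) := mul_nonneg hH ((norm_nonneg _).trans h3)
    have h5 : ∀ z, 0 ≤ (Metric.closedBall z 1).indicator (fun _ => H * (C * ‖x - x'‖)) y :=
      fun z => indicator_nonneg (fun _ _ => h4) y
    rw [h1]
    simp only [Pi.add_apply]
    by_cases hx : y ∈ Metric.closedBall x 1
    · have := h5 x'
      simp only [indicator_of_mem hx]
      linarith [h2.trans (mul_le_mul_of_nonneg_left h3 hH)]
    by_cases hx' : y ∈ Metric.closedBall x' 1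
    · have := h5 x
      simp only [indicator_of_mem hx']
      linarith [h2.trans (mul_le_mul_of_nonneg_left h3 hH)]
    · have h6 : 1 < ‖x - y‖ := by
        rw [← dist_eq_norm, dist_comm]; simpa using hx
      have h7 : 1 < ‖x' - y‖ := by
        rw [← dist_eq_norm, dist_comm]; simpa using hx'
      rw [h.fderiv_eq_zero h6, h.fderiv_eq_zero h7, sub_zero, norm_zero, mul_zero] at h2
      rw [h.fderiv_eq_zero h6, h.fderiv_eq_zero h7, sub_zero]
      linarith [h5 x, h5 x']
  · simp only [Pi.add_apply]
    rw [integral_add (hind x) (hind x'), hint, hint]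
    exact le_of_eq (by ring)

end IsMollifier

/-! ### The approximate mean curvature of a finite measure -/

section Curvature

variable {d n : ℕ} {ψ : E n → ℝ} {ε a D : ℝ}

theorem smoothedMass_eq (h : IsMollifier (kernel ψ ε)) (V : Measure (E n × Gr d n)) (x : E n) :
    smoothedMass ψ ε V x = ∫ p, kernel ψ ε (p.1 - x) ∂V := by
  rw [smoothedMass, massMeasure, integral_map measurable_fst.aemeasurable]
  exact (h.continuous.comp (continuous_id.sub continuous_const)).aestronglyMeasurable

theorem smoothedMass_nonneg (h : IsMollifier (kernel ψ ε)) (V : Measure (E n × Gr d n)) (x : E n) :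
    0 ≤ smoothedMass ψ ε V x :=
  integral_nonneg fun _ => h.nonneg _

theorem continuous_firstVariation_integrand (h : IsMollifier (kernel ψ ε)) :
    Continuous fun q : (E n × Gr d n) × E n =>
      q.1.2.proj (gradient (kernel ψ ε) (q.1.1 - q.2)) :=
  ((Gr.isometry_proj d n).continuous.comp (continuous_snd.comp continuous_fst)).clm_apply
    (h.continuous_gradient.comp ((continuous_fst.comp continuous_fst).sub continuous_snd))

theorem norm_firstVariation_integrand_le (ψ : E n → ℝ) (ε : ℝ) (p : E n × Gr d n) (x : E n) :
    ‖p.2.proj (gradient (kernel ψ ε) (p.1 - x))‖ ≤ ‖fderiv ℝ (kernel ψ ε) (p.1 - x)‖ :=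
  (p.2.norm_proj_apply_le _).trans (norm_gradient _ _).le

variable (V : Measure (E n × Gr d n)) [IsFiniteMeasure V]

theorem integrable_smoothedMass_integrand (h : IsMollifier (kernel ψ ε)) (x : E n) :
    Integrable (fun p : E n × Gr d n => kernel ψ ε (p.1 - x)) V := by
  obtain ⟨C, -, hC, -⟩ := h.exists_bound
  exact Integrable.of_bound (C := C)
    (h.continuous.comp (continuous_fst.sub continuous_const)).aestronglyMeasurable
    (ae_of_all _ fun p => by rw [Real.norm_of_nonneg (h.nonneg _)]; exact hC _)

theorem continuous_smoothedMass (h : IsMollifier (kernel ψ ε)) :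
    Continuous (smoothedMass ψ ε V) := by
  obtain ⟨C, -, hC, -⟩ := h.exists_bound
  rw [funext (smoothedMass_eq h V)]
  refine continuous_of_dominated (bound := fun _ => C) (fun x =>
    (integrable_smoothedMass_integrand V h x).aestronglyMeasurable)
    (fun x => ae_of_all _ fun p => ?_) (integrable_const C) (ae_of_all _ fun p => ?_)
  · rw [Real.norm_of_nonneg (h.nonneg _)]; exact hC _
  · exact h.continuous.comp (continuous_const.sub continuous_id)

theorem integrable_firstVariation_integrand (h : IsMollifier (kernel ψ ε)) (x : E n) :
    Integrable (fun p : E n × Gr d n => p.2.proj (gradient (kernel ψ ε) (p.1 - x))) V := by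
  obtain ⟨C, -, -, hC, -⟩ := h.exists_bound
  exact Integrable.of_bound (C := C) ((continuous_firstVariation_integrand h).comp
      (continuous_id.prodMk continuous_const)).aestronglyMeasurable
      (ae_of_all _ fun p => (norm_firstVariation_integrand_le ψ ε p x).trans (hC _))

theorem continuous_smoothedFirstVariation (h : IsMollifier (kernel ψ ε)) :
    Continuous (smoothedFirstVariation ψ ε V) := by
  obtain ⟨C, -, -, hC, -⟩ := h.exists_bound
  change Continuous fun x => ∫ p, p.2.proj (gradient (kernel ψ ε) (p.1 - x)) ∂V
  refine continuous_of_dominated (bound := fun _ => C)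
    (fun x => (integrable_firstVariation_integrand V h x).aestronglyMeasurable)
    (fun x => ae_of_all _ fun p => ?_) (integrable_const C) (ae_of_all _ fun p => ?_)
  · exact (norm_firstVariation_integrand_le ψ ε p x).trans (hC _)
  · exact p.2.proj.continuous.comp
      (h.continuous_gradient.comp (continuous_const.sub continuous_id))

theorem continuous_preMeanCurvature (h : IsMollifier (kernel ψ ε)) (hε : 0 < ε) :
    Continuous (preMeanCurvature ψ ε V) :=
  ((((continuous_smoothedMass V h).add continuous_const).inv₀ fun x =>
    (add_pos_of_nonneg_of_pos (smoothedMass_nonneg h V x) hε).ne').smul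
      (continuous_smoothedFirstVariation V h)).neg

theorem norm_smoothedFirstVariation_le (h : IsMollifier (kernel ψ ε))
    (hD : ∀ x, ‖fderiv ℝ (kernel ψ ε) x‖ ≤ a * kernel ψ ε x + D) (x : E n) :
    ‖smoothedFirstVariation ψ ε V x‖ ≤ a * smoothedMass ψ ε V x + D * V.real univ := by
  have hi := integrable_smoothedMass_integrand V h x
  calc _ ≤ ∫ p, (a * kernel ψ ε (p.1 - x) + D) ∂V :=
        norm_integral_le_of_norm_le ((hi.const_mul a).add (integrable_const D))
          (ae_of_all _ fun p => (norm_firstVariation_integrand_le ψ ε p x).trans (hD _))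
    _ = _ := by
        rw [integral_add (hi.const_mul a) (integrable_const D), integral_const_mul,
          smoothedMass_eq h, integral_const, smul_eq_mul, mul_comm D]

/-- The part `a (Φ_ε * ‖V‖)` of the numerator is absorbed by the denominator; only the remainder `D
‖V‖(ℝⁿ)` is divided by `ε`. -/
theorem norm_preMeanCurvature_le (h : IsMollifier (kernel ψ ε)) (hε : 0 < ε) (ha : 0 ≤ a)
    (hD0 : 0 ≤ D) (hD : ∀ x, ‖fderiv ℝ (kernel ψ ε) x‖ ≤ a * kernel ψ ε x + D) (x : E n) :
    ‖preMeanCurvature ψ ε V x‖ ≤ a + D * V.real univ / ε := by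
  have hm := smoothedMass_nonneg h V x
  have hN := norm_smoothedFirstVariation_le V h hD x
  have hV : 0 ≤ D * V.real univ := mul_nonneg hD0 measureReal_nonneg
  rw [preMeanCurvature, norm_neg, norm_smul, Real.norm_of_nonneg (by positivity),
    inv_mul_le_iff₀ (by positivity)]
  refine hN.trans ?_
  have h1 : D * V.real univ / ε * ε = D * V.real univ := by field_simp
  have h2 : 0 ≤ D * V.real univ / ε := by positivity
  nlinarith [mul_nonneg hm h2, mul_nonneg ha hε.le]

theorem hasFDerivAt_approxMeanCurvature (h : IsMollifier (kernel ψ ε)) (hε : 0 < ε) (x : E n) :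
    HasFDerivAt (approxMeanCurvature ψ ε V)
      (mollifyDeriv (kernel ψ ε) (preMeanCurvature ψ ε V) x) x :=
  h.hasFDerivAt_mollify (continuous_preMeanCurvature V h hε) x

theorem contDiff_approxMeanCurvature (h : IsMollifier (kernel ψ ε)) (hε : 0 < ε) :
    ContDiff ℝ ∞ (approxMeanCurvature ψ ε V) :=
  h.contDiff_mollify (continuous_preMeanCurvature V h hε)

theorem fderiv_approxMeanCurvature (h : IsMollifier (kernel ψ ε)) (hε : 0 < ε) (x : E n) :
    fderiv ℝ (approxMeanCurvature ψ ε V) x =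
      mollifyDeriv (kernel ψ ε) (preMeanCurvature ψ ε V) x :=
  (hasFDerivAt_approxMeanCurvature V h hε x).fderiv

/-! ### The first variation in the direction of the approximate mean curvature -/

/-- The trace over a plane as a continuous linear functional. -/
noncomputable def planeTraceCLM (S : Gr d n) : (E n →L[ℝ] E n) →L[ℝ] ℝ :=
  ∑ i, (innerSL ℝ (stdOrthonormalBasis ℝ S.1 i : E n)) ∘L
    (ContinuousLinearMap.apply ℝ (E n) (stdOrthonormalBasis ℝ S.1 i : E n))

theorem planeTraceCLM_apply (S : Gr d n) (L : E n →L[ℝ] E n) :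
    planeTraceCLM S L = planeTrace L S := by
  simp [planeTraceCLM, planeTrace]

theorem planeTrace_smulRight (S : Gr d n) (l : E n →L[ℝ] ℝ) (g w : E n)
    (hg : ∀ v, l v = inner ℝ g v) :
    planeTrace (l.smulRight w) S = inner ℝ (S.proj g) w := by
  have h : S.proj g = ∑ i, inner ℝ (stdOrthonormalBasis ℝ S.1 i : E n) g •
      (stdOrthonormalBasis ℝ S.1 i : E n) := by
    change S.1.starProjection g = _
    rw [(stdOrthonormalBasis ℝ S.1).starProjection_eq_sum_rankOne]
    simp
  rw [h, sum_inner, planeTrace]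
  refine Finset.sum_congr rfl fun i _ => ?_
  rw [ContinuousLinearMap.smulRight_apply, hg, real_inner_smul_left, real_inner_smul_right,
    real_inner_comm]

theorem planeTrace_mollifyDeriv {Φ : E n → ℝ} (h : IsMollifier Φ) {w : E n → E n} {H : ℝ}
    (hw : Continuous w) (hb : ∀ y, ‖w y‖ ≤ H) (x : E n) (S : Gr d n) :
    planeTrace (mollifyDeriv Φ w x) S =
      ∫ y, inner ℝ (S.proj (gradient Φ (x - y))) (w y) := by
  rw [← planeTraceCLM_apply, mollifyDeriv,
    ← ContinuousLinearMap.integral_comp_comm _ (h.integrable_mollifyDeriv hw hb x)]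
  refine integral_congr_ae (ae_of_all _ fun y => ?_)
  simp only [planeTraceCLM_apply]
  exact planeTrace_smulRight S _ _ _ fun v => (inner_gradient_left _ _ _).symm

/-- The Fubini hypothesis for the first variation. The field `w` need not be integrable: for fixed
`p` the integrand is dominated by `H ‖∇Φ_ε(p.1 - y)‖`, whose integral in `y` does not depend on `p`,
and `V` is finite. -/
theorem integrable_prod_firstVariation (h : IsMollifier (kernel ψ ε)) {w : E n → E n} {H : ℝ}
    (hw : Continuous w) (hb : ∀ y, ‖w y‖ ≤ H) :
    Integrable (fun q : (E n × Gr d n) × E n =>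
      (inner ℝ (q.1.2.proj (gradient (kernel ψ ε) (q.1.1 - q.2))) (w q.2) : ℝ))
      (V.prod volume) := by
  have hc : Continuous fun q : (E n × Gr d n) × E n =>
      (inner ℝ (q.1.2.proj (gradient (kernel ψ ε) (q.1.1 - q.2))) (w q.2) : ℝ) :=
    (continuous_firstVariation_integrand h).inner (hw.comp continuous_snd)
  have hle : ∀ (p : E n × Gr d n) (y : E n),
      ‖(inner ℝ (p.2.proj (gradient (kernel ψ ε) (p.1 - y))) (w y) : ℝ)‖ ≤
        H * ‖fderiv ℝ (kernel ψ ε) (p.1 - y)‖ := fun p y => by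
    refine (norm_inner_le_norm _ _).trans ?_
    rw [mul_comm]
    exact mul_le_mul (hb y) (norm_firstVariation_integrand_le ψ ε p y) (norm_nonneg _)
      ((norm_nonneg _).trans (hb y))
  have hint : ∀ x : E n, Integrable fun y => H * ‖fderiv ℝ (kernel ψ ε) (x - y)‖ := fun x =>
    (h.integrable_fderiv.norm.comp_sub_left x).const_mul H
  have hi : ∀ p : E n × Gr d n, Integrable fun y =>
      (inner ℝ (p.2.proj (gradient (kernel ψ ε) (p.1 - y))) (w y) : ℝ) := fun p =>
    Integrable.mono' (hint p.1)
      (hc.comp (continuous_const.prodMk continuous_id)).aestronglyMeasurable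
      (ae_of_all _ (hle p))
  rw [integrable_prod_iff hc.aestronglyMeasurable]
  refine ⟨ae_of_all _ hi, ?_⟩
  refine Integrable.of_bound (C := H * ∫ y, ‖fderiv ℝ (kernel ψ ε) y‖)
    hc.norm.aestronglyMeasurable.integral_prod_right' (ae_of_all _ fun p => ?_)
  rw [Real.norm_of_nonneg (integral_nonneg fun _ => norm_nonneg _)]
  refine (integral_mono (hi p).norm (hint p.1) (hle p)).trans ?_
  rw [integral_const_mul, integral_sub_left_eq_self fun y => ‖fderiv ℝ (kernel ψ ε) y‖]

/-- The approximate mean curvature is a direction of decrease of the mass. -/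
theorem integral_planeTrace_nonpos (h : IsMollifier (kernel ψ ε)) (hε : 0 < ε) {H : ℝ}
    (hb : ∀ y, ‖preMeanCurvature ψ ε V y‖ ≤ H) :
    Integrable (fun p : E n × Gr d n =>
      planeTrace (fderiv ℝ (approxMeanCurvature ψ ε V) p.1) p.2) V ∧
    ∫ p, planeTrace (fderiv ℝ (approxMeanCurvature ψ ε V) p.1) p.2 ∂V ≤ 0 := by
  have hw := continuous_preMeanCurvature V h hε
  have hprod := integrable_prod_firstVariation V h hw hb
  simp only [fderiv_approxMeanCurvature V h hε, planeTrace_mollifyDeriv h hw hb]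
  refine ⟨hprod.integral_prod_left, ?_⟩
  -- After the exchange the inner integral is the smoothed first variation at `y` paired with
  -- `preMeanCurvature`, a nonpositive multiple of that same vector. Both mollifications evaluate
  -- the gradient at `p.1 - y`, so no symmetry of the kernel is needed.
  rw [integral_integral_swap (f := fun (p : E n × Gr d n) y =>
    (inner ℝ (p.2.proj (gradient (kernel ψ ε) (p.1 - y))) (preMeanCurvature ψ ε V y) : ℝ)) hprod]
  refine integral_nonpos fun y => ?_
  have hi := integrable_firstVariation_integrand V h y
  have h1 : ∫ p : E n × Gr d n, (inner ℝ (p.2.proj (gradient (kernel ψ ε) (p.1 - y)))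
      (preMeanCurvature ψ ε V y) : ℝ) ∂V =
      inner ℝ (smoothedFirstVariation ψ ε V y) (preMeanCurvature ψ ε V y) := by
    simp only [real_inner_comm (preMeanCurvature ψ ε V y)]
    exact integral_inner hi _
  simp only [h1, Pi.zero_apply]
  rw [preMeanCurvature, inner_neg_right, real_inner_smul_right, real_inner_self_eq_norm_sq]
  have := smoothedMass_nonneg h V y
  have h2 : 0 ≤ (smoothedMass ψ ε V y + ε)⁻¹ * ‖smoothedFirstVariation ψ ε V y‖ ^ 2 := by
    positivity
  linarith

end Curvature

/-! ### The Euler maps -/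

/-- The perturbation is `1/2`-Lipschitz, so `id + h` is a global homeomorphism. Its differential `1
+ Dh` is everywhere invertible, and the inverse function theorem makes the inverse `C¹`. -/
theorem isC1Diffeo_id_add {n : ℕ} {h : E n → E n} (hh : ContDiff ℝ 1 h)
    (hb : ∀ x, ‖fderiv ℝ h x‖ ≤ 1 / 2) : IsC1Diffeo fun x => x + h x := by
  have hd := hh.differentiable one_ne_zero
  have hder : ∀ x, HasFDerivAt (fun x => x + h x) (1 + fderiv ℝ h x) x := fun x =>
    (hasFDerivAt_id x).add (hd x).hasFDerivAt
  have hC1 : ContDiff ℝ 1 fun x => x + h x := contDiff_id.add hh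
  have hL : LipschitzWith (1 / 2) h := lipschitzWith_of_nnnorm_fderiv_le hd fun x => by
    rw [← NNReal.coe_le_coe]
    simpa using hb x
  have happ : ApproximatesLinearOn (fun x => x + h x)
      (ContinuousLinearEquiv.refl ℝ (E n) : E n →L[ℝ] E n) univ (1 / 2) := by
    rw [ApproximatesLinearOn.approximatesLinearOn_iff_lipschitzOnWith]
    have : (fun x => x + h x) - ⇑(ContinuousLinearEquiv.refl ℝ (E n) : E n →L[ℝ] E n) = h := by
      funext x; simp
    rw [this]
    exact hL.lipschitzOnWith
  -- In dimension 0 the identity has norm 0 and the strict inequality fails, so that case is split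
  -- off.
  have hc : Subsingleton (E n) ∨ (1 / 2 : NNReal) <
      ‖((ContinuousLinearEquiv.refl ℝ (E n)).symm : E n →L[ℝ] E n)‖₊⁻¹ := by
    rcases subsingleton_or_nontrivial (E n) with hs | hs
    · exact Or.inl hs
    · right
      have : ‖((ContinuousLinearEquiv.refl ℝ (E n)).symm : E n →L[ℝ] E n)‖₊ = 1 := by
        simp
      rw [this, inv_one, ← NNReal.coe_lt_coe]
      norm_num
  let e := happ.toHomeomorph _ hc
  let L : E n → E n ≃L[ℝ] E n := fun x => (LinearEquiv.ofInjectiveEndo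
    ((1 + fderiv ℝ h x : E n →L[ℝ] E n) : E n →ₗ[ℝ] E n)
    (lowerBound_one_add (hb x)).injective).toContinuousLinearEquiv
  refine ⟨hC1, e.symm, ?_, e.symm_apply_apply, e.apply_symm_apply⟩
  refine Homeomorph.contDiff_symm (f₀' := L) e (fun x => ?_) hC1
  have hLx : (L x : E n →L[ℝ] E n) = 1 + fderiv ℝ h x := by
    ext1 v; rfl
  rw [hLx]
  exact hder x

theorem norm_smul_fderiv_le {d n : ℕ} {ψ : E n → ℝ} {ε : ℝ} (V : Measure (E n × Gr d n)) {τ B b : ℝ} (hτ : 0 ≤ τ)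
    (hB : ∀ x, ‖fderiv ℝ (approxMeanCurvature ψ ε V) x‖ ≤ B) (hτB : τ * B ≤ b) (x : E n) :
    ‖τ • fderiv ℝ (approxMeanCurvature ψ ε V) x‖ ≤ b := by
  rw [norm_smul, Real.norm_of_nonneg hτ]
  exact (mul_le_mul_of_nonneg_left (hB x) hτ).trans hτB

section EulerMap

variable {d n : ℕ} {ψ : E n → ℝ} {ε : ℝ} (V : Measure (E n × Gr d n)) [IsFiniteMeasure V]

theorem fderiv_eulerMap (h : IsMollifier (kernel ψ ε)) (hε : 0 < ε) (τ : ℝ) (x : E n) :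
    fderiv ℝ (eulerMap ψ ε τ V) x = 1 + τ • fderiv ℝ (approxMeanCurvature ψ ε V) x := by
  have h1 := (hasFDerivAt_approxMeanCurvature V h hε x).differentiableAt.hasFDerivAt
  exact ((hasFDerivAt_id x).add (h1.const_smul τ)).fderiv

theorem isC1Diffeo_eulerMap (h : IsMollifier (kernel ψ ε)) (hε : 0 < ε) {τ B : ℝ} (hτ : 0 ≤ τ)
    (hB : ∀ x, ‖fderiv ℝ (approxMeanCurvature ψ ε V) x‖ ≤ B) (hτB : τ * B ≤ 1 / 2) :
    IsC1Diffeo (eulerMap ψ ε τ V) := by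
  have hc : ContDiff ℝ 1 (approxMeanCurvature ψ ε V) :=
    (contDiff_approxMeanCurvature V h hε).of_le (by simp)
  refine isC1Diffeo_id_add (hc.const_smul τ) fun x => ?_
  have h1 := ((hc.differentiable one_ne_zero x).hasFDerivAt.const_smul τ).fderiv
  have h2 := norm_smul_fderiv_le V hτ hB hτB x
  rw [← h1] at h2
  exact h2

theorem admissible_eulerMap (h : IsMollifier (kernel ψ ε)) (hε : 0 < ε) {τ B : ℝ} (hτ : 0 ≤ τ)
    (hB : ∀ x, ‖fderiv ℝ (approxMeanCurvature ψ ε V) x‖ ≤ B) (hτB : τ * B ≤ 1 / 2) :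
    Admissible 2 (eulerMap ψ ε τ V) (fderiv ℝ (eulerMap ψ ε τ V)) := by
  have hc := (isC1Diffeo_eulerMap V h hε hτ hB hτB).1
  refine ⟨hc.continuous, hc.continuous_fderiv one_ne_zero, fun x => ?_⟩
  rw [fderiv_eulerMap V h hε]
  exact one_add_mem_controlled (norm_smul_fderiv_le V hτ hB hτB x)

theorem planeTrace_smul (c : ℝ) (L : E n →L[ℝ] E n) (S : Gr d n) :
    planeTrace (c • L) S = c * planeTrace L S := by
  rw [← planeTraceCLM_apply, map_smul, planeTraceCLM_apply, smul_eq_mul]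

/-- An Euler step increases the mass at most quadratically in the time step. -/
theorem mass_pushforward_eulerMap_le (hn : 1 ≤ n) (hdn : d ≤ n) (h : IsMollifier (kernel ψ ε))
    (hε : 0 < ε) {τ B H : ℝ} (hτ : 0 ≤ τ) (hb : ∀ y, ‖preMeanCurvature ψ ε V y‖ ≤ H)
    (hB : ∀ x, ‖fderiv ℝ (approxMeanCurvature ψ ε V) x‖ ≤ B) (hτB : 2 * n * (τ * B) ≤ 1) :
    pushforward (eulerMap ψ ε τ V) V univ ≤
      ENNReal.ofReal (V.real univ * (1 + 3 * n ^ 2 * (τ * B) ^ 2)) := by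
  have hn' : (1 : ℝ) ≤ n := by exact_mod_cast hn
  have hB0 : 0 ≤ B := (norm_nonneg _).trans (hB 0)
  have hτB0 : 0 ≤ τ * B := mul_nonneg hτ hB0
  have hτB2 : τ * B ≤ 1 / 2 := by nlinarith
  obtain ⟨hint, hneg⟩ := integral_planeTrace_nonpos V h hε hb
  rw [pushforward_eq_transport, (admissible_eulerMap V h hε hτ hB hτB2).transport_univ]
  set c := 3 * (n : ℝ) ^ 2 * (τ * B) ^ 2
  have hle : ∀ p : E n × Gr d n, tangentialJacobian (fderiv ℝ (eulerMap ψ ε τ V) p.1) p.2 ≤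
      1 + c + τ * planeTrace (fderiv ℝ (approxMeanCurvature ψ ε V) p.1) p.2 := fun p => by
    have h1 := norm_smul_fderiv_le V hτ hB le_rfl p.1
    have h2 : 2 * n * ‖τ • fderiv ℝ (approxMeanCurvature ψ ε V) p.1‖ ≤ 1 :=
      le_trans (by gcongr) hτB
    have h3 := tangentialJacobian_one_add_le hdn _ h2 p.2
    rw [planeTrace_smul] at h3
    rw [fderiv_eulerMap V h hε]
    have h4 : 3 * (n : ℝ) ^ 2 * ‖τ • fderiv ℝ (approxMeanCurvature ψ ε V) p.1‖ ^ 2 ≤ c := by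
      show _ ≤ 3 * (n : ℝ) ^ 2 * (τ * B) ^ 2
      gcongr
    linarith
  have hint' := (integrable_const (μ := V) (1 + c)).add (hint.const_mul τ)
  calc _ ≤ ∫⁻ p, ENNReal.ofReal
        (1 + c + τ * planeTrace (fderiv ℝ (approxMeanCurvature ψ ε V) p.1) p.2) ∂V :=
        lintegral_mono fun p => ENNReal.ofReal_le_ofReal (hle p)
    -- The integrand dominates a Jacobian and is therefore nonnegative. This permits passing to the
    -- Bochner integral, where the sign of the integrated trace can be used.
    _ = ENNReal.ofReal (∫ p,
        (1 + c + τ * planeTrace (fderiv ℝ (approxMeanCurvature ψ ε V) p.1) p.2) ∂V) :=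
        (ofReal_integral_eq_lintegral_ofReal hint' (ae_of_all _ fun p =>
          (tangentialJacobian_nonneg _ _).trans (hle p))).symm
    _ ≤ _ := by
        refine ENNReal.ofReal_le_ofReal ?_
        rw [integral_add (integrable_const _) (hint.const_mul τ), integral_const,
          integral_const_mul, smul_eq_mul]
        nlinarith

end EulerMap

open scoped BoundedContinuousFunction

/-! ### The Lagrangian velocity field -/

open Classical in
/-- A function as a bounded continuous function, with default value `0`. -/
noncomputable def toBCF {α F : Type*} [TopologicalSpace α] [NormedAddCommGroup F] (g : α → F) :
    α →ᵇ F :=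
  if h : Continuous g ∧ ∃ C, ∀ x, ‖g x‖ ≤ C then
    BoundedContinuousFunction.ofNormedAddCommGroup g h.1 h.2.choose h.2.choose_spec
  else 0

theorem toBCF_apply {α F : Type*} [TopologicalSpace α] [NormedAddCommGroup F] {g : α → F}
    (hg : Continuous g) {C : ℝ} (hC : ∀ x, ‖g x‖ ≤ C) (x : α) : toBCF g x = g x := by
  have h : Continuous g ∧ ∃ C, ∀ x, ‖g x‖ ≤ C := ⟨hg, C, hC⟩
  rw [toBCF, dif_pos h]
  rfl

/-- The Lagrangian states: a displacement and a deformation field. -/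
abbrev LagrangianState (n : ℕ) : Type := (E n →ᵇ E n) × (E n →ᵇ (E n →L[ℝ] E n))

/-- The varifold obtained from `V₀` by a displacement and a deformation field. -/
noncomputable def stateMeasure {d n : ℕ} (V₀ : Measure (E n × Gr d n)) (y : LagrangianState n) :
    Measure (E n × Gr d n) :=
  transport V₀ (fun x => x + y.1 x) y.2

/-- The velocity of a state under the approximate mean curvature flow. -/
noncomputable def velocity {d n : ℕ} (ψ : E n → ℝ) (ε : ℝ) (V₀ : Measure (E n × Gr d n))
    (y : LagrangianState n) : LagrangianState n :=
  (toBCF fun x => approxMeanCurvature ψ ε (stateMeasure V₀ y) (x + y.1 x),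
    toBCF fun x => fderiv ℝ (approxMeanCurvature ψ ε (stateMeasure V₀ y)) (x + y.1 x) ∘L y.2 x)

/-- The states whose deformation field is controlled by `R`. -/
def controlledStates (n : ℕ) (R : ℝ) : Set (LagrangianState n) :=
  {y | ∀ x, y.2 x ∈ controlled n R}

theorem isClosed_controlledStates (n : ℕ) (R : ℝ) : IsClosed (controlledStates n R) := by
  have h : controlledStates n R = ⋂ x, {y | y.2 x ∈ controlled n R} := by
    ext y; simp [controlledStates]
  rw [h]
  refine isClosed_iInter fun x => (isClosed_controlled n R).preimage ?_
  exact (continuous_eval_const x).comp continuous_snd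

section

variable {d n : ℕ} {R : ℝ} {y y' : LagrangianState n}

theorem admissible_of_mem_controlledStates (hy : y ∈ controlledStates n R) :
    Admissible R (fun x => x + y.1 x) y.2 :=
  ⟨continuous_id.add y.1.continuous, y.2.continuous, hy⟩

theorem norm_displacement_sub_le (y y' : LagrangianState n) (x : E n) :
    ‖(x + y.1 x) - (x + y'.1 x)‖ ≤ ‖y - y'‖ := by
  rw [add_sub_add_left_eq_sub]
  exact ((y.1 - y'.1).norm_coe_le_norm x).trans (norm_fst_le (y - y'))

theorem norm_field_sub_le (y y' : LagrangianState n) (x : E n) :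
    ‖y.2 x - y'.2 x‖ ≤ ‖y - y'‖ :=
  ((y.2 - y'.2).norm_coe_le_norm x).trans (norm_snd_le (y - y'))

theorem norm_lagrangianState_le {C : ℝ} (hC : 0 ≤ C) (h1 : ∀ x, ‖y.1 x‖ ≤ C)
    (h2 : ∀ x, ‖y.2 x‖ ≤ C) : ‖y‖ ≤ C :=
  max_le ((BoundedContinuousFunction.norm_le hC).2 h1) ((BoundedContinuousFunction.norm_le hC).2 h2)

variable {ψ : E n → ℝ} {ε : ℝ} (V₀ : Measure (E n × Gr d n)) [IsFiniteMeasure V₀]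

theorem isFiniteMeasure_stateMeasure (hdn : d ≤ n) (hy : y ∈ controlledStates n R) :
    IsFiniteMeasure (stateMeasure V₀ y) :=
  (admissible_of_mem_controlledStates hy).isFiniteMeasure_transport hdn V₀

theorem real_stateMeasure_le (hdn : d ≤ n) (hy : y ∈ controlledStates n R) :
    (stateMeasure V₀ y).real univ ≤ jacobianBound n R * V₀.real univ := by
  have hA := admissible_of_mem_controlledStates hy
  have h := hA.integral_transport hdn V₀ (φ := fun _ => (1 : ℝ)) continuous_const
  simp only [integral_const, smul_eq_mul, mul_one] at h
  rw [stateMeasure, h]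
  refine (Real.le_norm_self _).trans ?_
  refine norm_integral_le_of_norm_le_const (μ := V₀) (ae_of_all _ fun p => ?_)
  rw [Real.norm_of_nonneg (tangentialJacobian_nonneg _ _)]
  exact tangentialJacobian_le hdn (hy p.1).1 p.2

theorem exists_preMeanCurvature_bound (hdn : d ≤ n) (h : IsMollifier (kernel ψ ε)) (hε : 0 < ε)
    (R : ℝ) : ∃ H, 0 ≤ H ∧ ∀ y ∈ controlledStates n R, ∀ x,
      ‖preMeanCurvature ψ ε (stateMeasure V₀ y) x‖ ≤ H := by
  obtain ⟨C, hC0, -, hC, -⟩ := h.exists_bound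
  have hJ := jacobianBound_nonneg n R
  refine ⟨0 + C * (jacobianBound n R * V₀.real univ) / ε, by positivity, fun y hy x => ?_⟩
  have := isFiniteMeasure_stateMeasure V₀ hdn hy
  refine (norm_preMeanCurvature_le (stateMeasure V₀ y) h hε le_rfl hC0
    (fun x => by simpa using hC x) x).trans ?_
  gcongr
  exact real_stateMeasure_le V₀ hdn hy

/-- The kernel and `(y, S) ↦ S(∇Φ_ε(y - x))` are bounded Lipschitz test functions uniformly in `x`,
so the smoothed mass and first variation inherit the Lipschitz estimate for transports. The quotient
is harmless because its denominator is at least `ε`. -/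
theorem exists_preMeanCurvature_lipschitz (hdn : d ≤ n) (h : IsMollifier (kernel ψ ε))
    (hε : 0 < ε) (R : ℝ) : ∃ c, 0 ≤ c ∧ ∀ y ∈ controlledStates n R, ∀ y' ∈ controlledStates n R,
      ∀ x, ‖preMeanCurvature ψ ε (stateMeasure V₀ y) x -
        preMeanCurvature ψ ε (stateMeasure V₀ y') x‖ ≤ c * ‖y - y'‖ := by
  rcases lt_or_ge R 0 with hR | hR
  · exact ⟨0, le_rfl, fun y hy => absurd ((norm_nonneg _).trans (hy 0).1) (not_le.2 hR)⟩
  obtain ⟨C, hC0, hC1, hC2, hC3, hC4⟩ := h.exists_bound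
  obtain ⟨H, hH0, hH⟩ := exists_preMeanCurvature_bound V₀ hdn h hε R
  have hJ := jacobianBound_nonneg n R
  have hJ' := jacobianLip_nonneg n hR
  set c := (jacobianLip n R * C + jacobianBound n R * (1 + 2 * R) * (2 * C)) * V₀.real univ
  have hc : 0 ≤ c := by positivity
  refine ⟨ε⁻¹ * (c * (1 + H)), by positivity, fun y hy y' hy' x => ?_⟩
  have hA := admissible_of_mem_controlledStates hy
  have hA' := admissible_of_mem_controlledStates hy'
  have hm : |smoothedMass ψ ε (stateMeasure V₀ y) x - smoothedMass ψ ε (stateMeasure V₀ y') x| ≤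
      c * ‖y - y'‖ := by
    rw [smoothedMass_eq h, smoothedMass_eq h]
    refine hA.norm_integral_sub_integral_le hA' hdn V₀ (b := C) (l := 2 * C)
      (φ := fun p : E n × Gr d n => kernel ψ ε (p.1 - x))
      (fun p => ?_) (fun p q => ?_) (by positivity) (norm_displacement_sub_le y y')
      (norm_field_sub_le y y')
    · rw [Real.norm_of_nonneg (h.nonneg _)]; exact hC1 _
    · have h1 := hC3 (p.1 - x) (q.1 - x)
      rw [sub_sub_sub_cancel_right, ← dist_eq_norm] at h1
      have h2 : dist p.1 q.1 ≤ dist p q := le_max_left _ _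
      rw [Real.norm_eq_abs]
      nlinarith [mul_le_mul_of_nonneg_left h2 hC0, dist_nonneg (x := p) (y := q),
        mul_nonneg hC0 (dist_nonneg (x := p) (y := q))]
  have hN : ‖smoothedFirstVariation ψ ε (stateMeasure V₀ y) x -
      smoothedFirstVariation ψ ε (stateMeasure V₀ y') x‖ ≤ c * ‖y - y'‖ := by
    refine hA.norm_integral_sub_integral_le hA' hdn V₀ (b := C) (l := 2 * C)
      (φ := fun p : E n × Gr d n => p.2.proj (gradient (kernel ψ ε) (p.1 - x)))
      (fun p => ?_) (fun p q => ?_) (by positivity) (norm_displacement_sub_le y y')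
      (norm_field_sub_le y y')
    · exact (norm_firstVariation_integrand_le ψ ε p x).trans (hC2 _)
    · have h1 := hC4 (p.1 - x) (q.1 - x)
      rw [sub_sub_sub_cancel_right, ← dist_eq_norm p.1 q.1, ← norm_gradient_sub] at h1
      have h2 : dist p.1 q.1 ≤ dist p q := le_max_left _ _
      have h3 : dist p.2 q.2 ≤ dist p q := le_max_right _ _
      rw [Gr.dist_eq] at h3
      set g := gradient (kernel ψ ε) (p.1 - x)
      set g' := gradient (kernel ψ ε) (q.1 - x)
      have h4 : ‖g‖ ≤ C := (norm_gradient _ _).trans_le (hC2 _)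
      have h5 : p.2.proj g - q.2.proj g' = (p.2.proj - q.2.proj) g + q.2.proj (g - g') := by
        simp
      rw [h5]
      refine (norm_add_le _ _).trans ?_
      have h6 := ((p.2.proj - q.2.proj).le_opNorm g).trans
        (mul_le_mul h3 h4 (norm_nonneg _) dist_nonneg)
      have h7 := (q.2.norm_proj_apply_le (g - g')).trans
        (h1.trans (mul_le_mul_of_nonneg_left h2 hC0))
      linarith
  have hm0 := smoothedMass_nonneg h (stateMeasure V₀ y) x
  have hm0' := smoothedMass_nonneg h (stateMeasure V₀ y') x
  have hH' := hH y' hy' x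
  rw [preMeanCurvature, norm_neg] at hH'
  rw [preMeanCurvature, preMeanCurvature]
  set m := smoothedMass ψ ε (stateMeasure V₀ y) x
  set m' := smoothedMass ψ ε (stateMeasure V₀ y') x
  set N := smoothedFirstVariation ψ ε (stateMeasure V₀ y) x
  set N' := smoothedFirstVariation ψ ε (stateMeasure V₀ y') x
  have hme : 0 < m + ε := by positivity
  have hme' : 0 < m' + ε := by positivity
  -- The difference is arranged so that the complete quotient for `y'` appears; its norm is already
  -- bounded by `H`, so no separate bound for `N'` is needed.
  have hdiff : -((m + ε)⁻¹ • N) - -((m' + ε)⁻¹ • N') =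
      (m + ε)⁻¹ • ((m - m') • ((m' + ε)⁻¹ • N') - (N - N')) := by
    have h1 : (m + ε)⁻¹ * (m - m') * (m' + ε)⁻¹ = (m' + ε)⁻¹ - (m + ε)⁻¹ := by
      field_simp
      ring
    rw [smul_sub, smul_smul, smul_smul, h1]
    module
  rw [hdiff, norm_smul, Real.norm_of_nonneg (by positivity), mul_assoc]
  have h1 : (m + ε)⁻¹ ≤ ε⁻¹ := inv_anti₀ hε (by linarith)
  have h2 : ‖(m - m') • ((m' + ε)⁻¹ • N')‖ ≤ c * ‖y - y'‖ * H := by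
    rw [norm_smul]
    exact mul_le_mul hm hH' (norm_nonneg _) (by positivity)
  refine mul_le_mul h1 ((norm_sub_le _ _).trans ?_) (norm_nonneg _) (by positivity)
  linarith

section Velocity

variable (hdn : d ≤ n) (h : IsMollifier (kernel ψ ε)) (hε : 0 < ε)
include hdn h hε

/-- On controlled states both components are continuous and bounded, so the default branch of
`toBCF` is not taken. -/
theorem velocity_apply (hy : y ∈ controlledStates n R) (x : E n) :
    (velocity ψ ε V₀ y).1 x = approxMeanCurvature ψ ε (stateMeasure V₀ y) (x + y.1 x) ∧
    (velocity ψ ε V₀ y).2 x =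
      fderiv ℝ (approxMeanCurvature ψ ε (stateMeasure V₀ y)) (x + y.1 x) ∘L y.2 x := by
  have := isFiniteMeasure_stateMeasure V₀ hdn hy
  obtain ⟨H, hH0, hH⟩ := exists_preMeanCurvature_bound V₀ hdn h hε R
  have hA := admissible_of_mem_controlledStates hy
  have hc := contDiff_approxMeanCurvature (stateMeasure V₀ y) h hε
  refine ⟨toBCF_apply (hc.continuous.comp hA.continuous_map)
    (C := H) (fun x => h.norm_mollify_le (hH y hy) _) x,
    toBCF_apply (((hc.continuous_fderiv (by simp)).comp hA.continuous_map).clm_comp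
      hA.continuous_field) (C := H * (∫ y, ‖fderiv ℝ (kernel ψ ε) y‖) * R) (fun x => ?_) x⟩
  refine (ContinuousLinearMap.opNorm_comp_le _ _).trans ?_
  rw [Function.comp, fderiv_approxMeanCurvature _ h hε]
  exact mul_le_mul (h.norm_mollifyDeriv_le (hH y hy) _) (hy x).1 (norm_nonneg _)
    (mul_nonneg hH0 (integral_nonneg fun _ => norm_nonneg _))

theorem exists_velocity_bound (R : ℝ) :
    ∃ C, 0 ≤ C ∧ ∀ y ∈ controlledStates n R, ‖velocity ψ ε V₀ y‖ ≤ C := by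
  rcases lt_or_ge R 0 with hR | hR
  · exact ⟨0, le_rfl, fun y hy => absurd ((norm_nonneg _).trans (hy 0).1) (not_le.2 hR)⟩
  obtain ⟨H, hH0, hH⟩ := exists_preMeanCurvature_bound V₀ hdn h hε R
  have hI : 0 ≤ ∫ y, ‖fderiv ℝ (kernel ψ ε) y‖ := integral_nonneg fun _ => norm_nonneg _
  refine ⟨H + H * (∫ y, ‖fderiv ℝ (kernel ψ ε) y‖) * R, by positivity, fun y hy => ?_⟩
  have := isFiniteMeasure_stateMeasure V₀ hdn hy
  refine norm_lagrangianState_le (by positivity) (fun x => ?_) fun x => ?_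
  · rw [(velocity_apply V₀ hdn h hε hy x).1]
    exact (h.norm_mollify_le (hH y hy) _).trans (le_add_of_nonneg_right (by positivity))
  · rw [(velocity_apply V₀ hdn h hε hy x).2, fderiv_approxMeanCurvature _ h hε]
    refine (ContinuousLinearMap.opNorm_comp_le _ _).trans ?_
    refine (mul_le_mul (h.norm_mollifyDeriv_le (hH y hy) _) (hy x).1 (norm_nonneg _)
      (by positivity)).trans ?_
    exact le_add_of_nonneg_left hH0

theorem exists_velocity_lipschitz (R : ℝ) :
    ∃ K : NNReal, LipschitzOnWith K (velocity ψ ε V₀) (controlledStates n R) := by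
  rcases lt_or_ge R 0 with hR | hR
  · exact ⟨0, fun y hy => absurd ((norm_nonneg _).trans (hy 0).1) (not_le.2 hR)⟩
  obtain ⟨H, hH0, hH⟩ := exists_preMeanCurvature_bound V₀ hdn h hε R
  obtain ⟨c, hc0, hc⟩ := exists_preMeanCurvature_lipschitz V₀ hdn h hε R
  obtain ⟨C, hC0, -, -, -, hC⟩ := h.exists_bound
  set I := ∫ y, ‖fderiv ℝ (kernel ψ ε) y‖
  have hI : 0 ≤ I := integral_nonneg fun _ => norm_nonneg _
  set G := 2 * (H * C * volume.real (Metric.closedBall (0 : E n) 1))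
  have hG : 0 ≤ G := by
    have : 0 ≤ volume.real (Metric.closedBall (0 : E n) 1) := measureReal_nonneg
    positivity
  -- The first bracket is the Lipschitz constant of the displacement component, the second that of
  -- the field component.
  have hK : 0 ≤ (c + H * I) + (c * I * R + G * R + H * I) := by positivity
  refine ⟨Real.toNNReal ((c + H * I) + (c * I * R + G * R + H * I)), LipschitzOnWith.of_dist_le_mul fun y hy y' hy' => ?_⟩
  have hfin := isFiniteMeasure_stateMeasure V₀ hdn hy
  have hfin' := isFiniteMeasure_stateMeasure V₀ hdn hy'
  have hw := continuous_preMeanCurvature (stateMeasure V₀ y) h hε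
  have hw' := continuous_preMeanCurvature (stateMeasure V₀ y') h hε
  rw [Real.coe_toNNReal _ hK]
  refine ((dist_eq_norm (velocity ψ ε V₀ y) (velocity ψ ε V₀ y')).trans_le ?_).trans_eq
    (congrArg _ (dist_eq_norm y y').symm)
  set δ := ‖y - y'‖
  have hδ : 0 ≤ δ := norm_nonneg (y - y')
  have hdisp := norm_displacement_sub_le y y'
  have hcδ : 0 ≤ c * δ := by positivity
  have hval : ∀ x, ‖approxMeanCurvature ψ ε (stateMeasure V₀ y) x -
      approxMeanCurvature ψ ε (stateMeasure V₀ y') x‖ ≤ c * δ := fun x => by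
    rw [approxMeanCurvature, approxMeanCurvature,
      h.mollify_sub hw hw' (hH y hy) (hH y' hy')]
    exact h.norm_mollify_le (hc y hy y' hy') x
  have hder : ∀ x, ‖fderiv ℝ (approxMeanCurvature ψ ε (stateMeasure V₀ y)) x -
      fderiv ℝ (approxMeanCurvature ψ ε (stateMeasure V₀ y')) x‖ ≤ c * δ * I := fun x => by
    rw [fderiv_approxMeanCurvature _ h hε, fderiv_approxMeanCurvature _ h hε,
      h.mollifyDeriv_sub hw hw' (hH y hy) (hH y' hy')]
    exact h.norm_mollifyDeriv_le (hc y hy y' hy') x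
  have hder' : ∀ x, ‖fderiv ℝ (approxMeanCurvature ψ ε (stateMeasure V₀ y')) x‖ ≤ H * I :=
    fun x => by
      rw [fderiv_approxMeanCurvature _ h hε]
      exact h.norm_mollifyDeriv_le (hH y' hy') x
  have hder2 : ∀ x x', ‖fderiv ℝ (approxMeanCurvature ψ ε (stateMeasure V₀ y')) x -
      fderiv ℝ (approxMeanCurvature ψ ε (stateMeasure V₀ y')) x'‖ ≤ G * ‖x - x'‖ :=
    fun x x' => by
      rw [fderiv_approxMeanCurvature _ h hε, fderiv_approxMeanCurvature _ h hε]
      exact h.norm_mollifyDeriv_sub_le hw' (hH y' hy') hC x x'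
  have hlip : ∀ x x', ‖approxMeanCurvature ψ ε (stateMeasure V₀ y') x -
      approxMeanCurvature ψ ε (stateMeasure V₀ y') x'‖ ≤ H * I * ‖x - x'‖ := fun x x' =>
    convex_univ.norm_image_sub_le_of_norm_fderiv_le
      (fun z _ => (hasFDerivAt_approxMeanCurvature (stateMeasure V₀ y') h hε z).differentiableAt)
      (fun z _ => hder' z) (mem_univ x') (mem_univ x)
  refine norm_lagrangianState_le (mul_nonneg hK hδ) (fun x => ?_) fun x => ?_
  · change ‖(velocity ψ ε V₀ y).1 x - (velocity ψ ε V₀ y').1 x‖ ≤ _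
    rw [(velocity_apply V₀ hdn h hε hy x).1, (velocity_apply V₀ hdn h hε hy' x).1]
    refine (norm_sub_le_norm_sub_add_norm_sub _
      (approxMeanCurvature ψ ε (stateMeasure V₀ y') (x + y.1 x)) _).trans ?_
    have h1 := hval (x + y.1 x)
    have h2 := (hlip (x + y.1 x) (x + y'.1 x)).trans
      (mul_le_mul_of_nonneg_left (hdisp x) (by positivity))
    have h3 : 0 ≤ (c * I * R + G * R + H * I) * δ := by positivity
    linarith
  · change ‖(velocity ψ ε V₀ y).2 x - (velocity ψ ε V₀ y').2 x‖ ≤ _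
    rw [(velocity_apply V₀ hdn h hε hy x).2, (velocity_apply V₀ hdn h hε hy' x).2]
    set P := fderiv ℝ (approxMeanCurvature ψ ε (stateMeasure V₀ y))
    set P' := fderiv ℝ (approxMeanCurvature ψ ε (stateMeasure V₀ y'))
    -- The three terms change, in turn, the varifold generating the curvature, the evaluation point,
    -- and the deformation field.
    have h0 : P (x + y.1 x) ∘L y.2 x - P' (x + y'.1 x) ∘L y'.2 x =
        (P (x + y.1 x) - P' (x + y.1 x)) ∘L y.2 x +
        (P' (x + y.1 x) - P' (x + y'.1 x)) ∘L y.2 x +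
        P' (x + y'.1 x) ∘L (y.2 x - y'.2 x) := by
      ext v
      simp
    rw [h0]
    refine (norm_add₃_le).trans ?_
    have h1 := (ContinuousLinearMap.opNorm_comp_le (P (x + y.1 x) - P' (x + y.1 x)) (y.2 x)).trans
      (mul_le_mul (hder _) (hy x).1 (norm_nonneg _) (by positivity))
    have h2 := (ContinuousLinearMap.opNorm_comp_le (P' (x + y.1 x) - P' (x + y'.1 x))
      (y.2 x)).trans (mul_le_mul ((hder2 _ _).trans
        (mul_le_mul_of_nonneg_left (hdisp x) hG)) (hy x).1 (norm_nonneg _) (by positivity))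
    have h3 := (ContinuousLinearMap.opNorm_comp_le (P' (x + y'.1 x)) (y.2 x - y'.2 x)).trans
      (mul_le_mul (hder' _) (norm_field_sub_le y y' x) (norm_nonneg _) (by positivity))
    have h4 : 0 ≤ (c + H * I) * δ := by positivity
    linarith

/-- An Euler step for the measures is an Euler step for the Lagrangian states. -/
theorem pushforward_eulerMap_stateMeasure (hy : y ∈ controlledStates n R) {τ B : ℝ} (hτ : 0 ≤ τ)
    (hB : ∀ x, ‖fderiv ℝ (approxMeanCurvature ψ ε (stateMeasure V₀ y)) x‖ ≤ B)
    (hτB : τ * B ≤ 1 / 2) :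
    pushforward (eulerMap ψ ε τ (stateMeasure V₀ y)) (stateMeasure V₀ y) =
      stateMeasure V₀ (y + τ • velocity ψ ε V₀ y) := by
  have := isFiniteMeasure_stateMeasure V₀ hdn hy
  have hA := admissible_of_mem_controlledStates hy
  have hE := admissible_eulerMap (stateMeasure V₀ y) h hε hτ hB hτB
  rw [pushforward_eq_transport]
  refine (hA.transport_transport hE hdn V₀).trans ?_
  change _ = transport V₀ _ _
  congr 1
  · funext x
    simp only [Function.comp, eulerMap, Prod.fst_add, Prod.smul_fst,
      BoundedContinuousFunction.coe_add, BoundedContinuousFunction.coe_smul, Pi.add_apply]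
    rw [(velocity_apply V₀ hdn h hε hy x).1, add_assoc]
  · funext x
    simp only [Prod.snd_add, Prod.smul_snd, BoundedContinuousFunction.coe_add,
      BoundedContinuousFunction.coe_smul, Pi.add_apply]
    rw [(velocity_apply V₀ hdn h hε hy x).2, fderiv_eulerMap _ h hε]
    ext v
    simp

end Velocity

end

/-! ### Subdivisions -/

namespace Subdivision

variable {a b : ℝ} (T : Subdivision a b)

theorem pt_le {i j : ℕ} (hij : i ≤ j) (hj : j ≤ T.m) : T.pt i ≤ T.pt j := by
  rcases hij.eq_or_lt with rfl | h
  · exact le_rfl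
  · exact (T.pt_lt h hj).le

theorem pt_mem {i : ℕ} (hi : i ≤ T.m) : T.pt i ∈ Icc a b :=
  ⟨by simpa [T.first] using T.pt_le (Nat.zero_le i) hi,
    by simpa [T.last] using T.pt_le hi le_rfl⟩

theorem index_spec {t : ℝ} (ht : t ∈ Ico a b) :
    T.index t < T.m ∧ t ∈ Ico (T.pt (T.index t)) (T.pt (T.index t + 1)) := by
  classical
  have h2 : T.index t ≤ T.m - 1 := Nat.findGreatest_le _
  have h3 : T.pt (T.index t) ≤ t :=
    Nat.findGreatest_spec (P := fun i => T.pt i ≤ t) (m := 0) (Nat.zero_le _) (by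
      rw [T.first]; exact ht.1)
  have hm := T.m_pos
  refine ⟨by omega, h3, ?_⟩
  -- The index is capped at `m - 1`. At the cap the right endpoint is `b`, which `t < b` excludes;
  -- below it, maximality of the index applies.
  rcases h2.eq_or_lt with h | h
  · rw [h, Nat.sub_add_cancel hm, T.last]; exact ht.2
  · by_contra hcon
    exact Nat.findGreatest_is_greatest (P := fun i => T.pt i ≤ t) (n := T.m - 1)
      (k := T.index t + 1) (Nat.lt_succ_self _) (by omega) (not_lt.1 hcon)

theorem exists_mem_Icc {t : ℝ} (ht : t ∈ Icc a b) :
    ∃ i < T.m, t ∈ Icc (T.pt i) (T.pt (i + 1)) := by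
  rcases ht.2.eq_or_lt with rfl | h
  · have hm := T.m_pos
    refine ⟨T.m - 1, by omega, ?_, ?_⟩
    · exact (T.pt_mem (by omega)).2
    · rw [Nat.sub_add_cancel hm, T.last]
  · have := T.index_spec ⟨ht.1, h⟩
    exact ⟨_, this.1, Ico_subset_Icc_self this.2⟩

theorem step_le_mesh {i : ℕ} (hi : i < T.m) : T.pt (i + 1) - T.pt i ≤ T.mesh :=
  Finset.le_sup' (fun i => T.pt (i + 1) - T.pt i) (Finset.mem_range.2 hi)

theorem mesh_pos : 0 < T.mesh :=
  (sub_pos.2 (T.lt_succ 0 T.m_pos)).trans_le (T.step_le_mesh T.m_pos)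

end Subdivision

theorem mesh_dyadic (j : ℕ) : (dyadic j).mesh = (1 / 2) ^ j := by
  have h : ∀ i : ℕ, (dyadic j).pt (i + 1) - (dyadic j).pt i = (1 / 2 : ℝ) ^ j := fun i => by
    simp only [dyadic]
    push_cast
    rw [← sub_div, add_sub_cancel_left, one_div_pow]
  simp only [Subdivision.mesh, h]
  exact Finset.sup'_const _ _

theorem tendsto_mesh_dyadic : Tendsto (fun j => (dyadic j).mesh) atTop (𝓝 0) := by
  simp only [mesh_dyadic]
  exact tendsto_pow_atTop_nhds_zero_of_lt_one (by norm_num) (by norm_num)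

/-! ### Euler polygons -/

section Euler

variable {X : Type*} [NormedAddCommGroup X] [NormedSpace ℝ X] {a b : ℝ}

/-- The nodes of the explicit Euler scheme for the autonomous equation `y' = F y`. -/
noncomputable def eulerNode (F : X → X) (T : Subdivision a b) (y₀ : X) : ℕ → X
  | 0 => y₀
  | i + 1 => eulerNode F T y₀ i + (T.pt (i + 1) - T.pt i) • F (eulerNode F T y₀ i)

/-- The Euler polygon of the autonomous equation `y' = F y`. -/
noncomputable def eulerPolygon (F : X → X) (T : Subdivision a b) (y₀ : X) (t : ℝ) : X :=
  eulerNode F T y₀ (T.index t) + (t - T.pt (T.index t)) • F (eulerNode F T y₀ (T.index t))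

theorem eulerPolygon_eq (F : X → X) (T : Subdivision a b) (y₀ : X) {i : ℕ} (hi : i < T.m) {t : ℝ}
    (ht : t ∈ Icc (T.pt i) (T.pt (i + 1))) :
    eulerPolygon F T y₀ t = eulerNode F T y₀ i + (t - T.pt i) • F (eulerNode F T y₀ i) := by
  classical
  have h1 : i ≤ T.index t := Nat.le_findGreatest (by omega) ht.1
  have h2 : T.index t ≤ T.m - 1 := Nat.findGreatest_le _
  have h3 : T.pt (T.index t) ≤ t :=
    Nat.findGreatest_spec (P := fun i => T.pt i ≤ t) (m := i) (by omega) ht.1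
  rcases h1.eq_or_lt with h | h
  · rw [eulerPolygon, ← h]
  · have h4 : T.index t = i + 1 := by
      by_contra hne
      have := T.pt_lt (i := i + 1) (j := T.index t) (by omega) (by omega)
      linarith [ht.2]
    have h5 : t = T.pt (i + 1) := le_antisymm ht.2 (h4 ▸ h3)
    rw [eulerPolygon, h4, h5, sub_self, zero_smul, add_zero, eulerNode]

theorem eulerPolygon_pt (F : X → X) (T : Subdivision a b) (y₀ : X) {i : ℕ} (hi : i < T.m) :
    eulerPolygon F T y₀ (T.pt i) = eulerNode F T y₀ i := by
  rw [eulerPolygon_eq F T y₀ hi ⟨le_rfl, (T.lt_succ i hi).le⟩, sub_self, zero_smul, add_zero]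

theorem continuousOn_eulerPolygon (F : X → X) (T : Subdivision a b) (y₀ : X) :
    ContinuousOn (eulerPolygon F T y₀) (Icc a b) := by
  have h : ∀ i ≤ T.m, ContinuousOn (eulerPolygon F T y₀) (Icc a (T.pt i)) := by
    intro i
    induction i with
    | zero => intro _; rw [T.first, Icc_self]; exact continuousOn_singleton _ _
    | succ i ih =>
      intro hi
      have h1 := T.pt_mem (i := i) (by omega)
      rw [← Icc_union_Icc_eq_Icc h1.1 (T.lt_succ i (by omega)).le]
      refine (ih (by omega)).union_of_isClosed ?_ isClosed_Icc isClosed_Icc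
      refine ContinuousOn.congr (f := fun t => eulerNode F T y₀ i +
        (t - T.pt i) • F (eulerNode F T y₀ i)) (by fun_prop) fun t ht => ?_
      exact eulerPolygon_eq F T y₀ (by omega) ht
  simpa [T.last] using h T.m le_rfl

theorem hasDerivWithinAt_eulerPolygon (F : X → X) (T : Subdivision a b) (y₀ : X) {t : ℝ}
    (ht : t ∈ Ico a b) :
    HasDerivWithinAt (eulerPolygon F T y₀) (F (eulerNode F T y₀ (T.index t))) (Ici t) t := by
  obtain ⟨h1, h2⟩ := T.index_spec ht
  set i := T.index t
  have hd : HasDerivAt (fun s => eulerNode F T y₀ i + (s - T.pt i) • F (eulerNode F T y₀ i))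
      (F (eulerNode F T y₀ i)) t := by
    simpa using ((((hasDerivAt_id t).sub_const (T.pt i)).smul_const
      (F (eulerNode F T y₀ i))).const_add (eulerNode F T y₀ i))
  refine hd.hasDerivWithinAt.congr_of_eventuallyEq ?_
    (eulerPolygon_eq F T y₀ h1 (Ico_subset_Icc_self h2))
  filter_upwards [Ico_mem_nhdsGE h2.2] with s hs
  exact eulerPolygon_eq F T y₀ h1 ⟨h2.1.trans hs.1, hs.2.le⟩

/-- Two Euler polygons that stay where the field is Lipschitz and bounded are close. -/
theorem dist_eulerPolygon_le {F : X → X} {s : Set X} {K : NNReal} {C : ℝ}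
    (hF : LipschitzOnWith K F s) (hC : ∀ y ∈ s, ‖F y‖ ≤ C) (y₀ : X) (T T' : Subdivision a b)
    (hT : ∀ t ∈ Icc a b, eulerPolygon F T y₀ t ∈ s)
    (hT' : ∀ t ∈ Icc a b, eulerPolygon F T' y₀ t ∈ s) {t : ℝ} (ht : t ∈ Icc a b) :
    dist (eulerPolygon F T y₀ t) (eulerPolygon F T' y₀ t) ≤
      gronwallBound 0 K (K * (T.mesh * C) + K * (T'.mesh * C)) (t - a) := by
  -- The polygon moves with the velocity of its last node, at distance at most `T.mesh * C` from the
  -- current point, so it solves the ODE up to an error `K * (T.mesh * C)`.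
  have key : ∀ T : Subdivision a b, (∀ t ∈ Icc a b, eulerPolygon F T y₀ t ∈ s) →
      ∀ t ∈ Ico a b, dist (F (eulerNode F T y₀ (T.index t))) (F (eulerPolygon F T y₀ t)) ≤
        K * (T.mesh * C) := by
    intro T hT t ht
    obtain ⟨h1, h2⟩ := T.index_spec ht
    have h3 : eulerNode F T y₀ (T.index t) ∈ s := by
      rw [← eulerPolygon_pt F T y₀ h1]
      exact hT _ (T.pt_mem h1.le)
    refine (hF.dist_le_mul _ h3 _ (hT t (Ico_subset_Icc_self ht))).trans ?_
    refine mul_le_mul_of_nonneg_left ?_ K.2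
    rw [dist_eq_norm, eulerPolygon, sub_add_cancel_left, norm_neg, norm_smul,
      Real.norm_of_nonneg (sub_nonneg.2 h2.1)]
    refine mul_le_mul ?_ (hC _ h3) (norm_nonneg _) T.mesh_pos.le
    linarith [T.step_le_mesh h1, h2.2]
  have hstart : ∀ T : Subdivision a b, eulerPolygon F T y₀ a = y₀ := fun T => by
    have := eulerPolygon_pt F T y₀ T.m_pos
    rwa [T.first] at this
  -- Gronwall's inequality uses the Lipschitz bound only between points of the two polygons, so `s`
  -- need not be convex; the controlled states do not form a convex set in general.
  refine dist_le_of_approx_trajectories_ODE_of_mem (v := fun _ => F) (s := fun _ => s)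
    (fun _ _ => hF) (continuousOn_eulerPolygon F T y₀)
    (fun t ht => hasDerivWithinAt_eulerPolygon F T y₀ ht) (key T hT)
    (fun t ht => hT t (Ico_subset_Icc_self ht)) (continuousOn_eulerPolygon F T' y₀)
    (fun t ht => hasDerivWithinAt_eulerPolygon F T' y₀ ht) (key T' hT')
    (fun t ht => hT' t (Ico_subset_Icc_self ht)) ?_ t ht
  rw [hstart, hstart, dist_self]

theorem tendsto_gronwallBound_zero {ι : Type*} {l : Filter ι} {e : ι → ℝ} (he : Tendsto e l (𝓝 0))
    (K x : ℝ) : Tendsto (fun i => gronwallBound 0 K (e i) x) l (𝓝 0) := by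
  have h := ((gronwallBound_continuous_ε 0 K x).tendsto 0).comp he
  rwa [gronwallBound_ε0_δ0] at h

/-- Euler polygons converge, uniformly with respect to the choice of the subdivisions. -/
theorem exists_tendsto_eulerPolygon [CompleteSpace X] {F : X → X} {s : Set X} {K : NNReal} {C : ℝ}
    (hF : LipschitzOnWith K F s) (hC : ∀ y ∈ s, ‖F y‖ ≤ C) (y₀ : X)
    {δ : ℝ} (hδ : 0 < δ)
    (hs : ∀ T : Subdivision a b, T.mesh ≤ δ → ∀ t ∈ Icc a b, eulerPolygon F T y₀ t ∈ s)
    {S : ℕ → Subdivision a b} (hS : Tendsto (fun j => (S j).mesh) atTop (𝓝 0))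
    {t : ℝ} (ht : t ∈ Icc a b) :
    ∃ y, ∀ T : ℕ → Subdivision a b, Tendsto (fun j => (T j).mesh) atTop (𝓝 0) →
      Tendsto (fun j => eulerPolygon F (T j) y₀ t) atTop (𝓝 y) := by
  have hfine : ∀ {T : ℕ → Subdivision a b}, Tendsto (fun j => (T j).mesh) atTop (𝓝 0) →
      ∀ᶠ j in atTop, (T j).mesh ≤ δ := fun h => h.eventually_le_const hδ
  -- No solution of the ODE is constructed beforehand. The reference sequence `S` is Cauchy, its
  -- limit serves as `y`, and every other sequence `T` is at vanishing distance from `S`.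
  have hcauchy : CauchySeq fun j => eulerPolygon F (S j) y₀ t := by
    rw [cauchySeq_iff_tendsto_dist_atTop_0]
    have h1 : Tendsto (fun q : ℕ × ℕ => K * ((S q.1).mesh * C) + K * ((S q.2).mesh * C))
        atTop (𝓝 0) := by
      rw [← prod_atTop_atTop_eq]
      simpa using (((hS.comp tendsto_fst).mul_const C).const_mul (K : ℝ)).add
        (((hS.comp tendsto_snd).mul_const C).const_mul (K : ℝ))
    refine squeeze_zero' (Eventually.of_forall fun _ => dist_nonneg) ?_
      (tendsto_gronwallBound_zero h1 K (t - a))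
    rw [← prod_atTop_atTop_eq]
    filter_upwards [(hfine hS).prod_mk (hfine hS)] with q hq
    exact dist_eulerPolygon_le hF hC y₀ _ _ (hs _ hq.1) (hs _ hq.2) ht
  obtain ⟨y, hy⟩ := cauchySeq_tendsto_of_complete hcauchy
  refine ⟨y, fun T hT => ?_⟩
  refine hy.congr_dist ?_
  have h1 : Tendsto (fun j => K * ((S j).mesh * C) + K * ((T j).mesh * C)) atTop (𝓝 0) := by
    simpa using ((hS.mul_const C).const_mul (K : ℝ)).add ((hT.mul_const C).const_mul (K : ℝ))
  refine squeeze_zero' (Eventually.of_forall fun _ => dist_nonneg) ?_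
    (tendsto_gronwallBound_zero h1 K (t - a))
  filter_upwards [hfine hS, hfine hT] with j hj hj'
  exact dist_eulerPolygon_le hF hC y₀ _ _ (hs _ hj) (hs _ hj') ht

end Euler

/-! ### A priori bounds for the time-discrete flow -/

/-- The state of a flow that has not moved. -/
noncomputable def initialState (n : ℕ) : LagrangianState n :=
  (0, BoundedContinuousFunction.const (E n) 1)

theorem stateMeasure_initialState {d n : ℕ} (V₀ : Measure (E n × Gr d n)) :
    stateMeasure V₀ (initialState n) = V₀ := by
  have h : (fun x : E n => x + (initialState n).1 x) = fun x => x := by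
    funext x; simp [initialState]
  have h' : ⇑(initialState n).2 = fderiv ℝ fun x : E n => x := by
    funext x
    rw [fderiv_fun_id]
    rfl
  rw [stateMeasure, h, h', ← pushforward_eq_transport, pushforward_id]

/-- The bounds satisfied at time `s` by the states of a sufficiently fine time-discrete flow. -/
structure APriori {d n : ℕ} (V₀ : Measure (E n × Gr d n)) (M B s : ℝ) (y : LagrangianState n) :
    Prop where
  norm_le : ∀ x, ‖y.2 x‖ ≤ Real.exp (B * s)
  lowerBound : ∀ x, LowerBound (Real.exp (2 * (B * s))) (y.2 x)
  mass_le : stateMeasure V₀ y univ ≤ ENNReal.ofReal (M + s)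

section

variable {d n : ℕ} {V₀ : Measure (E n × Gr d n)} {M B s : ℝ} {y : LagrangianState n}

theorem APriori.mem_controlledStates (h : APriori V₀ M B s y) (hB : 0 ≤ B) (hs0 : 0 ≤ s)
    (hs : s ≤ 1) :
    y ∈ controlledStates n (Real.exp (2 * B)) := fun x => by
  have h1 : B * s ≤ B := mul_le_of_le_one_right hB hs
  have h2 : 0 ≤ B * s := mul_nonneg hB hs0
  exact ⟨(h.norm_le x).trans (Real.exp_le_exp.2 (by linarith)),
    (h.lowerBound x).mono (Real.exp_le_exp.2 (by linarith))⟩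

theorem aPriori_initialState (hV₀ : V₀ univ ≤ ENNReal.ofReal M) (B : ℝ) :
    APriori V₀ M B 0 (initialState n) where
  norm_le x := by
    rw [mul_zero, Real.exp_zero]
    exact ContinuousLinearMap.norm_id_le
  lowerBound x v := by simp [initialState]
  mass_le := by rwa [stateMeasure_initialState, add_zero]

/-- Equivalent to `(1 - s)⁻¹ ≤ exp (2 s)`, the loss of lower bound in one Euler step. It explains
the factor 2 in the exponent of `APriori.lowerBound`. -/
theorem one_le_mul_exp_of_le_half {s : ℝ} (hs0 : 0 ≤ s) (hs : s ≤ 1 / 2) :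
    1 ≤ Real.exp (2 * s) * (1 - s) := by
  have h1 := Real.quadratic_le_exp_of_nonneg (x := 2 * s) (by linarith)
  nlinarith [mul_nonneg hs0 (by linarith : (0:ℝ) ≤ 1 - s), sq_nonneg s,
    mul_le_mul_of_nonneg_right h1 (by linarith : (0:ℝ) ≤ 1 - s)]

variable {ψ : E n → ℝ} {ε δ : ℝ} [IsFiniteMeasure V₀]

/-- One Euler step. -/
theorem APriori.step (hn : 1 ≤ n) (hdn : d ≤ n) (h : IsMollifier (kernel ψ ε)) (hε : 0 < ε)
    (hM : 0 ≤ M) (hB0 : 0 ≤ B)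
    (hB : ∀ V : Measure (E n × Gr d n), IsFiniteMeasure V → V.real univ ≤ M + 1 →
      ∀ x, ‖fderiv ℝ (approxMeanCurvature ψ ε V) x‖ ≤ B)
    (hδ1 : 2 * n * (δ * B) ≤ 1) (hδ2 : 3 * n ^ 2 * B ^ 2 * (M + 1) * δ ≤ 1)
    (hy : APriori V₀ M B s y) (hs : 0 ≤ s) {τ : ℝ} (hτ : 0 ≤ τ) (hτδ : τ ≤ δ)
    (hsτ : s + τ ≤ 1) :
    IsC1Diffeo (eulerMap ψ ε τ (stateMeasure V₀ y)) ∧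
    pushforward (eulerMap ψ ε τ (stateMeasure V₀ y)) (stateMeasure V₀ y) =
      stateMeasure V₀ (y + τ • velocity ψ ε V₀ y) ∧
    APriori V₀ M B (s + τ) (y + τ • velocity ψ ε V₀ y) := by
  have hyc := hy.mem_controlledStates hB0 hs (by linarith)
  have hfin := isFiniteMeasure_stateMeasure V₀ hdn hyc
  have hmass : (stateMeasure V₀ y).real univ ≤ M + s :=
    ENNReal.toReal_le_of_le_ofReal (by linarith) hy.mass_le
  -- The bootstrap: `B` is available only for masses at most `M + 1`, and the mass bound `M + s` at
  -- the current time `s ≤ 1` provides this.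
  have hBx := hB _ hfin (by linarith)
  have hn' : (1 : ℝ) ≤ n := by exact_mod_cast hn
  have hτB0 : 0 ≤ τ * B := mul_nonneg hτ hB0
  have hτB1 : τ * B ≤ δ * B := mul_le_mul_of_nonneg_right hτδ hB0
  have hτB2 : 2 * n * (τ * B) ≤ 1 := le_trans (by gcongr) hδ1
  have hτB3 : τ * B ≤ 1 / 2 := by nlinarith
  have hpush := pushforward_eulerMap_stateMeasure V₀ hdn h hε hyc hτ hBx hτB3
  refine ⟨isC1Diffeo_eulerMap _ h hε hτ hBx hτB3, hpush, ?_⟩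
  obtain ⟨H, -, hH⟩ := exists_preMeanCurvature_bound V₀ hdn h hε (Real.exp (2 * B))
  have hfield : ∀ x, (y + τ • velocity ψ ε V₀ y).2 x =
      (1 + τ • fderiv ℝ (approxMeanCurvature ψ ε (stateMeasure V₀ y)) (x + y.1 x)) ∘L y.2 x := by
    intro x
    simp only [Prod.snd_add, Prod.smul_snd, BoundedContinuousFunction.coe_add,
      BoundedContinuousFunction.coe_smul, Pi.add_apply]
    rw [(velocity_apply V₀ hdn h hε hyc x).2]
    ext v
    simp
  have hnorm : ∀ x, ‖τ • fderiv ℝ (approxMeanCurvature ψ ε (stateMeasure V₀ y)) x‖ ≤ τ * B :=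
    norm_smul_fderiv_le _ hτ hBx le_rfl
  refine ⟨fun x => ?_, fun x => ?_, ?_⟩
  · rw [hfield]
    refine (ContinuousLinearMap.opNorm_comp_le _ _).trans ?_
    rw [show B * (s + τ) = τ * B + B * s by ring, Real.exp_add]
    refine mul_le_mul ((norm_one_add_le _).trans ?_) (hy.norm_le x) (norm_nonneg _)
      (Real.exp_pos _).le
    linarith [hnorm (x + y.1 x), Real.add_one_le_exp (τ * B)]
  · rw [hfield, show 2 * (B * (s + τ)) = 2 * (B * s) + 2 * (τ * B) by ring, Real.exp_add]
    refine (hy.lowerBound x).comp (Real.exp_pos _).le fun v => ?_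
    set L := τ • fderiv ℝ (approxMeanCurvature ψ ε (stateMeasure V₀ y)) (x + y.1 x)
    have h1 : ‖L v‖ ≤ τ * B * ‖v‖ := L.le_of_opNorm_le (hnorm _) v
    have h2 : ‖v‖ - ‖L v‖ ≤ ‖v + L v‖ := by
      have := norm_sub_le (v + L v) (L v)
      rw [add_sub_cancel_right] at this
      linarith
    have h3 := one_le_mul_exp_of_le_half hτB0 hτB3
    calc ‖v‖ ≤ Real.exp (2 * (τ * B)) * (1 - τ * B) * ‖v‖ :=
          le_mul_of_one_le_left (norm_nonneg _) h3
      _ = Real.exp (2 * (τ * B)) * (‖v‖ - τ * B * ‖v‖) := by ring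
      _ ≤ Real.exp (2 * (τ * B)) * ‖v + L v‖ := by
          refine mul_le_mul_of_nonneg_left ?_ (Real.exp_pos _).le
          linarith
  · rw [← hpush]
    refine (mass_pushforward_eulerMap_le _ hn hdn h hε hτ (hH y hyc) hBx hτB2).trans
      (ENNReal.ofReal_le_ofReal ?_)
    -- The quadratic mass gain is at most `3 n² B² (M + 1) τ · τ`, and `hδ2` bounds this by `τ`. The
    -- mass therefore grows at rate at most 1 in time.
    have h1 : (stateMeasure V₀ y).real univ * (3 * n ^ 2 * (τ * B) ^ 2) ≤
        (M + 1) * (3 * n ^ 2 * (τ * B) ^ 2) :=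
      mul_le_mul_of_nonneg_right (by linarith) (by positivity)
    have h2 : (M + 1) * (3 * n ^ 2 * (τ * B) ^ 2) =
        (3 * n ^ 2 * B ^ 2 * (M + 1) * τ) * τ := by ring
    have h3 : 3 * n ^ 2 * B ^ 2 * (M + 1) * τ ≤ 1 := le_trans (by gcongr) hδ2
    have h4 := mul_le_mul_of_nonneg_right h3 hτ
    rw [mul_add, mul_one]
    linarith

/-- For fine subdivisions the flow is well defined, is given by the Euler polygon of the Lagrangian
states, and satisfies the a priori bounds. -/
theorem discreteFlow_eq_stateMeasure (hn : 1 ≤ n) (hdn : d ≤ n) (h : IsMollifier (kernel ψ ε))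
    (hε : 0 < ε) (hM : 0 ≤ M) (hB0 : 0 ≤ B)
    (hB : ∀ V : Measure (E n × Gr d n), IsFiniteMeasure V → V.real univ ≤ M + 1 →
      ∀ x, ‖fderiv ℝ (approxMeanCurvature ψ ε V) x‖ ≤ B)
    (hδ1 : 2 * n * (δ * B) ≤ 1) (hδ2 : 3 * n ^ 2 * B ^ 2 * (M + 1) * δ ≤ 1)
    (hV₀ : V₀ univ ≤ ENNReal.ofReal M) (T : Subdivision 0 1) (hT : T.mesh ≤ δ) :
    (∀ i < T.m, ∀ τ ∈ Icc 0 (T.pt (i + 1) - T.pt i),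
      IsC1Diffeo (eulerMap ψ ε τ (nodeFlow ψ ε T V₀ i))) ∧
    ∀ t ∈ Icc (0 : ℝ) 1,
      discreteFlow ψ ε T V₀ t =
        stateMeasure V₀ (eulerPolygon (velocity ψ ε V₀) T (initialState n) t) ∧
      APriori V₀ M B t (eulerPolygon (velocity ψ ε V₀) T (initialState n) t) := by
  -- Any `τ ≤ δ` is allowed, so the same statement serves the full steps between nodes and the
  -- partial steps to intermediate times.
  have hstep := fun {s : ℝ} {y : LagrangianState n} (hy : APriori V₀ M B s y) (hs : 0 ≤ s) {τ : ℝ}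
    (hτ : 0 ≤ τ) (hτδ : τ ≤ δ) (hsτ : s + τ ≤ 1) =>
      hy.step hn hdn h hε hM hB0 hB hδ1 hδ2 hs hτ hτδ hsτ
  have hnode : ∀ i ≤ T.m,
      nodeFlow ψ ε T V₀ i = stateMeasure V₀ (eulerNode (velocity ψ ε V₀) T (initialState n) i) ∧
      APriori V₀ M B (T.pt i) (eulerNode (velocity ψ ε V₀) T (initialState n) i) := by
    intro i
    induction i with
    | zero =>
      intro _
      rw [T.first]
      exact ⟨(stateMeasure_initialState V₀).symm, aPriori_initialState hV₀ B⟩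
    | succ i ih =>
      intro hi
      obtain ⟨h1, h2⟩ := ih (by omega)
      have h3 := hstep h2 (T.pt_mem (by omega)).1 (sub_nonneg.2 (T.lt_succ i (by omega)).le)
        ((T.step_le_mesh (by omega)).trans hT) (by
          rw [add_sub_cancel]; exact (T.pt_mem hi).2)
      rw [add_sub_cancel] at h3
      refine ⟨?_, h3.2.2⟩
      rw [nodeFlow, h1, h3.2.1]
      rfl
  refine ⟨fun i hi τ hτ => ?_, fun t ht => ?_⟩
  · obtain ⟨h1, h2⟩ := hnode i hi.le
    rw [h1]
    refine (hstep h2 (T.pt_mem hi.le).1 hτ.1 (hτ.2.trans ((T.step_le_mesh hi).trans hT)) ?_).1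
    have := (T.pt_mem (i := i + 1) hi).2
    linarith [hτ.2]
  · obtain ⟨i, hi, hti⟩ := T.exists_mem_Icc ht
    obtain ⟨h1, h2⟩ := hnode i hi.le
    have h3 := hstep h2 (T.pt_mem hi.le).1 (sub_nonneg.2 hti.1)
      ((by linarith [hti.2] : t - T.pt i ≤ T.pt (i + 1) - T.pt i).trans
        ((T.step_le_mesh hi).trans hT)) (by rw [add_sub_cancel]; exact ht.2)
    rw [add_sub_cancel] at h3
    rw [discreteFlow_eq ψ ε T V₀ hi hti, eulerPolygon_eq _ T _ hi hti, h1]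
    exact h3.2

end

/-! ### Convergence of the measures of convergent states -/

section Convergence

variable {d n : ℕ} {R : ℝ} (V₀ : Measure (E n × Gr d n)) [IsFiniteMeasure V₀]

/-- Dominated convergence over the fixed measure `V₀`. The test function need only be bounded and
continuous, so `φ = 1` is admitted and the mass bound passes to the limit without loss at infinity.
-/
theorem tendsto_integral_stateMeasure (hdn : d ≤ n) {y : ℕ → LagrangianState n}
    {Y : LagrangianState n} (hy : ∀ᶠ j in atTop, y j ∈ controlledStates n R)
    (hlim : Tendsto y atTop (𝓝 Y)) {φ : E n × Gr d n → ℝ} (hφ : Continuous φ) {b : ℝ}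
    (hb : ∀ p, ‖φ p‖ ≤ b) :
    Tendsto (fun j => ∫ p, φ p ∂(stateMeasure V₀ (y j))) atTop
      (𝓝 (∫ p, φ p ∂(stateMeasure V₀ Y))) := by
  have hY : Y ∈ controlledStates n R := (isClosed_controlledStates n R).mem_of_tendsto hlim hy
  have hAY := admissible_of_mem_controlledStates hY
  rw [stateMeasure, hAY.integral_transport hdn V₀ hφ]
  have hint : ∀ᶠ j in atTop, ∫ p, tangentialJacobian ((y j).2 p.1) p.2 •
      φ (p.1 + (y j).1 p.1, Gr.image ((y j).2 p.1) p.2) ∂V₀ =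
      ∫ p, φ p ∂(stateMeasure V₀ (y j)) := by
    filter_upwards [hy] with j hj
    exact ((admissible_of_mem_controlledStates hj).integral_transport hdn V₀ hφ).symm
  refine Tendsto.congr' hint ?_
  refine tendsto_integral_filter_of_dominated_convergence (fun _ => jacobianBound n R * b)
    ?_ ?_ (integrable_const _) (ae_of_all _ fun p => ?_)
  · filter_upwards [hy] with j hj
    have hA := admissible_of_mem_controlledStates hj
    exact ((hA.continuous_jacobian hdn).smul
      (hφ.comp hA.continuous_transportMap)).aestronglyMeasurable
  · filter_upwards [hy] with j hj
    refine ae_of_all _ fun p => ?_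
    rw [norm_smul, Real.norm_of_nonneg (tangentialJacobian_nonneg _ _)]
    exact mul_le_mul (tangentialJacobian_le hdn (hj p.1).1 _) (hb _) (norm_nonneg _)
      (jacobianBound_nonneg _ _)
  · have h1 : Tendsto (fun j => (y j).1 p.1) atTop (𝓝 (Y.1 p.1)) :=
      (((continuous_eval_const p.1).comp continuous_fst).tendsto Y).comp hlim
    have h2 : Tendsto (fun j => (y j).2 p.1) atTop (𝓝[controlled n R] (Y.2 p.1)) :=
      tendsto_nhdsWithin_iff.2 ⟨(((continuous_eval_const p.1).comp continuous_snd).tendsto Y).comp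
        hlim, hy.mono fun j hj => hj p.1⟩
    have h3 := (continuousOn_tangentialJacobian_left hdn p.2 _ (hY p.1)).tendsto.comp h2
    have h4 := (continuousOn_image_left p.2 _ (hY p.1)).tendsto.comp h2
    exact h3.smul ((hφ.tendsto _).comp ((h1.const_add p.1).prodMk_nhds h4))

/-- The transport estimate with `b = l = 1` is uniform over all test functions in the supremum. -/
theorem tendsto_boundedLipschitzDist_stateMeasure (hdn : d ≤ n) {y : ℕ → LagrangianState n}
    {Y : LagrangianState n} (hy : ∀ᶠ j in atTop, y j ∈ controlledStates n R)
    (hlim : Tendsto y atTop (𝓝 Y)) :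
    Tendsto (fun j => boundedLipschitzDist (stateMeasure V₀ (y j)) (stateMeasure V₀ Y)) atTop
      (𝓝 0) := by
  have hY : Y ∈ controlledStates n R := (isClosed_controlledStates n R).mem_of_tendsto hlim hy
  have hAY := admissible_of_mem_controlledStates hY
  set c := (jacobianLip n R * 1 + jacobianBound n R * (1 + 2 * R) * 1) * V₀.real univ
  have h1 : Tendsto (fun j => ENNReal.ofReal (c * ‖y j - Y‖)) atTop (𝓝 0) := by
    have h2 : Tendsto (fun j => dist (y j) Y) atTop (𝓝 0) := tendsto_iff_dist_tendsto_zero.1 hlim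
    have h3 : Tendsto (fun j => ‖y j - Y‖) atTop (𝓝 0) := h2.congr fun j => dist_eq_norm (y j) Y
    have h4 := h3.const_mul c
    rw [mul_zero] at h4
    simpa using ENNReal.tendsto_ofReal h4
  refine tendsto_of_tendsto_of_tendsto_of_le_of_le' tendsto_const_nhds h1
    (Eventually.of_forall fun _ => zero_le) ?_
  filter_upwards [hy] with j hj
  refine iSup₂_le fun φ hφ => ENNReal.ofReal_le_ofReal ?_
  refine (admissible_of_mem_controlledStates hj).norm_integral_sub_integral_le hAY hdn V₀
    (φ := φ) (b := 1) (l := 1) (fun p => ?_) (fun p q => ?_) zero_le_one (norm_displacement_sub_le (y j) Y)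
    (norm_field_sub_le (y j) Y)
  · rw [Real.norm_of_nonneg (hφ.2 p).1]; exact (hφ.2 p).2
  · have := hφ.1.dist_le_mul p q
    rwa [dist_eq_norm] at this

theorem weakStarTendsto_stateMeasure (hdn : d ≤ n) {y : ℕ → LagrangianState n}
    {Y : LagrangianState n} (hy : ∀ᶠ j in atTop, y j ∈ controlledStates n R)
    (hlim : Tendsto y atTop (𝓝 Y)) :
    WeakStarTendsto (fun j => stateMeasure V₀ (y j)) (stateMeasure V₀ Y) := by
  intro φ hφ hφc _
  obtain ⟨b, hb⟩ := hφc.exists_bound_of_continuous hφ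
  exact tendsto_integral_stateMeasure V₀ hdn hy hlim hφ hb

theorem stateMeasure_univ_le_of_tendsto (hdn : d ≤ n) {y : ℕ → LagrangianState n}
    {Y : LagrangianState n} (hy : ∀ᶠ j in atTop, y j ∈ controlledStates n R)
    (hlim : Tendsto y atTop (𝓝 Y)) {m : ℝ} (hm : 0 ≤ m)
    (hle : ∀ᶠ j in atTop, stateMeasure V₀ (y j) univ ≤ ENNReal.ofReal m) :
    stateMeasure V₀ Y univ ≤ ENNReal.ofReal m := by
  have hY : Y ∈ controlledStates n R := (isClosed_controlledStates n R).mem_of_tendsto hlim hy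
  have := isFiniteMeasure_stateMeasure V₀ hdn hY
  have h := tendsto_integral_stateMeasure V₀ hdn hy hlim (φ := fun _ => 1) continuous_const
    (b := 1) (fun _ => by simp)
  simp only [integral_const, smul_eq_mul, mul_one] at h
  have h1 : (stateMeasure V₀ Y).real univ ≤ m :=
    le_of_tendsto h (hle.mono fun j hj => ENNReal.toReal_le_of_le_ofReal hm hj)
  rw [← ofReal_measureReal]
  exact ENNReal.ofReal_le_ofReal h1

end Convergence

/-- A regular measure on a locally compact Hausdorff space is determined by its integrals of
nonnegative continuous compactly supported functions. -/
theorem WeakStarTendsto.unique {X : Type*} [TopologicalSpace X] [T2Space X]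
    [LocallyCompactSpace X] [MeasurableSpace X] [BorelSpace X] {μ : ℕ → Measure X}
    {ν ν' : Measure X} [ν.Regular] [ν'.Regular] (h : WeakStarTendsto μ ν)
    (h' : WeakStarTendsto μ ν') : ν = ν' := by
  refine Measure.ext_of_integral_eq_on_compactlySupported_nnreal fun f => ?_
  have hc : Continuous fun x => (f x : ℝ) := NNReal.continuous_coe.comp f.continuous
  have hs : HasCompactSupport fun x => (f x : ℝ) :=
    f.hasCompactSupport.comp_left (g := ((↑) : NNReal → ℝ)) rfl
  exact tendsto_nhds_unique (h _ hc hs fun x => (f x).2) (h' _ hc hs fun x => (f x).2)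

theorem WeakStarTendsto.congr {X : Type*} [TopologicalSpace X] [MeasurableSpace X]
    {μ μ' : ℕ → Measure X} {ν : Measure X} (h : WeakStarTendsto μ ν)
    (hμ : ∀ᶠ j in atTop, μ j = μ' j) : WeakStarTendsto μ' ν := fun φ h1 h2 h3 =>
  (h φ h1 h2 h3).congr' (hμ.mono fun j hj => by rw [hj])

/-! ### The quantitative bound for the approximate mean curvature -/

/-- The constant in the bound for the derivative of the approximate mean curvature. -/
noncomputable def curvatureConstant (n : ℕ) (K₁ : ℝ) : ℝ :=
  (1 + cutoffBound n K₁ * volume.real (Metric.closedBall (0 : E n) 1)) * (1 + cutoffBound n K₁)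

/-- Differentiating the outer mollifier gives the product of `sup ‖h̃_ε‖`, of order `(M + 1) ε⁻²`,
and the integral of `‖∇Φ_ε‖`, of order `ε⁻²`. -/
theorem norm_fderiv_approxMeanCurvature_le {d n : ℕ} {K₁ K₂ ε M : ℝ} {ψ : E n → ℝ}
    (hψ : IsCutoff K₁ K₂ ψ) (hε : 0 < ε) (hε1 : ε < 1) (hM : 0 ≤ M)
    (V : Measure (E n × Gr d n)) [IsFiniteMeasure V] (hV : V.real univ ≤ M + 1) (x : E n) :
    ‖fderiv ℝ (approxMeanCurvature ψ ε V) x‖ ≤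
      curvatureConstant n K₁ * (M + 1) * (ε ^ 4)⁻¹ := by
  have h := hψ.isMollifier hε hε1
  have hD := hψ.cutoffBound_nonneg
  set D := cutoffBound n K₁
  have hinv : 1 ≤ (ε ^ 2)⁻¹ := (one_le_inv₀ (by positivity)).2 (by nlinarith)
  have hI := h.integral_norm_fderiv_le hinv hD (hψ.norm_fderiv_kernel_le hε hε1)
  have hH : ∀ y, ‖preMeanCurvature ψ ε V y‖ ≤ (1 + D) * (M + 1) * (ε ^ 2)⁻¹ := fun y => by
    refine (norm_preMeanCurvature_le V h hε (by positivity) hD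
      (hψ.norm_fderiv_kernel_le hε hε1) y).trans ?_
    have h1 : D * V.real univ / ε ≤ D * (M + 1) * (ε ^ 2)⁻¹ := by
      rw [div_eq_mul_inv]
      have : ε⁻¹ ≤ (ε ^ 2)⁻¹ := inv_anti₀ (by positivity) (by nlinarith)
      gcongr
    have h2 : (ε ^ 2)⁻¹ ≤ (M + 1) * (ε ^ 2)⁻¹ := le_mul_of_one_le_left (by positivity) (by linarith)
    linarith
  rw [fderiv_approxMeanCurvature V h hε]
  refine (h.norm_mollifyDeriv_le hH x).trans ((mul_le_mul_of_nonneg_left hI (by positivity)).trans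
    (le_of_eq ?_))
  unfold curvatureConstant
  have : (ε ^ 4)⁻¹ = (ε ^ 2)⁻¹ * (ε ^ 2)⁻¹ := by rw [← mul_inv]; ring
  rw [this]
  ring

end VarifoldFlow

/-! ### Convergence of the time-discrete flows and uniqueness of the limit. -/

theorem theorem4p1 (n : ℕ) (hn : 2 ≤ n) (K₁ K₂ : ℝ) :
    ∃ c₃ : ℝ, 0 < c₃ ∧
      ∀ (d : ℕ), 1 ≤ d → d ≤ n →
      ∀ ψ : E n → ℝ, IsCutoff K₁ K₂ ψ →
      ∀ ε ∈ Ioo (0 : ℝ) 1, ∀ M : ℝ, 1 ≤ M →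
      ∀ V₀ : Measure (E n × Gr d n), IsVarifold V₀ → IsCompact V₀.support →
        massMeasure V₀ univ ≤ ENNReal.ofReal M →
        -- the time-discrete flow is well defined for every sufficiently fine subdivision
        (∀ T : Subdivision 0 1, c₃ * T.mesh ≤ ((M + 1) ^ 3)⁻¹ * ε ^ 8 →
          (∀ i < T.m, ∀ τ ∈ Icc 0 (T.pt (i + 1) - T.pt i),
            IsC1Diffeo (eulerMap ψ ε τ (nodeFlow ψ ε T V₀ i))) ∧
          (∀ t ∈ Icc (0 : ℝ) 1, IsVarifold (discreteFlow ψ ε T V₀ t) ∧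
            massMeasure (discreteFlow ψ ε T V₀ t) univ ≤ ENNReal.ofReal (M + 1))) ∧
        ∃ V : Icc (0 : ℝ) 1 → Measure (E n × Gr d n),
          -- (i) convergence along the dyadic subdivisions
          (∀ t : Icc (0 : ℝ) 1,
            IsVarifold (V t) ∧
            massMeasure (V t) univ ≤ ENNReal.ofReal (M + 1) ∧
            WeakStarTendsto (fun j => discreteFlow ψ ε (dyadic j) V₀ t) (V t) ∧
            Tendsto (fun j => boundedLipschitzDist (discreteFlow ψ ε (dyadic j) V₀ t) (V t))
              atTop (𝓝 0)) ∧
          -- (ii) convergence to the same family along every sequence of subdivisions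
          (∀ T : ℕ → Subdivision 0 1, Tendsto (fun j => (T j).mesh) atTop (𝓝 0) →
            ∀ t : Icc (0 : ℝ) 1,
              WeakStarTendsto (fun j => discreteFlow ψ ε (T j) V₀ t) (V t) ∧
              Tendsto (fun j => boundedLipschitzDist (discreteFlow ψ ε (T j) V₀ t) (V t))
                atTop (𝓝 0)) ∧
          -- uniqueness of the limit flow
          (∀ T : ℕ → Subdivision 0 1, Tendsto (fun j => (T j).mesh) atTop (𝓝 0) →
            ∀ W : Icc (0 : ℝ) 1 → Measure (E n × Gr d n), (∀ t, IsVarifold (W t)) →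
              (∀ t : Icc (0 : ℝ) 1,
                WeakStarTendsto (fun j => discreteFlow ψ ε (T j) V₀ t) (W t)) →
              W = V) := by
  set C := curvatureConstant n |K₁|
  have hc₃ : 0 < 2 * n * |C| + 3 * n ^ 2 * C ^ 2 + 1 := by positivity
  -- The first two summands serve `hδ1` and `hδ2`. No cut-off is given yet, so the sign of `K₁` is
  -- unknown; the absolute values and the summand 1 make positivity evident.
  refine ⟨2 * n * |C| + 3 * n ^ 2 * C ^ 2 + 1, hc₃, ?_⟩
  set c₃ := 2 * n * |C| + 3 * n ^ 2 * C ^ 2 + 1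
  intro d _ hdn ψ hψ ε hε M hM V₀ _ _ hmass
  rw [massMeasure_univ] at hmass
  have hfin : IsFiniteMeasure V₀ := ⟨hmass.trans_lt ENNReal.ofReal_lt_top⟩
  have hε0 : 0 < ε := hε.1
  have hε1 : ε < 1 := hε.2
  have hM0 : 0 ≤ M := by linarith
  have hn1 : 1 ≤ n := by omega
  have hK : |K₁| = K₁ := abs_of_nonneg hψ.nonneg_gradientBound
  have hΦ := hψ.isMollifier hε0 hε1
  have hC0 : 0 ≤ C := by
    have := hψ.cutoffBound_nonneg
    have : 0 ≤ volume.real (Metric.closedBall (0 : E n) 1) := measureReal_nonneg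
    change 0 ≤ curvatureConstant n |K₁|
    rw [hK]
    unfold curvatureConstant
    positivity
  set B := C * (M + 1) * (ε ^ 4)⁻¹
  have hB0 : 0 ≤ B := by positivity
  have hB : ∀ V : Measure (E n × Gr d n), IsFiniteMeasure V → V.real univ ≤ M + 1 →
      ∀ x, ‖fderiv ℝ (approxMeanCurvature ψ ε V) x‖ ≤ B := by
    intro V hV hVM x
    change _ ≤ curvatureConstant n |K₁| * (M + 1) * (ε ^ 4)⁻¹
    rw [hK]
    exact norm_fderiv_approxMeanCurvature_le hψ hε0 hε1 hM0 V hVM x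
  set δ := ((M + 1) ^ 3)⁻¹ * ε ^ 8 / c₃
  have hδ : 0 < δ := by positivity
  have hδc : c₃ * δ = ((M + 1) ^ 3)⁻¹ * ε ^ 8 := mul_div_cancel₀ _ hc₃.ne'
  have hfine : ∀ T : Subdivision 0 1, c₃ * T.mesh ≤ ((M + 1) ^ 3)⁻¹ * ε ^ 8 → T.mesh ≤ δ :=
    fun T hT => (le_div_iff₀' hc₃).2 hT
  have hδ1 : 2 * n * (δ * B) ≤ 1 := by
    have h1 : 2 * n * C * δ ≤ c₃ * δ := by
      refine mul_le_mul_of_nonneg_right ?_ hδ.le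
      change _ ≤ 2 * n * |C| + 3 * n ^ 2 * C ^ 2 + 1
      rw [abs_of_nonneg hC0]
      have : 0 ≤ 3 * (n : ℝ) ^ 2 * C ^ 2 := by positivity
      linarith
    calc 2 * n * (δ * B) = 2 * n * C * δ * ((M + 1) * (ε ^ 4)⁻¹) := by
          change 2 * n * (δ * (C * (M + 1) * (ε ^ 4)⁻¹)) = _
          ring
      _ ≤ ((M + 1) ^ 3)⁻¹ * ε ^ 8 * ((M + 1) * (ε ^ 4)⁻¹) := by
          rw [← hδc]
          gcongr
      _ = ((M + 1) ^ 2)⁻¹ * ε ^ 4 := by field_simp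
      _ ≤ 1 * 1 := by
          gcongr
          · exact inv_le_one_of_one_le₀ (one_le_pow₀ (by linarith))
          · exact pow_le_one₀ hε0.le hε1.le
      _ = 1 := one_mul 1
  -- Since `B² (M + 1) = C² (M + 1)³ ε⁻⁸`, this condition on the mass growth dictates the exponents
  -- 3 and 8; `hδ1`, linear in `B`, leaves room to spare.
  have hδ2 : 3 * n ^ 2 * B ^ 2 * (M + 1) * δ ≤ 1 := by
    have h1 : 3 * n ^ 2 * C ^ 2 * δ ≤ c₃ * δ := by
      refine mul_le_mul_of_nonneg_right ?_ hδ.le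
      change _ ≤ 2 * n * |C| + 3 * n ^ 2 * C ^ 2 + 1
      have : 0 ≤ 2 * (n : ℝ) * |C| := by positivity
      linarith
    calc 3 * n ^ 2 * B ^ 2 * (M + 1) * δ =
          3 * n ^ 2 * C ^ 2 * δ * ((M + 1) ^ 3 * (ε ^ 8)⁻¹) := by
          change 3 * n ^ 2 * (C * (M + 1) * (ε ^ 4)⁻¹) ^ 2 * (M + 1) * δ = _
          field_simp
      _ ≤ ((M + 1) ^ 3)⁻¹ * ε ^ 8 * ((M + 1) ^ 3 * (ε ^ 8)⁻¹) := by
          rw [← hδc]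
          gcongr
      _ = 1 := by field_simp
  have hflow := fun (T : Subdivision 0 1) (hT : T.mesh ≤ δ) =>
    discreteFlow_eq_stateMeasure hn1 hdn hΦ hε0 hM0 hB0 hB hδ1 hδ2 hmass T hT
  have hmem : ∀ T : Subdivision 0 1, T.mesh ≤ δ → ∀ t ∈ Icc (0 : ℝ) 1,
      eulerPolygon (velocity ψ ε V₀) T (initialState n) t ∈
        controlledStates n (Real.exp (2 * B)) := fun T hT t ht =>
    ((hflow T hT).2 t ht).2.mem_controlledStates hB0 ht.1 ht.2
  have hmassflow : ∀ T : Subdivision 0 1, T.mesh ≤ δ → ∀ t ∈ Icc (0 : ℝ) 1,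
      stateMeasure V₀ (eulerPolygon (velocity ψ ε V₀) T (initialState n) t) univ ≤
        ENNReal.ofReal (M + 1) := fun T hT t ht =>
    ((hflow T hT).2 t ht).2.mass_le.trans (ENNReal.ofReal_le_ofReal (by linarith [ht.2]))
  refine ⟨fun T hT => ⟨(hflow T (hfine T hT)).1, fun t ht => ?_⟩, ?_⟩
  · rw [((hflow T (hfine T hT)).2 t ht).1, massMeasure_univ]
    have := isFiniteMeasure_stateMeasure V₀ hdn (hmem T (hfine T hT) t ht)
    exact ⟨isVarifold_of_isFiniteMeasure _, hmassflow T (hfine T hT) t ht⟩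
  obtain ⟨K, hK'⟩ := exists_velocity_lipschitz V₀ hdn hΦ hε0 (Real.exp (2 * B))
  obtain ⟨A, -, hA⟩ := exists_velocity_bound V₀ hdn hΦ hε0 (Real.exp (2 * B))
  -- The dyadic subdivisions serve only as the reference sequence; the limit state `Y t` attracts
  -- the polygons of every sequence with vanishing mesh, so one family serves all of them.
  choose Y hY using fun t : Icc (0 : ℝ) 1 => exists_tendsto_eulerPolygon hK' hA (initialState n)
    hδ hmem tendsto_mesh_dyadic t.2
  have hev : ∀ T : ℕ → Subdivision 0 1, Tendsto (fun j => (T j).mesh) atTop (𝓝 0) →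
      ∀ᶠ j in atTop, (T j).mesh ≤ δ := fun T hT => hT.eventually_le_const hδ
  have hevmem : ∀ T : ℕ → Subdivision 0 1, Tendsto (fun j => (T j).mesh) atTop (𝓝 0) →
      ∀ t : Icc (0 : ℝ) 1, ∀ᶠ j in atTop,
        eulerPolygon (velocity ψ ε V₀) (T j) (initialState n) t ∈
          controlledStates n (Real.exp (2 * B)) := fun T hT t =>
    (hev T hT).mono fun j hj => hmem _ hj t t.2
  have heq : ∀ T : ℕ → Subdivision 0 1, Tendsto (fun j => (T j).mesh) atTop (𝓝 0) →
      ∀ t : Icc (0 : ℝ) 1, ∀ᶠ j in atTop,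
        stateMeasure V₀ (eulerPolygon (velocity ψ ε V₀) (T j) (initialState n) t) =
          discreteFlow ψ ε (T j) V₀ t := fun T hT t =>
    (hev T hT).mono fun j hj => ((hflow _ hj).2 t t.2).1.symm
  have hconv : ∀ T : ℕ → Subdivision 0 1, Tendsto (fun j => (T j).mesh) atTop (𝓝 0) →
      ∀ t : Icc (0 : ℝ) 1,
        WeakStarTendsto (fun j => discreteFlow ψ ε (T j) V₀ t) (stateMeasure V₀ (Y t)) ∧
        Tendsto (fun j => boundedLipschitzDist (discreteFlow ψ ε (T j) V₀ t)
          (stateMeasure V₀ (Y t))) atTop (𝓝 0) := fun T hT t =>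
    ⟨(weakStarTendsto_stateMeasure V₀ hdn (hevmem T hT t) (hY t T hT)).congr (heq T hT t),
      (tendsto_boundedLipschitzDist_stateMeasure V₀ hdn (hevmem T hT t) (hY t T hT)).congr'
        ((heq T hT t).mono fun j hj => by rw [hj])⟩
  have hvar : ∀ t : Icc (0 : ℝ) 1, IsVarifold (stateMeasure V₀ (Y t)) := fun t => by
    have hYt : Y t ∈ controlledStates n (Real.exp (2 * B)) :=
      (isClosed_controlledStates n _).mem_of_tendsto (hY t _ tendsto_mesh_dyadic)
        (hevmem _ tendsto_mesh_dyadic t)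
    have := isFiniteMeasure_stateMeasure V₀ hdn hYt
    exact isVarifold_of_isFiniteMeasure _
  refine ⟨fun t => stateMeasure V₀ (Y t), fun t => ⟨hvar t, ?_, hconv _ tendsto_mesh_dyadic t⟩,
    hconv, fun T hT W hW hWT => ?_⟩
  · rw [massMeasure_univ]
    exact stateMeasure_univ_le_of_tendsto V₀ hdn (hevmem _ tendsto_mesh_dyadic t)
      (hY t _ tendsto_mesh_dyadic) (by linarith)
      ((hev _ tendsto_mesh_dyadic).mono fun j hj => hmassflow _ hj t t.2)
  · funext t
    have h1 : (W t).Regular := hW t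
    have h2 : (stateMeasure V₀ (Y t)).Regular := hvar t
    exact (hWT t).unique (hconv T hT t).1
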